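/- **Lemma (Dolbeault–Grothendieck).** *The model.* Let $d\ge 2$, $\alpha>0$, $\eta=\mathrm{diag}(-1,1,\dots,1)$, and let $\beta,a\in\mathbb R$ belong either to the continuous unitary series $$a\le 1,\qquad 0<\beta\le \tfrac{24-d}{48},$$ or to the discrete unitary series $$\beta=\tfrac{24-d}{48}+\tfrac1{8m(m+1)},\quad a=1-\tfrac{((m+1)r-ms)^2-1}{4m(m+1)},\qquad m\ge2,\ 1\le r\le m-1,\ 1\le s\le r,$$ the critical values $\beta=\frac{25-d}{48}$, $a=1$ being excluded. For $p\in\mathbb R^{d}$ let $\mathcal H(p)$ be the complex bosonic Fock space generated from a vacuum by the creation operators with $m<0$ among $a^\mu_m$ ($0\le\mu\le d-1$) and $u_m$, where $$[a^\mu_m,a^\nu_n]=m\,\eta^{\mu\nu}\delta_{m+n},\qquad [u_m,u_n]=m\,\delta_{m+n},\qquad [a^\mu_m,u_n]=0,$$ the modes with $m>0$ annihilate the vacuum, $a_0^\mu=p^\mu/\sqrt\alpha$ and $u_0=0$. With $\sqrt\beta$ the principal (possibly complex) square root, put $$L_m=\tfrac12\sum_{k\in\mathbb Z}{:}a_{m+k}\cdot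 a_{-k}{:}+\tfrac12\sum_{k\in\mathbb Z}{:}u_{m+k}u_{-k}{:}+2i\sqrt\beta\,m\,u_m+2\beta\,\delta_{m,0}.$$ Let $\mathcal C_{\rm gh}$ be the fermionic Fock space of ghosts $c_m$ and anti-ghosts $b_m$, $m\in\mathbb Z$, with $\{b_m,c_n\}=\delta_{m+n}$, $\{b_m,b_n\}=\{c_m,c_n\}=0$, and vacuum annihilated by $c_m$ ($m>0$) and $b_m$ ($m\ge0$). Normal ordering of ghosts is taken with respect to this vacuum, with $:c_0b_0:\,=\frac12(c_0b_0-b_0c_0)$. Put $$\mathcal L_m=\sum_{k\in\mathbb Z}(k-m):c_{-k}b_{m+k}:,\qquad d_{\rm gh}=\tfrac12\sum_{m>0}c_{-m}\mathcal L_m+\tfrac12c_0\mathcal L_0+\tfrac12\sum_{m>0}\mathcal L_{-m}c_m,$$ and, on $\mathcal C(p)=\mathcal H(p)\otimes\mathcal C_{\rm gh}$, $$D=\sum_{m\in\mathbb Z}(L_m-\delta_{m,0}a)\otimes c_{-m}+1\otimes d_{\rm gh},\qquad L_m^{\rm tot}=\{b_m,D\}.$$ *The complex.* The polarized space is $\mathcal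 P(p)=\{\Psi\in\mathcal C(p): [L^{\rm tot}_m,D]\Psi=0\text{ for all }m\ge0\}$. For integers $a,b$ (here $a$ denotes a degree, not the intercept above) let $\mathcal P^a_b(p)$ be the space of all $\Psi\in\mathcal P(p)$ with $b_0\Psi=0$, $\sum_{m>0}c_{-m}b_m\Psi=a\Psi$ and $\sum_{m>0}b_{-m}c_m\Psi=b\Psi$; that is, $a$ counts the $c_{-m}$ excitations and $b$ the $b_{-m}$ excitations, $m>0$. Define $$\overline{\mathcal D}=\sum_{m>0}L_m\otimes c_{-m}+\sum_{m>0}c_{-m}\tau_m+\overline\partial,$$ $$\tau_m=\sum_{k>m}(m+k)\,b_{m-k}c_k,\qquad \overline\partial=-\tfrac12\sum_{m,k>0}(m-k)\,c_{-m}c_{-k}b_{k+m}.$$ *Claim.* Let $p\ne0$, let $b\in\mathbb Z$ and let $a>0$ be an integer. Then every element of $\overline{\mathcal D}\,\mathcal P^{a-1}_b(p)$ is a $\overline{\mathcal D}$-closed element of $\mathcal P^a_b(p)$, and $$\overline{\mathcal H}{}^a_b(p)=\frac{\ker\overline{\mathcal D}|_{\mathcal P^a_b(p)}}{\overline{\mathcal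 D}\,\mathcal P^{a-1}_b(p)}=0 .$$ The same holds if the spaces $\mathcal P^{\bullet}_b(p)$ are replaced by their subspaces on the mass shell, $L^{\rm tot}_0\Psi=0$, and if they are replaced by their subspaces of fixed level $N$, for each $N\ge 0$, where the level operator is $(L_0-\frac{p^2}{2\alpha}-2\beta)\otimes1+1\otimes\mathcal L_0$ with $p^2=\eta_{\mu\nu}p^\mu p^\nu$. -/

import Mathlib

noncomputable section

namespace MassiveBRST

open scoped TensorProduct

/-! ### Pointwise finite sums of endomorphisms -/

/-- A family of endomorphisms is pointwise finite if each vector is annihilated by all but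
finitely many members of the family. -/
def PointwiseFinite {ι V : Type*} [AddCommGroup V] [Module ℂ V] (T : ι → Module.End ℂ V) : Prop :=
  ∀ v, {i | T i v ≠ 0}.Finite

/-- The sum `v ↦ ∑ i, T i v` of a pointwise finite family of endomorphisms. -/
def pfSum {ι V : Type*} [AddCommGroup V] [Module ℂ V] (T : ι → Module.End ℂ V)
    (hT : PointwiseFinite T) : Module.End ℂ V where
  toFun v := ∑ᶠ i, T i v
  map_add' v w := by
    simp only [map_add]
    exact finsum_add_distrib (hT v) (hT w)
  map_smul' z v := by
    simp only [map_smul, RingHom.id_apply]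
    exact (smul_finsum' z (hT v)).symm

/-- The quotient `Z / (Z ∩ B)` for submodules `Z`, `B` of a common space. -/
abbrev Subquotient {V : Type*} [AddCommGroup V] [Module ℂ V] (Z B : Submodule ℂ V) : Type _ :=
  Z ⧸ B.submoduleOf Z

/-! ### Parameters of the model -/

/-- The parameters of a massive string: the space-time dimension `d`, the couplings `α`, `β` of
the action, and the intercept `a`, which fixes the beginning of the mass spectrum. -/
structure MassiveString where
  d : ℕ
  α : ℝ
  β : ℝ
  a : ℝ

namespace MassiveString

/-- The continuous series of unitary massive strings. -/
def IsContinuousSeries (S : MassiveString) : Prop :=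
  S.a ≤ 1 ∧ 0 < S.β ∧ S.β ≤ (24 - (S.d : ℝ)) / 48

/-- The discrete series of unitary massive strings. -/
def IsDiscreteSeries (S : MassiveString) : Prop :=
  ∃ m r s : ℕ, 2 ≤ m ∧ 1 ≤ r ∧ r ≤ m - 1 ∧ 1 ≤ s ∧ s ≤ r ∧
    S.β = (24 - (S.d : ℝ)) / 48 + 1 / (8 * (m : ℝ) * ((m : ℝ) + 1)) ∧
    S.a = 1 - ((((m : ℝ) + 1) * r - m * s) ^ 2 - 1) / (4 * (m : ℝ) * ((m : ℝ) + 1))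

/-- The critical values of the parameters. -/
def IsCritical (S : MassiveString) : Prop :=
  S.β = (25 - (S.d : ℝ)) / 48 ∧ S.a = 1

/-- The space `ℝ^d` of momenta, in contravariant components `p^0, …, p^(d-1)`. -/
abbrev Momentum (S : MassiveString) : Type := Fin S.d → ℝ

variable (S : MassiveString)

/-! ### The matter sector -/

/-- The labels of the families of oscillators: `some μ` stands for `a^μ` and `none` for the
Liouville modes `u`. -/
abbrev Label : Type := Option (Fin S.d)

/-- The metric `η = diag (-1, 1, …, 1)` on the space-time labels, together with `+1` for the
Liouville label. -/
def metric : S.Label → ℝ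
  | none => 1
  | some μ => if μ.val = 0 then -1 else 1

/-- The Minkowski square `p² = η_μν p^μ p^ν`. -/
def momentumSq (p : S.Momentum) : ℝ := ∑ μ, S.metric (some μ) * p μ ^ 2

/-- The bosonic Fock space: polynomials in the creation operators, with the variable `(i, k)`
being the mode of frequency `-(k+1)` of the oscillator family `i`; the vacuum is `1`. -/
abbrev Matter : Type := MvPolynomial (S.Label × ℕ) ℂ

/-- The zero modes: `a_0^μ = p^μ / √α` and `u_0 = 0`. -/
def zeroMode (p : S.Momentum) : S.Label → ℝ
  | none => 0
  | some μ => p μ / √S.α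

/-- The modes `a^μ_n`, `u_n` on the Fock space over momentum `p`: multiplication by a variable for
`n < 0`, a scalar for `n = 0`, and `n η^{μμ}` times a partial derivative for `n > 0`. -/
def osc (p : S.Momentum) (i : S.Label) : ℤ → Module.End ℂ S.Matter
  | Int.ofNat 0 => (S.zeroMode p i : ℂ) • 1
  | Int.ofNat (k + 1) =>
      (((k + 1 : ℕ) : ℂ) * (S.metric i : ℂ)) • (MvPolynomial.pderiv (i, k)).toLinearMap
  | Int.negSucc k => LinearMap.mulLeft ℂ (MvPolynomial.X (i, k))

/-- The normally ordered product `:α_m α_n:` of two modes of the same family. -/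
def normalOsc (p : S.Momentum) (i : S.Label) (m n : ℤ) : Module.End ℂ S.Matter :=
  if m ≤ n then S.osc p i m * S.osc p i n else S.osc p i n * S.osc p i m

theorem osc_eventually_zero (p : S.Momentum) (v : S.Matter) :
    ∃ N : ℕ, ∀ n : ℤ, (N : ℤ) ≤ n → ∀ i, S.osc p i n v = 0 := by
  refine ⟨v.vars.sup Prod.snd + 2, ?_⟩
  intro n hn i
  match n, hn with
  | Int.ofNat 0, hn => simp at hn; omega
  | Int.ofNat (k + 1), hn =>
    have hk : (i, k) ∉ v.vars := by
      intro h
      have := Finset.le_sup (f := Prod.snd) h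
      simp at hn this
      omega
    simp [osc, MvPolynomial.pderiv_eq_zero_of_notMem_vars hk]
  | Int.negSucc k, hn => exact absurd hn (by have := Int.negSucc_lt_zero k; omega)

theorem normalOsc_eq_zero {p : S.Momentum} {v : S.Matter} {N : ℕ}
    (hN : ∀ n : ℤ, (N : ℤ) ≤ n → ∀ i, S.osc p i n v = 0) (i : S.Label) (m n : ℤ)
    (h : (N : ℤ) ≤ m ∨ (N : ℤ) ≤ n) : S.normalOsc p i m n v = 0 := by
  unfold normalOsc
  split_ifs with hmn
  · simp [hN n (by omega) i]
  · simp [hN m (by omega) i]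

theorem virasoro_pointwiseFinite (p : S.Momentum) (m : ℤ) : PointwiseFinite fun k : ℤ =>
    ∑ i, (S.metric i : ℂ) • S.normalOsc p i (m + k) (-k) := by
  intro v
  obtain ⟨N, hN⟩ := S.osc_eventually_zero p v
  refine (Set.finite_Ioo (-(N : ℤ)) (N - m)).subset ?_
  intro k hk
  by_contra hc
  apply hk
  simp only [LinearMap.sum_apply, LinearMap.smul_apply]
  refine Finset.sum_eq_zero fun i _ => ?_
  rw [S.normalOsc_eq_zero hN i (m + k) (-k), smul_zero]
  simp only [Set.mem_Ioo, not_and_or, not_lt] at hc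
  omega

/-- The matter Virasoro operators
`L_m = ½ ∑_k :a_{m+k} · a_{-k}: + ½ ∑_k :u_{m+k} u_{-k}: + 2 i √β m u_m + 2 β δ_{m,0}`.
The root is the complex principal one; it is the usual real root when `β ≥ 0`. -/
def virasoro (p : S.Momentum) (m : ℤ) : Module.End ℂ S.Matter :=
  (1 / 2 : ℂ) • pfSum (fun k : ℤ => ∑ i, (S.metric i : ℂ) • S.normalOsc p i (m + k) (-k))
      (S.virasoro_pointwiseFinite p m)
    + (2 * Complex.I * (S.β : ℂ) ^ (1 / 2 : ℂ) * (m : ℂ)) • S.osc p none m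
    + (if m = 0 then 2 * (S.β : ℂ) else 0) • 1

theorem virasoro_eventually_zero (p : S.Momentum) (v : S.Matter) :
    ∃ N : ℕ, ∀ m : ℤ, (N : ℤ) ≤ m → S.virasoro p m v = 0 := by
  obtain ⟨N, hN⟩ := S.osc_eventually_zero p v
  refine ⟨2 * N + 1, fun m hm => ?_⟩
  have h0 : m ≠ 0 := by omega
  have h1 : ∀ k : ℤ, (∑ i, (S.metric i : ℂ) • S.normalOsc p i (m + k) (-k)) v = 0 := by
    intro k
    simp only [LinearMap.sum_apply, LinearMap.smul_apply]
    refine Finset.sum_eq_zero fun i _ => ?_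
    rw [S.normalOsc_eq_zero hN i (m + k) (-k) (by omega), smul_zero]
  have h2 : pfSum _ (S.virasoro_pointwiseFinite p m) v = 0 :=
    (finsum_congr h1).trans finsum_zero
  rw [virasoro, if_neg h0, LinearMap.add_apply, LinearMap.add_apply, LinearMap.smul_apply, h2,
    LinearMap.smul_apply, hN m (by omega)]
  simp

end MassiveString

/-! ### The ghost sector -/

/-- The span of the ghost creation operators: `Sum.inl k` stands for `c_{-k}` and `Sum.inr k` for
`b_{-(k+1)}`. -/
abbrev GhostModes : Type := (ℕ ⊕ ℕ) →₀ ℂ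

/-- The ghost Fock space: the exterior algebra on the ghost creation operators; the vacuum is `1`. -/
abbrev Ghost : Type := ExteriorAlgebra ℂ GhostModes

/-- The operator creating the mode `j`. -/
def ghostCreate (j : ℕ ⊕ ℕ) : Module.End ℂ Ghost :=
  LinearMap.mulLeft ℂ (ExteriorAlgebra.ι ℂ (Finsupp.single j 1))

/-- The operator annihilating the mode `j`: the antiderivation dual to `ghostCreate j`. -/
def ghostAnnihilate (j : ℕ ⊕ ℕ) : Module.End ℂ Ghost :=
  CliffordAlgebra.contractLeft (Q := (0 : QuadraticForm ℂ GhostModes)) (Finsupp.lapply j)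

/-- The ghost modes `c_n`; those with `n > 0` annihilate the vacuum. -/
def ghostC : ℤ → Module.End ℂ Ghost
  | Int.ofNat 0 => ghostCreate (Sum.inl 0)
  | Int.ofNat (k + 1) => ghostAnnihilate (Sum.inr k)
  | Int.negSucc k => ghostCreate (Sum.inl (k + 1))

/-- The anti-ghost modes `b_n`; those with `n ≥ 0` annihilate the vacuum. -/
def ghostB : ℤ → Module.End ℂ Ghost
  | Int.ofNat k => ghostAnnihilate (Sum.inl k)
  | Int.negSucc k => ghostCreate (Sum.inr k)

/-- The normally ordered product `:c_r b_s:`, antisymmetrized for the zero modes. -/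
def normalCB (r s : ℤ) : Module.End ℂ Ghost :=
  if r = 0 ∧ s = 0 then (1 / 2 : ℂ) • (ghostC 0 * ghostB 0 - ghostB 0 * ghostC 0)
  else if 0 ≤ s then ghostC r * ghostB s
  else -(ghostB s * ghostC r)

theorem ghostAnnihilate_eventually_zero (v : Ghost) :
    ∃ N : ℕ, ∀ k, N ≤ k → ghostAnnihilate (Sum.inl k) v = 0 ∧ ghostAnnihilate (Sum.inr k) v = 0 := by
  induction v using CliffordAlgebra.left_induction with
  | algebraMap r => exact ⟨0, fun k _ => by
      simp [ghostAnnihilate, CliffordAlgebra.contractLeft_algebraMap]⟩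
  | add x y hx hy =>
    obtain ⟨N, hN⟩ := hx
    obtain ⟨M, hM⟩ := hy
    exact ⟨max N M, fun k hk => by
      simp [hN k (le_trans (le_max_left _ _) hk), hM k (le_trans (le_max_right _ _) hk)]⟩
  | ι_mul x m hx =>
    obtain ⟨N, hN⟩ := hx
    have hm : ∃ M : ℕ, ∀ k, M ≤ k → m (Sum.inl k) = 0 ∧ m (Sum.inr k) = 0 := by
      refine ⟨m.support.sup (Sum.elim id id) + 1, fun k hk => ?_⟩
      constructor
      all_goals
        by_contra hne
        have := Finset.le_sup (f := Sum.elim id id) (Finsupp.mem_support_iff.mpr hne)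
        simp only [Sum.elim_inl, Sum.elim_inr, id_eq] at this
        omega
    obtain ⟨M, hM⟩ := hm
    refine ⟨max N M, fun k hk => ?_⟩
    have h1 := hN k (le_trans (le_max_left _ _) hk)
    have h2 := hM k (le_trans (le_max_right _ _) hk)
    simp only [ghostAnnihilate] at h1 ⊢
    simp [CliffordAlgebra.contractLeft_ι_mul, h1, h2]

theorem ghost_eventually_zero (v : Ghost) :
    ∃ N : ℕ, ∀ n : ℤ, (N : ℤ) ≤ n → ghostC n v = 0 ∧ ghostB n v = 0 := by
  obtain ⟨N, hN⟩ := ghostAnnihilate_eventually_zero v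
  refine ⟨N + 2, fun n hn => ?_⟩
  match n, hn with
  | Int.ofNat 0, hn => simp at hn; omega
  | Int.ofNat (k + 1), hn =>
    simp at hn
    exact ⟨(hN k (by omega)).2, (hN (k + 1) (by omega)).1⟩
  | Int.negSucc k, hn => exact absurd hn (by have := Int.negSucc_lt_zero k; omega)

theorem normalCB_eq_zero {v : Ghost} {N : ℕ}
    (hN : ∀ n : ℤ, (N : ℤ) ≤ n → ghostC n v = 0 ∧ ghostB n v = 0) (r s : ℤ)
    (h : (0 < r ∧ (N : ℤ) ≤ r ∧ s < 0) ∨ (0 < s ∧ (N : ℤ) ≤ s)) : normalCB r s v = 0 := by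
  unfold normalCB
  rcases h with ⟨h0, h1, h2⟩ | ⟨h0, h1⟩
  · rw [if_neg (by omega), if_neg (by omega)]
    simp [(hN r h1).1]
  · rw [if_neg (by omega), if_pos (by omega)]
    simp [(hN s h1).2]

theorem ghostVirasoro_pointwiseFinite (m : ℤ) : PointwiseFinite fun k : ℤ =>
    ((k - m : ℤ) : ℂ) • normalCB (-k) (m + k) := by
  intro v
  obtain ⟨N, hN⟩ := ghost_eventually_zero v
  refine (Set.finite_Ioo (-(N : ℤ) - |m| - 1) (N + |m| + 1)).subset ?_
  intro k hk
  by_contra hc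
  apply hk
  have hm1 := le_abs_self m
  have hm2 := neg_abs_le m
  simp only [Set.mem_Ioo, not_and_or, not_lt] at hc
  rw [LinearMap.smul_apply, normalCB_eq_zero hN (-k) (m + k) (by omega), smul_zero]

/-- The ghost Virasoro operators `𝓛_m = ∑_k (k - m) :c_{-k} b_{m+k}:`. -/
def ghostVirasoro (m : ℤ) : Module.End ℂ Ghost :=
  pfSum (fun k : ℤ => ((k - m : ℤ) : ℂ) • normalCB (-k) (m + k)) (ghostVirasoro_pointwiseFinite m)

theorem normalCB_eq_zero' {v : Ghost} {N : ℕ}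
    (hN : ∀ n : ℤ, (N : ℤ) ≤ n → ghostC n v = 0 ∧ ghostB n v = 0) (r s : ℤ)
    (h : 2 * (N : ℤ) + 1 ≤ r + s) : normalCB r s v = 0 := by
  by_cases hs : 0 < s ∧ (N : ℤ) ≤ s
  · exact normalCB_eq_zero hN r s (Or.inr hs)
  by_cases hs' : s < 0
  · exact normalCB_eq_zero hN r s (Or.inl ⟨by omega, by omega, hs'⟩)
  have hanti : ∀ (j l : ℕ ⊕ ℕ) (w : Ghost),
      ghostAnnihilate j (ghostAnnihilate l w) = -ghostAnnihilate l (ghostAnnihilate j w) :=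
    fun j l w => CliffordAlgebra.contractLeft_comm _ _ w
  unfold normalCB
  rw [if_neg (by omega), if_pos (by omega)]
  have hr : ghostC r v = 0 := (hN r (by omega)).1
  obtain ⟨k, rfl⟩ : ∃ k : ℕ, r = Int.ofNat (k + 1) :=
    ⟨(r - 1).toNat, by simp only [Int.ofNat_eq_natCast]; omega⟩
  obtain ⟨l, rfl⟩ : ∃ l : ℕ, s = Int.ofNat l := ⟨s.toNat, by simp only [Int.ofNat_eq_natCast]; omega⟩
  simp only [ghostC, ghostB, Module.End.mul_apply] at hr ⊢
  rw [hanti, hr, map_zero, neg_zero]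

theorem ghostVirasoro_eventually_zero (v : Ghost) :
    ∃ N : ℕ, ∀ m : ℤ, (N : ℤ) ≤ m → ghostVirasoro m v = 0 := by
  obtain ⟨N, hN⟩ := ghost_eventually_zero v
  refine ⟨2 * N + 1, fun m hm => ?_⟩
  have h1 : ∀ k : ℤ, normalCB (-k) (m + k) v = 0 := fun k =>
    normalCB_eq_zero' hN _ _ (by push_cast at hm; omega)
  simp [ghostVirasoro, pfSum, h1]

theorem pnat_finite_of_eventually {P : ℕ+ → Prop} (N : ℕ) (h : ∀ m : ℕ+, N ≤ (m : ℕ) → ¬ P m) :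
    {m | P m}.Finite := by
  refine (Set.finite_Iic (Nat.succPNat N)).subset fun m hm => ?_
  by_contra hc
  rw [Set.mem_Iic, not_le, ← PNat.coe_lt_coe, Nat.succPNat_coe] at hc
  exact h m (by omega) hm

theorem pointwiseFinite_left_mul (A B : ℕ+ → Module.End ℂ Ghost)
    (hB : ∀ v, ∃ N : ℕ, ∀ m : ℕ+, N ≤ (m : ℕ) → B m v = 0) :
    PointwiseFinite fun m : ℕ+ => A m * B m := by
  intro v
  obtain ⟨N, hN⟩ := hB v
  exact pnat_finite_of_eventually N fun m hm h => h (by simp [hN m hm])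

theorem ghostC_pnat (v : Ghost) : ∃ N : ℕ, ∀ m : ℕ+, N ≤ (m : ℕ) → ghostC (m : ℤ) v = 0 := by
  obtain ⟨N, hN⟩ := ghost_eventually_zero v
  exact ⟨N, fun m hm => (hN _ (by exact_mod_cast hm)).1⟩

theorem ghostB_pnat (v : Ghost) : ∃ N : ℕ, ∀ m : ℕ+, N ≤ (m : ℕ) → ghostB (m : ℤ) v = 0 := by
  obtain ⟨N, hN⟩ := ghost_eventually_zero v
  exact ⟨N, fun m hm => (hN _ (by exact_mod_cast hm)).2⟩

theorem ghostVirasoro_pnat (v : Ghost) :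
    ∃ N : ℕ, ∀ m : ℕ+, N ≤ (m : ℕ) → ghostVirasoro (m : ℤ) v = 0 := by
  obtain ⟨N, hN⟩ := ghostVirasoro_eventually_zero v
  exact ⟨N, fun m hm => hN _ (by exact_mod_cast hm)⟩

/-- The ghost differential
`d_gh = ½ ∑_{m>0} c_{-m} 𝓛_m + ½ c_0 𝓛_0 + ½ ∑_{m>0} 𝓛_{-m} c_m`. -/
def ghostDifferential : Module.End ℂ Ghost :=
  (1 / 2 : ℂ) • pfSum (fun m : ℕ+ => ghostC (-(m : ℤ)) * ghostVirasoro (m : ℤ))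
      (pointwiseFinite_left_mul _ _ ghostVirasoro_pnat)
    + (1 / 2 : ℂ) • (ghostC 0 * ghostVirasoro 0)
    + (1 / 2 : ℂ) • pfSum (fun m : ℕ+ => ghostVirasoro (-(m : ℤ)) * ghostC (m : ℤ))
      (pointwiseFinite_left_mul _ _ ghostC_pnat)

/-- The operator `∑_{m>0} c_{-m} b_m` counting the excitations `c_{-m}`, `m > 0`. -/
def countC : Module.End ℂ Ghost :=
  pfSum (fun m : ℕ+ => ghostC (-(m : ℤ)) * ghostB (m : ℤ))
    (pointwiseFinite_left_mul _ _ ghostB_pnat)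

/-- The operator `∑_{m>0} b_{-m} c_m` counting the excitations `b_{-m}`, `m > 0`. -/
def countB : Module.End ℂ Ghost :=
  pfSum (fun m : ℕ+ => ghostB (-(m : ℤ)) * ghostC (m : ℤ))
    (pointwiseFinite_left_mul _ _ ghostC_pnat)

theorem tau_pointwiseFinite (m : ℕ+) : PointwiseFinite fun j : ℕ+ =>
    ((2 * (m : ℕ) + (j : ℕ) : ℕ) : ℂ) • (ghostB (-(j : ℤ)) * ghostC ((m : ℤ) + (j : ℤ))) := by
  intro v
  obtain ⟨N, hN⟩ := ghost_eventually_zero v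
  exact pnat_finite_of_eventually N fun j hj h => h (by
    have : (N : ℤ) ≤ (m : ℤ) + (j : ℤ) := by
      have : (N : ℤ) ≤ ((j : ℕ) : ℤ) := by exact_mod_cast hj
      have h2 := m.pos
      omega
    simp [(hN _ this).1])

/-- `τ_m = ∑_{k>m} (m + k) b_{m-k} c_k` for `m > 0`, the sum being over `j = k - m > 0`. -/
def tau (m : ℕ+) : Module.End ℂ Ghost :=
  pfSum (fun j : ℕ+ =>
    ((2 * (m : ℕ) + (j : ℕ) : ℕ) : ℂ) • (ghostB (-(j : ℤ)) * ghostC ((m : ℤ) + (j : ℤ))))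
    (tau_pointwiseFinite m)

theorem tau_pnat (v : Ghost) : ∃ N : ℕ, ∀ m : ℕ+, N ≤ (m : ℕ) → tau m v = 0 := by
  obtain ⟨N, hN⟩ := ghost_eventually_zero v
  refine ⟨N, fun m hm => ?_⟩
  have h1 : ∀ j : ℕ+, ghostC ((m : ℤ) + (j : ℤ)) v = 0 := fun j =>
    (hN _ (by
      have : (N : ℤ) ≤ ((m : ℕ) : ℤ) := by exact_mod_cast hm
      omega)).1
  simp [tau, pfSum, h1]

theorem delBar_pointwiseFinite : PointwiseFinite fun q : ℕ+ × ℕ+ =>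
    (((q.1 : ℤ) - (q.2 : ℤ) : ℤ) : ℂ) •
      (ghostC (-(q.1 : ℤ)) * ghostC (-(q.2 : ℤ)) * ghostB ((q.2 : ℤ) + (q.1 : ℤ))) := by
  intro v
  obtain ⟨N, hN⟩ := ghost_eventually_zero v
  have hfin := (Set.finite_Iic (Nat.succPNat N))
  refine (hfin.prod hfin).subset ?_
  rintro ⟨m, k⟩ hmk
  by_contra hc
  apply hmk
  have hsum : (N : ℤ) ≤ (k : ℤ) + (m : ℤ) := by
    simp only [Set.mem_prod, Set.mem_Iic, not_and_or, not_le, ← PNat.coe_lt_coe,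
      Nat.succPNat_coe] at hc
    omega
  rw [LinearMap.smul_apply]
  rw [Module.End.mul_apply, (hN _ hsum).2, map_zero, smul_zero]

/-- `∂̄ = -½ ∑_{m,k>0} (m - k) c_{-m} c_{-k} b_{k+m}`. -/
def delBar : Module.End ℂ Ghost :=
  (-(1 / 2) : ℂ) • pfSum (fun q : ℕ+ × ℕ+ =>
    (((q.1 : ℤ) - (q.2 : ℤ) : ℤ) : ℂ) •
      (ghostC (-(q.1 : ℤ)) * ghostC (-(q.2 : ℤ)) * ghostB ((q.2 : ℤ) + (q.1 : ℤ))))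
    delBar_pointwiseFinite

namespace MassiveString

variable (S : MassiveString)

/-! ### The string differential space over a fixed momentum -/

/-- The string differential space over a fixed momentum: matter tensor ghosts. -/
abbrev Space : Type := S.Matter ⊗[ℂ] Ghost

/-- The action of a matter operator on the total space. -/
def onMatter (A : Module.End ℂ S.Matter) : Module.End ℂ S.Space := TensorProduct.map A 1

/-- The action of a ghost operator on the total space. -/
def onGhost (B : Module.End ℂ Ghost) : Module.End ℂ S.Space := TensorProduct.map 1 B

theorem tensor_pointwiseFinite {ι : Type*} (A : ι → Module.End ℂ S.Matter)
    (B : ι → Module.End ℂ Ghost) (h : ∀ x y, {i | A i x ≠ 0 ∧ B i y ≠ 0}.Finite) :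
    PointwiseFinite fun i => (TensorProduct.map (A i) (B i) : Module.End ℂ S.Space) := by
  intro v
  induction v using TensorProduct.induction_on with
  | zero => simp
  | tmul x y =>
    refine (h x y).subset fun i hi => ?_
    simp only [Set.mem_ofPred_eq, TensorProduct.map_tmul] at hi ⊢
    exact ⟨fun h0 => hi (by rw [h0, TensorProduct.zero_tmul]),
      fun h0 => hi (by rw [h0, TensorProduct.tmul_zero])⟩
  | add v w hv hw =>
    refine (hv.union hw).subset fun i hi => ?_
    simp only [Set.mem_ofPred_eq, Set.mem_union, map_add] at hi ⊢
    by_contra hc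
    push Not at hc
    exact hi (by rw [hc.1, hc.2, add_zero])

theorem brst_pointwiseFinite (p : S.Momentum) : PointwiseFinite fun m : ℤ =>
    (TensorProduct.map (S.virasoro p m - (if m = 0 then (S.a : ℂ) else 0) • 1) (ghostC (-m)) :
      Module.End ℂ S.Space) := by
  refine S.tensor_pointwiseFinite _ _ fun x y => ?_
  obtain ⟨N, hN⟩ := S.virasoro_eventually_zero p x
  obtain ⟨M, hM⟩ := ghost_eventually_zero y
  refine (Set.finite_Ioo (-(M : ℤ)) (N + 1)).subset fun m hm => ?_
  by_contra hc
  simp only [Set.mem_Ioo, not_and_or, not_lt] at hc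
  rcases hc with hc | hc
  · exact hm.2 (hM _ (by omega)).1
  · have h0 : m ≠ 0 := by omega
    exact hm.1 (by simp [h0, hN m (by omega)])

/-- The BRST differential `D = ∑_m (L_m - δ_{m,0} a) ⊗ c_{-m} + 1 ⊗ d_gh`. -/
def brst (p : S.Momentum) : Module.End ℂ S.Space :=
  pfSum (fun m : ℤ =>
      (TensorProduct.map (S.virasoro p m - (if m = 0 then (S.a : ℂ) else 0) • 1) (ghostC (-m)) :
        Module.End ℂ S.Space)) (S.brst_pointwiseFinite p)
    + S.onGhost ghostDifferential

/-- The ghost-extended constraints `L_m^tot = {b_m, D}`. -/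
def totalVirasoro (p : S.Momentum) (m : ℤ) : Module.End ℂ S.Space :=
  S.onGhost (ghostB m) * S.brst p + S.brst p * S.onGhost (ghostB m)

/-- The space of the polarized complex over `p`: all `Ψ` with `[L_m^tot, D] Ψ = 0` for `m ≥ 0`. -/
def polarized (p : S.Momentum) : Submodule ℂ S.Space :=
  ⨅ m : ℕ, LinearMap.ker
    (S.totalVirasoro p (m : ℤ) * S.brst p - S.brst p * S.totalVirasoro p (m : ℤ))

theorem dBar_pointwiseFinite (p : S.Momentum) : PointwiseFinite fun m : ℕ+ =>
    (TensorProduct.map (S.virasoro p (m : ℤ)) (ghostC (-(m : ℤ))) : Module.End ℂ S.Space) := by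
  refine S.tensor_pointwiseFinite _ _ fun x y => ?_
  obtain ⟨N, hN⟩ := S.virasoro_eventually_zero p x
  exact pnat_finite_of_eventually N fun m hm h => h.1 (hN _ (by exact_mod_cast hm))

/-- `D̄ = ∑_{m>0} L_m ⊗ c_{-m} + ∑_{m>0} c_{-m} τ_m + ∂̄`. -/
def dBar (p : S.Momentum) : Module.End ℂ S.Space :=
  pfSum (fun m : ℕ+ =>
      (TensorProduct.map (S.virasoro p (m : ℤ)) (ghostC (-(m : ℤ))) : Module.End ℂ S.Space))
      (S.dBar_pointwiseFinite p)
    + S.onGhost (pfSum (fun m : ℕ+ => ghostC (-(m : ℤ)) * tau m)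
      (pointwiseFinite_left_mul _ _ tau_pnat))
    + S.onGhost delBar

/-- The operator of total level, `(L_0 - p²/(2α) - 2β) ⊗ 1 + 1 ⊗ 𝓛_0`. -/
def levelOperator (p : S.Momentum) : Module.End ℂ S.Space :=
  S.onMatter (S.virasoro p 0 - ((S.momentumSq p / (2 * S.α) + 2 * S.β : ℝ) : ℂ) • 1)
    + S.onGhost (ghostVirasoro 0)

/-- The subspace of total level `N`. -/
def levelSpace (p : S.Momentum) (N : ℕ) : Submodule ℂ S.Space :=
  LinearMap.ker (S.levelOperator p - (N : ℂ) • 1)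

/-- The on-mass-shell subspace, the kernel of `L_0^tot`. -/
def onShell (p : S.Momentum) : Submodule ℂ S.Space :=
  LinearMap.ker (S.totalVirasoro p 0)

/-! ### The bigraded relative complex and its cohomology -/

/-- The polarized relative cochains (`b_0 Ψ = 0`) lying in the subspace `W`, of ghost excitation
degree `a` and anti-ghost excitation degree `b`. -/
def cochains (p : S.Momentum) (W : Submodule ℂ S.Space) (a b : ℤ) : Submodule ℂ S.Space :=
  S.polarized p ⊓ W ⊓ LinearMap.ker (S.onGhost (ghostB 0))
    ⊓ LinearMap.ker (S.onGhost countC - (a : ℂ) • 1)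
    ⊓ LinearMap.ker (S.onGhost countB - (b : ℂ) • 1)

/-- The `D̄`-closed cochains. -/
def cocycles (p : S.Momentum) (W : Submodule ℂ S.Space) (a b : ℤ) : Submodule ℂ S.Space :=
  S.cochains p W a b ⊓ LinearMap.ker (S.dBar p)

/-- The image under `D̄` of the cochains of bidegree `(a - 1, b)`. -/
def coboundaries (p : S.Momentum) (W : Submodule ℂ S.Space) (a b : ℤ) : Submodule ℂ S.Space :=
  (S.cochains p W (a - 1) b).map (S.dBar p)

/-- The bigraded cohomology of `D̄`: cocycles modulo coboundaries. -/
abbrev cohomology (p : S.Momentum) (W : Submodule ℂ S.Space) (a b : ℤ) : Type :=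
  Subquotient (S.cocycles p W a b) (S.coboundaries p W a b)

/-- In bidegree `(a, b)` the coboundaries are cocycles and the cohomology of `D̄` is zero. -/
def CohomologyVanishes (p : S.Momentum) (W : Submodule ℂ S.Space) (a b : ℤ) : Prop :=
  S.coboundaries p W a b ≤ S.cocycles p W a b ∧ Subsingleton (S.cohomology p W a b)

end MassiveString

end MassiveBRST

end

/-! The commutator `[L_m^tot, D]` is a scalar multiple of `c_m`. The scalar is the Virasoro anomaly
`(d + 48 β - 25)/12 * (m^3 - m) + 2 m (a - 1)`. It is zero for `m = 0` and, in the noncritical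
unitary series, strictly negative for `m ≥ 2`. Polarization therefore means `c_m Ψ = 0` for `m ≥ 2`,
together with `c_1 Ψ = 0` unless the intercept is `1`. Since `τ_m` ends in modes `c_k` with `k > m ≥
1`, it acts by zero, and on polarized cochains the operator D̄ becomes `δ = ∑ L_m c_{-m} + ∂̄`, the
Chevalley-Eilenberg differential of the algebra spanned by the `L_m`, `m > 0`, with coefficients in
the Fock space. The central term never enters, so `δ² = 0` (`polarizedDifferential_sq`).

Acyclicity comes from a light-cone homotopy. As `p ≠ 0`, there are two space-time labels `i`, `j`
and a complex `ε` with `ε² = -η_i η_j`, so that the directions `i ± ε j` are null, and with `κ = z_i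
+ ε z_j ≠ 0` for the zero modes `z` (`exists_rotation`). Put `K = ∑ α⁺_{-n} b_n`, where `α^±` are
the modes in the directions `i ± ε j`. The part of `L_m` linear in the zero modes contains `(η_i/2)
κ α⁻_m`. Its anticommutator with `K` is `κ` times an operator that counts `α⁺` and `c` excitations,
weighted by their levels (`lightMode_anticomm`).

All remaining terms of `δ K + K δ` are lower order. The operator `X = L_0 - h - R + ∑ (m-1) c_{-m}
b_m`, where `R` rotates the light-cone plane and `h` is the vacuum value of `L_0`, is diagonalizable
with eigenvalues in `ℕ`. It commutes with the leading term, and the corrections lower it by `1` or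
`2`. In ghost degree `a > 0` the leading term is injective, because a counting operator with natural
eigenvalues is shifted by `a`. By induction along the filtration, `T = δ K + K δ` is bijective
(`bijective_of_perturbation`, `exists_homotopy`).

Since `T` commutes with `δ`, a closed `Ψ = T Φ` has `δ Φ = 0`, hence `Ψ = δ (K Φ)`. Both `K` and `δ`
commute with `L_0 + 𝓛_0`, so the primitive stays in the same eigenspace, which settles the mass
shell and each fixed level (`exists_primitive`). -/

noncomputable section

namespace MassiveBRST

open scoped TensorProduct

/-! ### Pointwise finite families -/

/-- The operator `A` is the sum of the pointwise finite family `T`. -/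
def HasPf {ι V : Type*} [AddCommGroup V] [Module ℂ V] (T : ι → Module.End ℂ V)
    (A : Module.End ℂ V) : Prop :=
  PointwiseFinite T ∧ ∀ v, A v = ∑ᶠ i, T i v

section HasPf

variable {ι κ V : Type*} [AddCommGroup V] [Module ℂ V]
  {T T' : ι → Module.End ℂ V} {A A' B : Module.End ℂ V}

theorem hasPf_pfSum (hT : PointwiseFinite T) : HasPf T (pfSum T hT) := ⟨hT, fun _ => rfl⟩

/-- Identities between infinite sums of operators are proved by exhibiting both sides as sums of one
family. The verification is thereby reduced to single summands. -/
theorem HasPf.unique (h : HasPf T A) (h' : HasPf T A') : A = A' :=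
  LinearMap.ext fun v => (h.2 v).trans (h'.2 v).symm

theorem HasPf.congr (h : HasPf T A) (hT : ∀ i, T' i = T i) : HasPf T' A := by
  rwa [show T' = T from funext hT]

theorem HasPf.add (h : HasPf T A) (h' : HasPf T' A') : HasPf (fun i => T i + T' i) (A + A') := by
  refine ⟨fun v => ((h.1 v).union (h'.1 v)).subset fun i hi => ?_, fun v => ?_⟩
  · simp only [Set.mem_ofPred_eq, Set.mem_union, LinearMap.add_apply] at hi ⊢
    by_contra hc
    push Not at hc
    exact hi (by rw [hc.1, hc.2, add_zero])
  · simp only [LinearMap.add_apply, h.2, h'.2]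
    exact (finsum_add_distrib (h.1 v) (h'.1 v)).symm

theorem HasPf.mul_left (h : HasPf T A) (B : Module.End ℂ V) :
    HasPf (fun i => B * T i) (B * A) := by
  refine ⟨fun v => (h.1 v).subset fun i hi => ?_, fun v => ?_⟩
  · simp only [Set.mem_ofPred_eq, Module.End.mul_apply] at hi ⊢
    exact fun h0 => hi (by rw [h0, map_zero])
  · simp only [Module.End.mul_apply, h.2]
    exact B.toAddMonoidHom.map_finsum (h.1 v)

theorem HasPf.mul_right (h : HasPf T A) (B : Module.End ℂ V) :
    HasPf (fun i => T i * B) (A * B) :=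
  ⟨fun v => h.1 (B v), fun v => h.2 (B v)⟩

theorem HasPf.smul (h : HasPf T A) (z : ℂ) : HasPf (fun i => z • T i) (z • A) := by
  have := h.mul_left (z • 1)
  simpa using this

theorem HasPf.neg (h : HasPf T A) : HasPf (fun i => -T i) (-A) := by
  simpa using h.smul (-1)

theorem HasPf.sub (h : HasPf T A) (h' : HasPf T' A') : HasPf (fun i => T i - T' i) (A - A') := by
  simpa [sub_eq_add_neg] using h.add h'.neg

theorem HasPf.comm (h : HasPf T A) (B : Module.End ℂ V) :
    HasPf (fun i => T i * B - B * T i) (A * B - B * A) :=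
  (h.mul_right B).sub (h.mul_left B)

theorem HasPf.comm' (h : HasPf T A) (B : Module.End ℂ V) :
    HasPf (fun i => B * T i - T i * B) (B * A - A * B) :=
  (h.mul_left B).sub (h.mul_right B)

theorem HasPf.anticomm (h : HasPf T A) (B : Module.End ℂ V) :
    HasPf (fun i => B * T i + T i * B) (B * A + A * B) :=
  (h.mul_left B).add (h.mul_right B)

theorem HasPf.reindex (h : HasPf T A) (e : κ ≃ ι) : HasPf (fun k => T (e k)) A :=
  ⟨fun v => (h.1 v).preimage e.injective.injOn,
    fun v => (h.2 v).trans (finsum_comp_equiv e).symm⟩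

theorem hasPf_zero : HasPf (fun _ : ι => (0 : Module.End ℂ V)) 0 := ⟨fun v => by simp, by simp⟩

theorem hasPf_single [DecidableEq ι] (n : ι) (A : Module.End ℂ V) :
    HasPf (fun i => if i = n then A else 0) A := by
  refine ⟨fun v => (Set.finite_singleton n).subset fun i hi => ?_, fun v => ?_⟩
  · by_contra hc
    simp only [Set.mem_singleton_iff] at hc
    simp [hc] at hi
  · rw [finsum_eq_single _ n (fun i hi => by simp [hi])]
    simp

theorem HasPf.eq_zero (h : HasPf T A) (hT : ∀ i, T i = 0) : A = 0 :=
  h.unique (hasPf_zero.congr hT)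

/-- On a given vector only finitely many `T' k` are nonzero, and on each resulting image only
finitely many `T i`. The double family is thus pointwise finite and may be summed in either order.
-/
theorem HasPf.mul {T' : κ → Module.End ℂ V} (h : HasPf T A) (h' : HasPf T' B) :
    HasPf (fun q : ι × κ => T q.1 * T' q.2) (A * B) := by
  have hfin : PointwiseFinite (fun q : ι × κ => T q.1 * T' q.2) := by
    intro v
    refine ((h'.1 v).biUnion (t := fun k => (fun i => (i, k)) '' {i | T i (T' k v) ≠ 0})
      fun k _ => (h.1 _).image _).subset ?_
    rintro ⟨i, k⟩ hik
    simp only [Set.mem_ofPred_eq, Module.End.mul_apply, Set.mem_iUnion, Set.mem_image,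
      exists_prop] at hik ⊢
    exact ⟨k, fun h0 => hik (by rw [h0, map_zero]), i, hik, rfl⟩
  refine ⟨hfin, fun v => ?_⟩
  have h1 := hfin v
  have h2 : {q : κ × ι | T q.2 (T' q.1 v) ≠ 0}.Finite :=
    (h1.preimage (Prod.swap_injective.injOn)).subset fun q hq => hq
  have h3 : ∑ᶠ q : ι × κ, T q.1 (T' q.2 v) = ∑ᶠ q : κ × ι, T q.2 (T' q.1 v) :=
    (finsum_comp_equiv (Equiv.prodComm κ ι) (f := fun q : ι × κ => T q.1 (T' q.2 v))).symm
  simp only [Module.End.mul_apply]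
  rw [h3, finsum_curry _ h2, h'.2 v, map_finsum A (h'.1 v)]
  exact finsum_congr fun k => h.2 _

theorem HasPf.sum_fst {T : ι × κ → Module.End ℂ V} (h : HasPf T A) {S : κ → Module.End ℂ V}
    (hS : ∀ k, HasPf (fun i => T (i, k)) (S k)) : HasPf S A := by
  have hf : ∀ v, {q : κ × ι | T (q.2, q.1) v ≠ 0}.Finite := fun v =>
    ((h.1 v).preimage (Prod.swap_injective.injOn)).subset fun q hq => hq
  refine ⟨fun v => ((hf v).image Prod.fst).subset fun k hk => ?_, fun v => ?_⟩
  · by_contra hc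
    apply hk
    rw [(hS k).2 v]
    refine (finsum_congr fun i => ?_).trans finsum_zero
    by_contra hne
    exact hc ⟨(k, i), hne, rfl⟩
  · rw [h.2 v, ← finsum_comp_equiv (Equiv.prodComm κ ι) (f := fun q : ι × κ => T q v)]
    refine (finsum_curry _ (hf v)).trans (finsum_congr fun k => ((hS k).2 v).symm)

/-- Places a sum over positive modes, over a diagonal or over index triples inside a larger index
set, where it can be compared with other families. -/
theorem HasPf.extend {f : ι → κ} (hf : f.Injective) {T' : κ → Module.End ℂ V} (h : HasPf T A)
    (hT : ∀ i, T' (f i) = T i) (h0 : ∀ k ∉ Set.range f, T' k = 0) : HasPf T' A := by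
  refine ⟨fun v => ((h.1 v).image f).subset fun k hk => ?_, fun v => ?_⟩
  · by_cases hkf : k ∈ Set.range f
    · obtain ⟨i, rfl⟩ := hkf
      exact ⟨i, by simpa [hT] using hk, rfl⟩
    · simp [h0 k hkf] at hk
  · rw [h.2 v, ← finsum_mem_univ (f := fun k => T' k v), finsum_mem_inter_support_eq' _ _
      (Set.range f) fun k hk => by
        simp only [Set.mem_univ, true_iff]
        by_contra hkf
        exact hk (by simp [h0 k hkf]), finsum_mem_range hf]
    simp only [hT]

/-- A sum over the integers is assembled from its positive, zero and negative parts. -/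
theorem HasPf.of_int {T : ℤ → Module.End ℂ V} (h : HasPf (fun m : ℕ+ => T m) A)
    (h' : HasPf (fun m : ℕ+ => T (-m)) B) : HasPf T (A + T 0 + B) := by
  have h1 : HasPf (fun k : ℤ => if 0 < k then T k else 0) A :=
    h.extend (f := fun m : ℕ+ => (m : ℤ)) (fun m n hmn => by simpa using hmn)
      (fun m => by simp) fun k hk => by
        rw [if_neg]
        exact fun h0 => hk ⟨⟨k.toNat, by omega⟩, by simp; omega⟩
  have h2 : HasPf (fun k : ℤ => if k < 0 then T k else 0) B :=
    h'.extend (f := fun m : ℕ+ => -(m : ℤ)) (fun m n hmn => by simpa using hmn)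
      (fun m => by simp) fun k hk => by
        rw [if_neg]
        exact fun h0 => hk ⟨⟨(-k).toNat, by omega⟩, by simp; omega⟩
  refine ((h1.add (hasPf_single 0 (T 0))).add h2).congr fun k => ?_
  rcases lt_trichotomy k 0 with hk | rfl | hk
  · simp [hk, hk.ne, hk.not_gt]
  · simp
  · simp [hk, hk.ne', hk.not_gt]

theorem HasPf.apply_eq_zero (h : HasPf T A) {v : V} (hv : ∀ i, T i v = 0) : A v = 0 := by
  rw [h.2 v]
  simp [hv]

theorem HasPf.apply_eq_sum (h : HasPf T A) {v : V} (s : Finset ι) (hv : ∀ i ∉ s, T i v = 0) :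
    A v = ∑ i ∈ s, T i v := by
  rw [h.2 v]
  refine finsum_eq_sum_of_support_subset _ fun i hi => ?_
  by_contra hc
  exact hi (hv i hc)

end HasPf

/-! ### Generation of the Fock spaces from the vacuum -/

theorem matter_gen {σ : Type*} (P : Submodule ℂ (MvPolynomial σ ℂ)) (h1 : 1 ∈ P)
    (hX : ∀ j, ∀ v ∈ P, MvPolynomial.X j * v ∈ P) : P = ⊤ := by
  refine Submodule.eq_top_iff'.mpr fun v => ?_
  induction v using MvPolynomial.induction_on with
  | C r =>
    rw [← mul_one (MvPolynomial.C r), ← MvPolynomial.smul_eq_C_mul]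
    exact P.smul_mem r h1
  | add f g hf hg => exact P.add_mem hf hg
  | mul_X f j hf =>
    rw [mul_comm]
    exact hX j f hf

theorem ghost_gen (P : Submodule ℂ Ghost) (h1 : 1 ∈ P)
    (hX : ∀ j, ∀ v ∈ P, ghostCreate j v ∈ P) : P = ⊤ := by
  refine Submodule.eq_top_iff'.mpr fun v => ?_
  induction v using CliffordAlgebra.left_induction with
  | algebraMap r =>
    rw [Algebra.algebraMap_eq_smul_one]
    exact P.smul_mem r h1
  | add x y hx hy => exact P.add_mem hx hy
  | ι_mul x m hx =>
    have key : ∀ m : GhostModes, ExteriorAlgebra.ι ℂ m * x ∈ P := by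
      intro m
      induction m using Finsupp.induction_linear with
      | zero => simp
      | add f g hf hg =>
        rw [map_add, add_mul]
        exact P.add_mem hf hg
      | single j z =>
        rw [show Finsupp.single j z = z • Finsupp.single j (1 : ℂ) by simp, map_smul,
          smul_mul_assoc]
        exact P.smul_mem z (hX j x hx)
    exact key m

/-! ### Canonical anticommutation relations -/

theorem ghostCreate_anticomm (j k : ℕ ⊕ ℕ) :
    ghostCreate j * ghostCreate k + ghostCreate k * ghostCreate j = 0 := by
  refine LinearMap.ext fun v => ?_
  simp only [ghostCreate, LinearMap.add_apply, Module.End.mul_apply, LinearMap.mulLeft_apply,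
    ← mul_assoc, ← add_mul, ExteriorAlgebra.ι_add_mul_swap, zero_mul, LinearMap.zero_apply]

theorem ghostAnnihilate_anticomm (j k : ℕ ⊕ ℕ) :
    ghostAnnihilate j * ghostAnnihilate k + ghostAnnihilate k * ghostAnnihilate j = 0 := by
  refine LinearMap.ext fun v => ?_
  simp only [ghostAnnihilate, LinearMap.add_apply, Module.End.mul_apply]
  rw [CliffordAlgebra.contractLeft_comm]
  simp

theorem ghostAnnihilate_create (j k : ℕ ⊕ ℕ) :
    ghostAnnihilate j * ghostCreate k + ghostCreate k * ghostAnnihilate j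
      = if j = k then 1 else 0 := by
  refine LinearMap.ext fun v => ?_
  simp only [ghostAnnihilate, ghostCreate, LinearMap.add_apply, Module.End.mul_apply,
    LinearMap.mulLeft_apply]
  have := CliffordAlgebra.contractLeft_ι_mul (Q := (0 : QuadraticForm ℂ GhostModes))
    (Finsupp.lapply j) (Finsupp.single k 1) v
  rw [ExteriorAlgebra.ι, this]
  by_cases h : j = k
  · simp [h]
  · simp [h]

theorem ghostAnnihilate_one (j : ℕ ⊕ ℕ) : ghostAnnihilate j 1 = 0 := by
  simp [ghostAnnihilate]

theorem ghostC_one {n : ℤ} (h : 0 < n) : ghostC n 1 = 0 := by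
  match n, h with
  | Int.ofNat (k + 1), _ => exact ghostAnnihilate_one _

theorem ghostB_one {n : ℤ} (h : 0 ≤ n) : ghostB n 1 = 0 := by
  match n, h with
  | Int.ofNat k, _ => exact ghostAnnihilate_one _

theorem ghostC_ghostC (m n : ℤ) : ghostC m * ghostC n = -(ghostC n * ghostC m) := by
  rw [eq_neg_iff_add_eq_zero]
  rcases m with (_ | m) | m <;> rcases n with (_ | n) | n <;>
    simp only [ghostC, ghostCreate_anticomm, ghostAnnihilate_anticomm, ghostAnnihilate_create,
      add_comm (ghostCreate _ * ghostAnnihilate _)] <;> simp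

theorem ghostB_ghostB (m n : ℤ) : ghostB m * ghostB n = -(ghostB n * ghostB m) := by
  rw [eq_neg_iff_add_eq_zero]
  rcases m with m | m <;> rcases n with n | n <;>
    simp only [ghostB, ghostCreate_anticomm, ghostAnnihilate_anticomm, ghostAnnihilate_create,
      add_comm (ghostCreate _ * ghostAnnihilate _)] <;> simp

theorem ghostB_ghostC (m n : ℤ) :
    ghostB m * ghostC n + ghostC n * ghostB m = if m + n = 0 then 1 else 0 := by
  rcases m with m | m <;> rcases n with (_ | n) | n <;>
    simp only [ghostB, ghostC, ghostCreate_anticomm, ghostAnnihilate_anticomm,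
      ghostAnnihilate_create, add_comm (ghostCreate _ * ghostAnnihilate _)]
  case negSucc.ofNat.zero => rw [if_neg (by simp)]
  case ofNat.ofNat.succ => rw [if_neg (by simp; omega)]
  case negSucc.negSucc => rw [if_neg (by omega)]
  all_goals
    refine if_congr ?_ rfl rfl
    simp only [Sum.inl.injEq, Sum.inr.injEq, Int.negSucc_eq, Int.ofNat_eq_natCast]
    push_cast
    omega

theorem ghostCreate_eq (j : ℕ ⊕ ℕ) :
    (∃ n : ℤ, n ≤ 0 ∧ ghostCreate j = ghostC n) ∨ (∃ n : ℤ, n < 0 ∧ ghostCreate j = ghostB n) := by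
  rcases j with (_ | k) | k
  · exact Or.inl ⟨0, le_refl _, rfl⟩
  · exact Or.inl ⟨Int.negSucc k, (Int.negSucc_lt_zero k).le, rfl⟩
  · exact Or.inr ⟨Int.negSucc k, Int.negSucc_lt_zero k, rfl⟩

namespace MassiveString

variable (S : MassiveString)

/-! ### Canonical commutation relations -/

theorem metric_mul_self (i : S.Label) : S.metric i * S.metric i = 1 := by
  rcases i with _ | μ
  · simp [metric]
  · simp only [metric]
    split_ifs <;> norm_num

theorem pderiv_mul_pderiv {σ : Type*} (i j : σ) :
    ((MvPolynomial.pderiv i).toLinearMap * (MvPolynomial.pderiv j).toLinearMap :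
        Module.End ℂ (MvPolynomial σ ℂ))
      = (MvPolynomial.pderiv (R := ℂ) j).toLinearMap
        * (MvPolynomial.pderiv (R := ℂ) i).toLinearMap := by
  classical
  have h : ⁅(MvPolynomial.pderiv i : Derivation ℂ (MvPolynomial σ ℂ) (MvPolynomial σ ℂ)),
      (MvPolynomial.pderiv j : Derivation ℂ (MvPolynomial σ ℂ) (MvPolynomial σ ℂ))⁆ = 0 := by
    refine MvPolynomial.derivation_ext fun k => ?_
    rw [Derivation.commutator_apply]
    simp only [MvPolynomial.pderiv_X, Derivation.coe_zero, Pi.zero_apply, Pi.single_apply]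
    split_ifs <;> simp
  refine LinearMap.ext fun v => ?_
  have := congrArg (fun d => d v) h
  rwa [Derivation.commutator_apply, Derivation.coe_zero, Pi.zero_apply, sub_eq_zero] at this

theorem pderiv_mul_mulLeft {σ : Type*} [DecidableEq σ] (i j : σ) :
    ((MvPolynomial.pderiv i).toLinearMap * LinearMap.mulLeft ℂ (MvPolynomial.X j) :
        Module.End ℂ (MvPolynomial σ ℂ))
      = LinearMap.mulLeft ℂ (MvPolynomial.X j) * (MvPolynomial.pderiv i).toLinearMap
        + if i = j then 1 else 0 := by
  refine LinearMap.ext fun v => ?_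
  have : MvPolynomial.pderiv i (MvPolynomial.X j * v) = MvPolynomial.X j * MvPolynomial.pderiv i v
      + (if i = j then 1 else 0 : Module.End ℂ (MvPolynomial σ ℂ)) v := by
    rw [Derivation.leibniz, MvPolynomial.pderiv_X, Pi.single_apply]
    by_cases h : i = j
    · simp [h]
    · simp [h, Ne.symm h]
  exact this

theorem osc_comm (p : S.Momentum) (i j : S.Label) (m n : ℤ) :
    S.osc p i m * S.osc p j n - S.osc p j n * S.osc p i m
      = if i = j ∧ m + n = 0 then ((m : ℂ) * (S.metric i : ℂ)) • 1 else 0 := by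
  rw [sub_eq_iff_eq_add']
  rcases m with (_ | m) | m <;> rcases n with (_ | n) | n
  · rw [show (((Int.ofNat 0 : ℤ) : ℂ) * (S.metric i : ℂ)) • (1 : Module.End ℂ S.Matter) = 0 by
      simp, ite_self]
    simp only [osc, mul_smul_comm, mul_one, add_zero]
    exact smul_comm _ _ _
  · rw [if_neg (by simp; omega)]
    simp only [osc, smul_mul_assoc, mul_smul_comm, one_mul, mul_one, add_zero]
    rw [smul_comm]
  · rw [if_neg (by simp)]
    simp only [osc, smul_mul_assoc, mul_smul_comm, one_mul, mul_one, add_zero]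
  · rw [if_neg (by simp; omega)]
    simp only [osc, smul_mul_assoc, mul_smul_comm, one_mul, mul_one, add_zero]
    rw [smul_comm]
  · rw [if_neg (by simp; omega)]
    simp only [osc, smul_mul_smul_comm, pderiv_mul_pderiv (i, m), mul_comm, add_zero]
  · simp only [osc, smul_mul_assoc, mul_smul_comm, pderiv_mul_mulLeft, smul_add, Prod.mk.injEq]
    congr 1
    have e : (i = j ∧ Int.ofNat (m + 1) + Int.negSucc n = 0) ↔ i = j ∧ m = n :=
      and_congr_right fun _ => by
        rw [Int.negSucc_eq, Int.ofNat_eq_natCast]; push_cast; omega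
    simp only [e]
    split_ifs <;> simp
  · rw [if_neg (by simp)]
    simp only [osc, smul_mul_assoc, mul_smul_comm, one_mul, mul_one, add_zero]
  · simp only [osc, smul_mul_assoc, mul_smul_comm, pderiv_mul_mulLeft, smul_add, Prod.mk.injEq]
    have e : (i = j ∧ Int.negSucc m + Int.ofNat (n + 1) = 0) ↔ j = i ∧ n = m := by
      constructor
      · rintro ⟨rfl, h⟩; exact ⟨rfl, by rw [Int.negSucc_eq, Int.ofNat_eq_natCast] at h; push_cast at h; omega⟩
      · rintro ⟨rfl, rfl⟩; exact ⟨rfl, by rw [Int.negSucc_eq, Int.ofNat_eq_natCast]; push_cast; omega⟩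
    simp only [e]
    split_ifs with h
    · obtain ⟨rfl, rfl⟩ := h
      rw [add_assoc, ← add_smul, Int.negSucc_eq]
      push_cast
      rw [show ((n : ℂ) + 1) * (S.metric j : ℂ) + -((n : ℂ) + 1) * (S.metric j : ℂ) = 0 by ring,
        zero_smul, add_zero]
    · simp
  · rw [if_neg (by simp only [not_and]; intro _; omega), add_zero]
    refine LinearMap.ext fun v => ?_
    simp only [osc, Module.End.mul_apply, LinearMap.mulLeft_apply]
    ring

theorem osc_one (p : S.Momentum) (i : S.Label) {n : ℤ} (h : 0 < n) : S.osc p i n 1 = 0 := by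
  match n, h with
  | Int.ofNat (k + 1), _ => simp [osc]

theorem osc_zero (p : S.Momentum) (i : S.Label) : S.osc p i 0 = (S.zeroMode p i : ℂ) • 1 := rfl

end MassiveString

/-! ### The matter Virasoro algebra -/

theorem sum_Icc_int {M : Type*} [AddCommMonoid M] (f : ℤ → M) (n : ℕ) :
    ∑ k ∈ Finset.Icc (0 : ℤ) n, f k = ∑ k ∈ Finset.range (n + 1), f k := by
  refine (Finset.sum_bij (s := Finset.range (n + 1)) (t := Finset.Icc (0 : ℤ) n)
    (f := fun k => f k) (g := f) (fun k _ => (k : ℤ)) ?_ ?_ ?_ ?_).symm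
  · intro k hk
    simp only [Finset.mem_range, Finset.mem_Icc] at hk ⊢
    omega
  · intro k _ l _ hkl
    exact_mod_cast hkl
  · intro k hk
    simp only [Finset.mem_Icc] at hk
    exact ⟨k.toNat, by simp; omega, by omega⟩
  · intro k _
    rfl

theorem sum_range_mul_sub (M : ℂ) (n : ℕ) :
    ∑ k ∈ Finset.range n, (k : ℂ) * (M - k)
      = M * (n * (n - 1)) / 2 - (n - 1) * n * (2 * n - 1) / 6 := by
  induction n with
  | zero => simp
  | succ n ih =>
    rw [Finset.sum_range_succ, ih]
    push_cast
    ring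

section Matter

variable {ι V : Type*} [Fintype ι] [DecidableEq ι] [AddCommGroup V] [Module ℂ V]

/-- The normally ordered product of two modes. -/
def modeProd (a : ι → ℤ → Module.End ℂ V) (i : ι) (m n : ℤ) : Module.End ℂ V :=
  if m ≤ n then a i m * a i n else a i n * a i m

/-- Free oscillators `a i n` with metric `η`, zero modes `z`, generating `V` from `vac`, and the
Virasoro operators `L` built from them with background charge `q` in the direction `u`. -/
structure IsMatter (η : ι → ℂ) (a : ι → ℤ → Module.End ℂ V) (vac : V) (z : ι → ℂ) (u : ι)
    (q w : ℂ) (L : ℤ → Module.End ℂ V) : Prop where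
  metric : ∀ i, η i * η i = 1
  comm : ∀ i j m n, a i m * a j n - a j n * a i m
    = if i = j ∧ m + n = 0 then ((m : ℂ) * η i) • 1 else 0
  zero : ∀ i, a i 0 = z i • 1
  pos_vac : ∀ i, ∀ n : ℤ, 0 < n → a i n vac = 0
  finite : ∀ v, ∃ N : ℕ, ∀ n : ℤ, (N : ℤ) ≤ n → ∀ i, a i n v = 0
  gen : ∀ P : Submodule ℂ V, vac ∈ P → (∀ i, ∀ n : ℤ, n < 0 → ∀ v ∈ P, a i n v ∈ P) → P = ⊤
  charge : q * q = -2 * w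
  metric_u : η u = 1
  zero_u : z u = 0
  virasoro : ∀ m, ∃ Q, HasPf (fun k : ℤ => ∑ i, η i • modeProd a i (m + k) (-k)) Q ∧
    L m = (1 / 2 : ℂ) • Q + (q * m) • a u m + (if m = 0 then w else 0) • 1

namespace IsMatter

variable {η : ι → ℂ} {a : ι → ℤ → Module.End ℂ V} {vac : V} {z : ι → ℂ} {u : ι} {q w : ℂ}
  {L : ℤ → Module.End ℂ V} (h : IsMatter η a vac z u q w L)

include h

/-- An operator which kills the vacuum and commutes with the creation operators vanishes. -/
theorem ext (X : Module.End ℂ V) (h1 : X vac = 0)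
    (hX : ∀ i, ∀ n : ℤ, n < 0 → X * a i n = a i n * X) : X = 0 := by
  have := h.gen (LinearMap.ker X) h1 fun i n hn v hv => by
    have := LinearMap.congr_fun (hX i n hn) v
    simp only [Module.End.mul_apply, LinearMap.mem_ker.mp hv, map_zero] at this
    exact this
  exact LinearMap.ker_eq_top.mp this

/-- Normal ordering changes a product of two modes only by a scalar, and scalars drop out of every
commutator. -/
theorem modeProd_eq (i : ι) (r s : ℤ) :
    ∃ t : ℂ, modeProd a i r s = a i r * a i s + t • 1 := by
  unfold modeProd
  split_ifs with hrs
  · exact ⟨0, by simp⟩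
  · have := h.comm i i s r
    rw [sub_eq_iff_eq_add'] at this
    rw [this]
    split_ifs
    · exact ⟨_, rfl⟩
    · exact ⟨0, by simp⟩

theorem modeProd_comm (i : ι) (r s : ℤ) (x : Module.End ℂ V) :
    modeProd a i r s * x - x * modeProd a i r s
      = a i r * (a i s * x - x * a i s) + (a i r * x - x * a i r) * a i s := by
  obtain ⟨t, ht⟩ := h.modeProd_eq i r s
  rw [ht]
  simp only [add_mul, mul_add, mul_sub, sub_mul, smul_mul_assoc, mul_smul_comm, one_mul, mul_one,
    mul_assoc]
  module

theorem modeProd_comm_mode (i j : ι) (r s n : ℤ) :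
    modeProd a i r s * a j n - a j n * modeProd a i r s
      = (if i = j ∧ s + n = 0 then (s : ℂ) * η i else 0) • a i r
        + (if i = j ∧ r + n = 0 then (r : ℂ) * η i else 0) • a i s := by
  rw [h.modeProd_comm, h.comm, h.comm]
  congr 1 <;> split_ifs <;> simp

theorem sum_modeProd_comm_mode (j : ι) (r s n : ℤ) :
    (∑ i, η i • modeProd a i r s) * a j n - a j n * (∑ i, η i • modeProd a i r s)
      = (if s + n = 0 then (s : ℂ) else 0) • a j r
        + (if r + n = 0 then (r : ℂ) else 0) • a j s := by
  have hm := h.metric j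
  rw [Finset.sum_mul, Finset.mul_sum, ← Finset.sum_sub_distrib, Finset.sum_eq_single j]
  · rw [smul_mul_assoc, mul_smul_comm, ← smul_sub, h.modeProd_comm_mode, smul_add, smul_smul,
      smul_smul]
    simp only [true_and]
    congr 2
    · split_ifs
      · rw [mul_left_comm, hm, mul_one]
      · simp
    · split_ifs
      · rw [mul_left_comm, hm, mul_one]
      · simp
  · intro i _ hij
    rw [smul_mul_assoc, mul_smul_comm, ← smul_sub, h.modeProd_comm_mode]
    simp [hij]
  · simp

/-- A mode contracts with one factor of the quadratic sum, so only the summands `k = n` and `k = -m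
- n` survive. They contribute equally, which cancels the factor one half. The background charge adds
a scalar in the direction `u`. -/
theorem virasoro_comm_mode (m : ℤ) (j : ι) (n : ℤ) :
    L m * a j n - a j n * L m = (-(n : ℂ)) • a j (m + n)
        + (if j = u ∧ m + n = 0 then q * m ^ 2 else 0) • 1 := by
  obtain ⟨Q, hQ, hL⟩ := h.virasoro m
  have h' : Q * a j n - a j n * Q
      = (-(n : ℂ)) • a j (m + n) + (-(n : ℂ)) • a j (m + n) := by
    refine (hQ.comm (a j n)).unique (((hasPf_single n _).add (hasPf_single (-m - n) _)).congr
      fun k => ?_)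
    rw [h.sum_modeProd_comm_mode]
    congr 1
    · by_cases hk : k = n
      · subst hk; simp
      · rw [if_neg (by omega), if_neg hk, zero_smul]
    · by_cases hk : k = -m - n
      · subst hk
        simp [show -(-m - n) = m + n by ring, show m + (-m - n) = -n by ring]
      · rw [if_neg (by omega), if_neg hk, zero_smul]
  have hu := h.comm u j m n
  have e : L m * a j n - a j n * L m = (1 / 2 : ℂ) • (Q * a j n - a j n * Q)
        + (q * m) • (a u m * a j n - a j n * a u m) := by
    rw [hL]
    simp only [add_mul, mul_add, smul_mul_assoc, mul_smul_comm, one_mul, mul_one]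
    module
  rw [e, h', hu, ← two_smul ℂ, smul_smul, smul_smul]
  congr 1
  · module
  · simp only [eq_comm (a := u) (b := j)]
    split_ifs
    · rw [smul_smul, h.metric_u]
      module
    · simp

theorem modeProd_vac (i : ι) (r s : ℤ) (hrs : 0 < r ∨ 0 < s) : modeProd a i r s vac = 0 := by
  unfold modeProd
  split_ifs
  · rw [Module.End.mul_apply, h.pos_vac i _ (by omega), map_zero]
  · rw [Module.End.mul_apply, h.pos_vac i _ (by omega), map_zero]

theorem virasoro_vac_pos {m : ℤ} (hm : 0 < m) : L m vac = 0 := by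
  obtain ⟨Q, hQ, hL⟩ := h.virasoro m
  have h' := hQ.apply_eq_zero (v := vac) fun k => by
    simp only [LinearMap.sum_apply, LinearMap.smul_apply]
    refine Finset.sum_eq_zero fun i _ => ?_
    rw [h.modeProd_vac i _ _ (by omega), smul_zero]
  rw [hL, if_neg hm.ne', LinearMap.add_apply, LinearMap.add_apply, LinearMap.smul_apply, h',
    LinearMap.smul_apply, h.pos_vac u _ hm]
  simp

theorem virasoro_vac_zero : L 0 vac = ((1 / 2) * ∑ i, η i * z i ^ 2 + w) • vac := by
  obtain ⟨Q, hQ, hL⟩ := h.virasoro 0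
  have h' := hQ.apply_eq_sum (v := vac) {0} fun k hk => by
    simp only [LinearMap.sum_apply, LinearMap.smul_apply]
    refine Finset.sum_eq_zero fun i _ => ?_
    rw [h.modeProd_vac i _ _ (by simp at hk; omega), smul_zero]
  have hs : (∑ i, η i • modeProd a i (0 + 0) (-0)) vac = (∑ i, η i * z i ^ 2) • vac := by
    rw [Finset.sum_smul, LinearMap.sum_apply]
    refine Finset.sum_congr rfl fun i _ => ?_
    simp only [modeProd, add_zero, neg_zero, le_refl, if_true, LinearMap.smul_apply,
      Module.End.mul_apply, h.zero, Module.End.one_apply, smul_smul]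
    rw [pow_two]
  rw [hL, LinearMap.add_apply, LinearMap.add_apply, LinearMap.smul_apply, h',
    Finset.sum_singleton, hs]
  simp only [if_true, LinearMap.smul_apply, Module.End.one_apply, Int.cast_zero, mul_zero,
    zero_smul, LinearMap.zero_apply, smul_smul]
  module

/-- The vector `L_{-N}` applied to the vacuum, `N > 0`. -/
theorem virasoro_vac_neg {N : ℤ} (hN : 0 < N) :
    L (-N) vac = ((1 / 2 : ℂ) • (∑ i, η i • ∑ k ∈ Finset.Icc 0 N, a i (-k) * a i (k - N))
      - (q * N) • a u (-N)) vac := by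
  obtain ⟨Q, hQ, hL⟩ := h.virasoro (-N)
  have h' := hQ.apply_eq_sum (v := vac) (Finset.Icc (0 : ℤ) N) fun k hk => by
      simp only [LinearMap.sum_apply, LinearMap.smul_apply]
      refine Finset.sum_eq_zero fun i _ => ?_
      rw [h.modeProd_vac i _ _ (by simp at hk; omega), smul_zero]
  have hprod : ∀ i k, modeProd a i (-N + k) (-k) = a i (-k) * a i (k - N) := fun i k => by
    rw [neg_add_eq_sub, modeProd]
    split_ifs
    · have := h.comm i i (-k) (k - N)
      rw [if_neg (by omega), sub_eq_zero] at this
      exact this.symm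
    · rfl
  simp only [hprod] at h'
  rw [hL, LinearMap.add_apply, LinearMap.add_apply, LinearMap.smul_apply, h',
    if_neg (by omega), zero_smul, LinearMap.zero_apply, add_zero, LinearMap.sub_apply,
    LinearMap.smul_apply, LinearMap.smul_apply, sub_eq_add_neg]
  congr 1
  · congr 1
    simp only [LinearMap.sum_apply, LinearMap.smul_apply]
    rw [Finset.sum_comm]
    simp only [Finset.smul_sum]
  · rw [LinearMap.smul_apply, ← neg_smul]
    congr 1
    push_cast
    ring

/-- The two-mode contribution to `[L_m, L_{-N}]` on the vacuum. -/
theorem virasoro_comm_pair_vac (i : ι) {m N : ℤ} (hm : 0 ≤ m) (hN : 0 < N) :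
    (∑ k ∈ Finset.Icc 0 N, ((k : ℂ) • (a i (m - k) * a i (k - N))
        + ((N - k : ℤ) : ℂ) • (a i (-k) * a i (m + k - N)))) vac
      = (if m < N then ((m + N : ℤ) : ℂ) •
          (∑ k ∈ Finset.Icc 0 (N - m), a i (-k) * a i (k - (N - m))) vac else 0)
        + (if m = N then (((m : ℂ) ^ 3 - m) / 6 + 2 * m * (η i * z i ^ 2)) • η i • vac
          else 0) := by
  -- Both sums consist of vectors `f j`, the first one after the shift `j = k - m`. They vanish for
  -- `j > N - m`, where the right-hand mode is positive. For `j < 0` only the contraction of the two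
  -- modes survives; it needs `m = N` and produces the central term.
  set f : ℤ → V := fun j => a i (-j) (a i (j - (N - m)) vac) with hf
  have hf1 : ∀ j, N - m < j → f j = 0 := fun j hj => by
    simp only [hf]
    rw [h.pos_vac i _ (by omega), map_zero]
  have hcomm : ∀ j, f j = a i (j - (N - m)) (a i (-j) vac)
      + (if m = N then ((-j : ℤ) : ℂ) • η i • vac else 0) := fun j => by
    have := LinearMap.congr_fun (h.comm i i (-j) (j - (N - m))) vac
    simp only [LinearMap.sub_apply, Module.End.mul_apply, sub_eq_iff_eq_add'] at this
    simp only [hf, this]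
    congr 1
    simp only [true_and, show -j + (j - (N - m)) = 0 ↔ m = N by omega]
    split_ifs <;> simp [mul_smul]
  have hf2 : ∀ j < 0, f j = if m = N then ((-j : ℤ) : ℂ) • η i • vac else 0 := fun j hj => by
    rw [hcomm, h.pos_vac i (-j) (by omega), map_zero, zero_add]
  have hsum : (∑ k ∈ Finset.Icc 0 N, ((k : ℂ) • (a i (m - k) * a i (k - N))
        + ((N - k : ℤ) : ℂ) • (a i (-k) * a i (m + k - N)))) vac
      = ∑ j ∈ Finset.Icc (-m) (N - m), ((j + m : ℤ) : ℂ) • f j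
        + ∑ j ∈ Finset.Icc 0 N, ((N - j : ℤ) : ℂ) • f j := by
    rw [Finset.sum_add_distrib, LinearMap.add_apply, LinearMap.sum_apply, LinearMap.sum_apply]
    congr 1
    · refine Finset.sum_bij' (fun k _ => k - m) (fun j _ => j + m) ?_ ?_ ?_ ?_ ?_
      · intro k hk
        simp only [Finset.mem_Icc] at hk ⊢
        omega
      · intro k hk
        simp only [Finset.mem_Icc] at hk ⊢
        omega
      · intro k _; ring
      · intro k _; ring
      · intro k _
        simp only [hf, LinearMap.smul_apply, Module.End.mul_apply]
        rw [show -(k - m) = m - k by ring, show k - m - (N - m) = k - N by ring,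
          show k - m + m = k by ring]
    · refine Finset.sum_congr rfl fun j _ => ?_
      simp only [hf, LinearMap.smul_apply, Module.End.mul_apply]
      rw [show j - (N - m) = m + j - N by ring]
  rw [hsum]
  rcases lt_trichotomy m N with hlt | rfl | hgt
  · rw [if_pos hlt, if_neg hlt.ne, add_zero]
    have h1 : ∑ j ∈ Finset.Icc (-m) (N - m), ((j + m : ℤ) : ℂ) • f j
        = ∑ j ∈ Finset.Icc 0 (N - m), ((j + m : ℤ) : ℂ) • f j := by
      refine (Finset.sum_subset (Finset.Icc_subset_Icc (by omega) le_rfl) fun j hj hj' => ?_).symm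
      simp only [Finset.mem_Icc] at hj hj'
      rw [hf2 j (by omega), if_neg hlt.ne, smul_zero]
    have h2 : ∑ j ∈ Finset.Icc 0 N, ((N - j : ℤ) : ℂ) • f j
        = ∑ j ∈ Finset.Icc 0 (N - m), ((N - j : ℤ) : ℂ) • f j := by
      refine (Finset.sum_subset (Finset.Icc_subset_Icc le_rfl (by omega)) fun j hj hj' => ?_).symm
      simp only [Finset.mem_Icc] at hj hj'
      rw [hf1 j (by omega), smul_zero]
    rw [h1, h2, ← Finset.sum_add_distrib, LinearMap.sum_apply, Finset.smul_sum]
    refine Finset.sum_congr rfl fun j _ => ?_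
    rw [← add_smul, Module.End.mul_apply]
    congr 1
    push_cast
    ring
  · rw [if_neg (lt_irrefl m), if_pos rfl, zero_add]
    have hf0 : f 0 = (z i ^ 2) • vac := by
      simp [hf, h.zero, smul_smul, pow_two]
    have h2 : ∑ j ∈ Finset.Icc 0 m, ((m - j : ℤ) : ℂ) • f j = (m : ℂ) • f 0 := by
      rw [Finset.sum_eq_single_of_mem 0 (by simp [hm])]
      · simp
      · intro j hj hj0
        simp only [Finset.mem_Icc] at hj
        rw [hf1 j (by omega), smul_zero]
    have h1 : ∑ j ∈ Finset.Icc (-m) (m - m), ((j + m : ℤ) : ℂ) • f j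
        = (m : ℂ) • f 0 + (((m : ℂ) ^ 3 - m) / 6) • η i • vac := by
      -- With `k = j + m` the contraction contributes `k (m - k)`, which is zero at `j = 0`. Summed
      -- over `0 ≤ k ≤ m` this gives `(m^3 - m) / 6`.
      have hterm : ∀ j ∈ Finset.Icc (-m) (m - m), ((j + m : ℤ) : ℂ) • f j
          = (if j = 0 then (m : ℂ) • f 0 else 0)
            + (((j + m : ℤ) : ℂ) * (m - ((j + m : ℤ) : ℂ))) • η i • vac := by
        intro j hj
        simp only [Finset.mem_Icc] at hj
        by_cases hj0 : j = 0
        · subst hj0; simp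
        · rw [hf2 j (by omega), if_pos rfl, if_neg hj0, zero_add, smul_smul]
          congr 1
          push_cast
          ring
      rw [Finset.sum_congr rfl hterm, Finset.sum_add_distrib]
      congr 1
      · rw [Finset.sum_ite_eq' (Finset.Icc (-m) (m - m)) 0, if_pos (by simp [hm])]
      · rw [← Finset.sum_smul]
        congr 1
        obtain ⟨n, rfl⟩ := Int.eq_ofNat_of_zero_le hm
        have : ∑ j ∈ Finset.Icc (-(n : ℤ)) (n - n), ((j + n : ℤ) : ℂ) * ((n : ℤ) - ((j + n : ℤ) : ℂ))
            = ∑ k ∈ Finset.Icc (0 : ℤ) n, (k : ℂ) * (n - k) := by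
          refine Finset.sum_bij' (fun j _ => j + n) (fun k _ => k - n) ?_ ?_ ?_ ?_ ?_
          · intro k hk
            simp only [Finset.mem_Icc] at hk ⊢
            omega
          · intro k hk
            simp only [Finset.mem_Icc] at hk ⊢
            omega
          · intro k _; ring
          · intro k _; ring
          · intro k _; simp
        rw [this, sum_Icc_int]
        simp only [Int.cast_natCast]
        rw [sum_range_mul_sub]
        push_cast
        ring
    have hm2 := h.metric i
    rw [h1, h2, hf0, smul_smul, smul_smul, smul_smul, add_right_comm, ← add_smul, ← add_smul]
    congr 1
    linear_combination (-2 * m * z i ^ 2) * hm2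
  · rw [if_neg hgt.not_gt, if_neg hgt.ne', add_zero]
    rw [Finset.sum_eq_zero, Finset.sum_eq_zero, add_zero]
    · intro j hj
      simp only [Finset.mem_Icc] at hj
      rw [hf1 j (by omega), smul_zero]
    · intro j hj
      simp only [Finset.mem_Icc] at hj
      rw [hf2 j (by omega), if_neg hgt.ne', smul_zero]

/-- Jacobi identity for two Virasoro operators and a mode, each inner commutator being known from
`virasoro_comm_mode`. Consequently `[L_m, L_n] - (m - n) L_{m+n}` commutes with all modes. -/
theorem virasoro_comm_mode_comm (m n : ℤ) (j : ι) (k : ℤ) :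
    (L m * L n - L n * L m) * a j k - a j k * (L m * L n - L n * L m)
      = ((m - n : ℤ) : ℂ) • (L (m + n) * a j k - a j k * L (m + n)) := by
  have e : (L m * L n - L n * L m) * a j k - a j k * (L m * L n - L n * L m)
      = (L m * (L n * a j k - a j k * L n) - (L n * a j k - a j k * L n) * L m)
        - (L n * (L m * a j k - a j k * L m) - (L m * a j k - a j k * L m) * L n) := by
    simp only [mul_sub, sub_mul, mul_assoc]
    abel
  have e' : ∀ (s t : ℂ) (x y : Module.End ℂ V), x * (s • y + t • 1) - (s • y + t • 1) * x
      = s • (x * y - y * x) := fun s t x y => by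
    simp only [mul_add, add_mul, mul_smul_comm, smul_mul_assoc, mul_one, one_mul]
    module
  rw [e, h.virasoro_comm_mode, h.virasoro_comm_mode, e', e', h.virasoro_comm_mode,
    h.virasoro_comm_mode, h.virasoro_comm_mode]
  rw [show n + (m + k) = m + n + k by ring, show m + (n + k) = m + n + k by ring]
  -- The background scalars occur only for `k = -(m + n)`, where they agree because `(m + n)^2 (m -
  -- n) = (m + n) (m^2 - n^2)`.
  have hs : (if j = u ∧ m + n + k = 0 then q * ((m + n : ℤ) : ℂ) ^ 2 else 0) * ((m - n : ℤ) : ℂ)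
      = (-(k : ℂ)) * (if j = u ∧ m + n + k = 0 then q * (m : ℂ) ^ 2 else 0)
        - (-(k : ℂ)) * (if j = u ∧ m + n + k = 0 then q * (n : ℂ) ^ 2 else 0) := by
    split_ifs with hc
    · have : (k : ℂ) = -(m + n) := by
        have : k = -(m + n) := by omega
        rw [this]; push_cast; ring
      rw [this]
      push_cast
      ring
    · ring
  simp only [smul_add, smul_smul]
  push_cast at hs ⊢
  linear_combination (norm := module) (-hs) • (1 : Module.End ℂ V)

theorem virasoro_vac_nonneg {m : ℤ} (hm : 0 ≤ m) :
    ∃ t : ℂ, L m vac = t • vac ∧ (0 < m → t = 0) := by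
  rcases hm.eq_or_lt with rfl | hm
  · exact ⟨_, h.virasoro_vac_zero, fun h0 => absurd h0 (lt_irrefl 0)⟩
  · exact ⟨0, by rw [h.virasoro_vac_pos hm, zero_smul], fun _ => rfl⟩

/-- As `L_m` acts on the vacuum by a scalar, `L_{-N}` may be replaced by the finite sum `O` with the
same value on the vacuum. Its commutator with `L_m` is then computed one product of modes at a time.
-/
theorem virasoro_comm_vac_neg {m N : ℤ} (hm : 0 ≤ m) (hN : 0 < N) :
    (L m * L (-N) - L (-N) * L m) vac = ((m + N : ℤ) : ℂ) • L (m - N) vac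
      + (if m = N then (((Fintype.card ι : ℂ) / 12 + 2 * w) * ((m : ℂ) ^ 3 - m)) • vac else 0) := by
  obtain ⟨t, ht, -⟩ := h.virasoro_vac_nonneg hm
  set O : Module.End ℂ V :=
    (1 / 2 : ℂ) • (∑ i, η i • ∑ k ∈ Finset.Icc 0 N, a i (-k) * a i (k - N))
      - (q * N) • a u (-N) with hO
  have h1 : (L m * L (-N) - L (-N) * L m) vac = (L m * O - O * L m) vac := by
    simp only [LinearMap.sub_apply, Module.End.mul_apply, ht, map_smul]
    rw [h.virasoro_vac_neg hN]
  have hmode := h.virasoro_comm_mode m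
  have hpair : ∀ i k, (L m * (a i (-k) * a i (k - N)) - (a i (-k) * a i (k - N)) * L m)
      = (k : ℂ) • (a i (m - k) * a i (k - N))
        + ((N - k : ℤ) : ℂ) • (a i (-k) * a i (m + k - N))
        + ((if i = u ∧ m - k = 0 then q * m ^ 2 else 0) • a i (k - N)
          + (if i = u ∧ m + k - N = 0 then q * m ^ 2 else 0) • a i (-k)) := by
    intro i k
    have e : L m * (a i (-k) * a i (k - N)) - (a i (-k) * a i (k - N)) * L m
        = (L m * a i (-k) - a i (-k) * L m) * a i (k - N)
          + a i (-k) * (L m * a i (k - N) - a i (k - N) * L m) := by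
      simp only [mul_sub, sub_mul, mul_assoc]
      abel
    rw [e, hmode, hmode]
    simp only [add_mul, mul_add, smul_mul_assoc, mul_smul_comm, one_mul, mul_one, ← sub_eq_add_neg,
      ← add_sub_assoc]
    push_cast
    module
  have hbg : ∑ k ∈ Finset.Icc 0 N, ((if m - k = 0 then q * (m : ℂ) ^ 2 else 0) • a u (k - N)
        + (if m + k - N = 0 then q * (m : ℂ) ^ 2 else 0) • a u (-k)) vac
      = (2 * (q * (m : ℂ) ^ 2)) • a u (m - N) vac := by
    by_cases hmN : m ≤ N
    · have h1 : ∀ k ∈ Finset.Icc 0 N, ((if m - k = 0 then q * (m : ℂ) ^ 2 else 0) • a u (k - N)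
          + (if m + k - N = 0 then q * (m : ℂ) ^ 2 else 0) • a u (-k)) vac
          = (if k = m then (q * (m : ℂ) ^ 2) • a u (m - N) vac else 0)
            + (if k = N - m then (q * (m : ℂ) ^ 2) • a u (m - N) vac else 0) := fun k _ => by
        rw [LinearMap.add_apply]
        congr 1
        · by_cases hk : k = m
          · simp [hk]
          · simp [hk, show m - k ≠ 0 by omega]
        · by_cases hk : k = N - m
          · simp [hk]
          · simp [hk, show m + k - N ≠ 0 by omega]
      rw [Finset.sum_congr rfl h1, Finset.sum_add_distrib, Finset.sum_ite_eq', Finset.sum_ite_eq',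
        if_pos (by simp; omega), if_pos (by simp; omega)]
      module
    · rw [h.pos_vac u _ (by omega), smul_zero]
      refine Finset.sum_eq_zero fun k hk => ?_
      simp only [Finset.mem_Icc] at hk
      rw [if_neg (by omega), if_neg (by omega)]
      simp
  have hcomm : (L m * O - O * L m) vac
      = (1 / 2 : ℂ) • (∑ i, η i • (∑ k ∈ Finset.Icc 0 N, ((k : ℂ) • (a i (m - k) * a i (k - N))
        + ((N - k : ℤ) : ℂ) • (a i (-k) * a i (m + k - N)))) vac)
        + (q * (m : ℂ) ^ 2) • a u (m - N) vac
        - (q * N) • ((N : ℂ) • a u (m - N) vac + (if m = N then q * (m : ℂ) ^ 2 else 0) • vac) := by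
    have e : L m * O - O * L m = (1 / 2 : ℂ) • (∑ i, η i • ∑ k ∈ Finset.Icc 0 N,
          (L m * (a i (-k) * a i (k - N)) - (a i (-k) * a i (k - N)) * L m))
        - (q * N) • (L m * a u (-N) - a u (-N) * L m) := by
      rw [hO]
      simp only [mul_sub, sub_mul, mul_smul_comm, smul_mul_assoc, Finset.mul_sum, Finset.sum_mul,
        Finset.sum_sub_distrib, smul_sub]
      abel
    have e2 : ∑ i, η i • (∑ k ∈ Finset.Icc 0 N,
          ((if i = u ∧ m - k = 0 then q * (m : ℂ) ^ 2 else 0) • a i (k - N)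
          + (if i = u ∧ m + k - N = 0 then q * (m : ℂ) ^ 2 else 0) • a i (-k))) vac
        = (2 * (q * (m : ℂ) ^ 2)) • a u (m - N) vac := by
      rw [Finset.sum_eq_single u]
      · simp only [true_and]
        rw [h.metric_u, one_smul, LinearMap.sum_apply, hbg]
      · intro i _ hi
        simp [hi]
      · simp
    rw [e, hmode]
    simp only [hpair, Finset.sum_add_distrib (s := Finset.Icc 0 N), LinearMap.sub_apply,
      LinearMap.smul_apply, LinearMap.add_apply, smul_add] at e2 ⊢
    simp only [LinearMap.sum_apply, LinearMap.smul_apply, LinearMap.add_apply, smul_add,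
      Finset.sum_add_distrib (s := Finset.univ), Int.cast_neg, neg_neg, true_and,
      ← sub_eq_add_neg, sub_eq_zero (a := m), Module.End.one_apply] at e2 ⊢
    linear_combination (norm := module) (1 / 2 : ℂ) • e2
  rw [h1, hcomm]
  simp only [h.virasoro_comm_pair_vac _ hm hN]
  rcases lt_trichotomy m N with hlt | rfl | hgt
  · simp only [if_pos hlt, if_neg hlt.ne]
    have := h.virasoro_vac_neg (N := N - m) (by omega)
    rw [neg_sub] at this
    rw [this]
    simp only [LinearMap.sub_apply, LinearMap.smul_apply, LinearMap.sum_apply (t := Finset.univ),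
      smul_sub, add_zero, zero_smul]
    have e3 : ∑ i, η i • ((m + N : ℤ) : ℂ) • (∑ k ∈ Finset.Icc 0 (N - m), a i (-k) * a i (k - (N - m))) vac
        = ((m + N : ℤ) : ℂ) • ∑ i, η i • (∑ k ∈ Finset.Icc 0 (N - m), a i (-k) * a i (k - (N - m))) vac := by
      rw [Finset.smul_sum]
      exact Finset.sum_congr rfl fun i _ => smul_comm _ _ _
    rw [e3]
    push_cast
    module
  · simp only [lt_irrefl, if_false, if_true, zero_add, sub_self]
    rw [h.virasoro_vac_zero, h.zero, h.zero_u]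
    have e4 : ∀ i, η i • (((m : ℂ) ^ 3 - m) / 6 + 2 * m * (η i * z i ^ 2)) • η i • vac
        = (((m : ℂ) ^ 3 - m) / 6 + 2 * m * (η i * z i ^ 2)) • vac := fun i => by
      have hm2 := h.metric i
      rw [smul_smul, smul_smul]
      congr 1
      linear_combination (((m : ℂ) ^ 3 - m) / 6 + 2 * m * (η i * z i ^ 2)) * hm2
    have hq := h.charge
    simp only [e4]
    rw [← Finset.sum_smul, Finset.sum_add_distrib, ← Finset.mul_sum, Finset.sum_const,
      Finset.card_univ, nsmul_eq_mul]
    simp only [zero_smul, LinearMap.zero_apply, smul_zero, add_zero, zero_add, smul_smul,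
      ← add_smul, ← sub_smul]
    congr 1
    push_cast
    -- The background charge contributes `-q^2 m^3 = 2 w m^3`. Of this, `2 w m` belongs to the shift
    -- of `2 m L_0`, and `2 w (m^3 - m)` enters the central term.
    linear_combination (-(m : ℂ) ^ 3) * hq
  · simp only [if_neg hgt.not_gt, if_neg hgt.ne', h.pos_vac u (m - N) (by omega),
      h.virasoro_vac_pos (m := m - N) (by omega)]
    simp

/-- By `virasoro_comm_mode_comm` the difference of the two sides commutes with all modes, so by
`IsMatter.ext` it suffices to evaluate it on the vacuum. The resulting central charge is `card ι +
24 w`. -/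
theorem virasoro_comm {m : ℤ} (hm : 0 ≤ m) (n : ℤ) :
    L m * L n - L n * L m = ((m - n : ℤ) : ℂ) • L (m + n)
      + (if m + n = 0 then ((Fintype.card ι : ℂ) / 12 + 2 * w) * ((m : ℂ) ^ 3 - m) else 0) • 1 := by
  rw [← sub_eq_zero]
  refine h.ext _ ?_ fun j k _ => ?_
  · rcases le_or_gt 0 n with hn | hn
    · obtain ⟨t, ht, ht0⟩ := h.virasoro_vac_nonneg hm
      obtain ⟨t', ht', ht0'⟩ := h.virasoro_vac_nonneg hn
      have h1 : ((m - n : ℤ) : ℂ) • L (m + n) vac = 0 := by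
        by_cases h0 : m = n
        · simp [h0]
        · rw [h.virasoro_vac_pos (by omega), smul_zero]
      have h2 : (if m + n = 0 then ((Fintype.card ι : ℂ) / 12 + 2 * w) * ((m : ℂ) ^ 3 - m) else 0)
          = 0 := by
        split_ifs with h0
        · have : m = 0 := by omega
          simp [this]
        · rfl
      simp only [LinearMap.sub_apply, LinearMap.add_apply, LinearMap.smul_apply, h1, h2,
        Module.End.mul_apply, ht, ht', map_smul, zero_smul]
      rw [smul_comm]
      simp
    · obtain ⟨N, rfl⟩ : ∃ N, n = -N := ⟨-n, by ring⟩
      rw [LinearMap.sub_apply, h.virasoro_comm_vac_neg hm (by omega)]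
      simp only [LinearMap.add_apply, LinearMap.smul_apply, Module.End.one_apply, sub_neg_eq_add,
        ← sub_eq_add_neg, sub_eq_zero (a := m)]
      split_ifs <;> simp
  · have := h.virasoro_comm_mode_comm m n j k
    simp only [sub_mul, mul_sub, add_mul, mul_add, smul_mul_assoc, mul_smul_comm, one_mul, mul_one,
      smul_sub] at this ⊢
    linear_combination (norm := module) this

end IsMatter

end Matter

/-! ### The ghost Virasoro algebra and the ghost differential -/

section GhostAlgebra

variable {V : Type*} [AddCommGroup V] [Module ℂ V]

/-- The normally ordered product of a ghost and an anti-ghost mode. -/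
def modeCB (c b : ℤ → Module.End ℂ V) (r s : ℤ) : Module.End ℂ V :=
  if r = 0 ∧ s = 0 then (1 / 2 : ℂ) • (c 0 * b 0 - b 0 * c 0)
  else if 0 ≤ s then c r * b s
  else -(b s * c r)

/-- Ghost modes `c`, `b` generating `V` from `vac`, the ghost Virasoro operators `ℓ` and the ghost
differential `d`. -/
structure IsGhost (c b : ℤ → Module.End ℂ V) (vac : V) (ℓ : ℤ → Module.End ℂ V)
    (d : Module.End ℂ V) : Prop where
  cc : ∀ m n, c m * c n = -(c n * c m)
  bb : ∀ m n, b m * b n = -(b n * b m)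
  bc : ∀ m n, b m * c n + c n * b m = if m + n = 0 then 1 else 0
  finite : ∀ v, ∃ N : ℕ, ∀ n : ℤ, (N : ℤ) ≤ n → c n v = 0 ∧ b n v = 0
  c_vac : ∀ n : ℤ, 0 < n → c n vac = 0
  b_vac : ∀ n : ℤ, 0 ≤ n → b n vac = 0
  gen : ∀ P : Submodule ℂ V, vac ∈ P → (∀ n : ℤ, n ≤ 0 → ∀ v ∈ P, c n v ∈ P) →
    (∀ n : ℤ, n < 0 → ∀ v ∈ P, b n v ∈ P) → P = ⊤
  virasoro : ∀ m, HasPf (fun k : ℤ => ((k - m : ℤ) : ℂ) • modeCB c b (-k) (m + k)) (ℓ m)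
  differential : ∃ A B, HasPf (fun m : ℕ+ => c (-(m : ℤ)) * ℓ m) A ∧
    HasPf (fun m : ℕ+ => ℓ (-(m : ℤ)) * c m) B ∧
    d = (1 / 2 : ℂ) • A + (1 / 2 : ℂ) • (c 0 * ℓ 0) + (1 / 2 : ℂ) • B

namespace IsGhost

variable {c b : ℤ → Module.End ℂ V} {vac : V} {ℓ : ℤ → Module.End ℂ V} {d : Module.End ℂ V}
  (h : IsGhost c b vac ℓ d)

include h

/-- An operator which kills the vacuum and commutes, or anticommutes, with the creation operators
vanishes. -/
theorem ext (X : Module.End ℂ V) (h1 : X vac = 0) (s : ℂ)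
    (hC : ∀ n : ℤ, n ≤ 0 → X * c n = s • (c n * X))
    (hB : ∀ n : ℤ, n < 0 → X * b n = s • (b n * X)) : X = 0 := by
  have := h.gen (LinearMap.ker X) h1 (fun n hn v hv => by
      have := LinearMap.congr_fun (hC n hn) v
      simp only [Module.End.mul_apply, LinearMap.smul_apply, LinearMap.mem_ker.mp hv, map_zero,
        smul_zero] at this
      exact this)
    (fun n hn v hv => by
      have := LinearMap.congr_fun (hB n hn) v
      simp only [Module.End.mul_apply, LinearMap.smul_apply, LinearMap.mem_ker.mp hv, map_zero,
        smul_zero] at this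
      exact this)
  exact LinearMap.ker_eq_top.mp this

theorem bc' (m n : ℤ) : b m * c n = -(c n * b m) + (if m + n = 0 then 1 else 0 : ℂ) • 1 := by
  have := h.bc m n
  split_ifs at this ⊢ <;> linear_combination (norm := module) this

theorem modeCB_eq (r s : ℤ) : ∃ t : ℂ, modeCB c b r s = c r * b s + t • 1 := by
  unfold modeCB
  split_ifs with h1 h2
  · refine ⟨-(1 / 2), ?_⟩
    rw [h1.1, h1.2, h.bc' 0 0, if_pos (by norm_num)]
    module
  · exact ⟨0, by simp⟩
  · exact ⟨-(if s + r = 0 then 1 else 0), by rw [h.bc' s r]; module⟩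

theorem modeCB_comm_c (r s n : ℤ) : modeCB c b r s * c n - c n * modeCB c b r s
    = (if s + n = 0 then 1 else 0 : ℂ) • c r := by
  obtain ⟨t, ht⟩ := h.modeCB_eq r s
  rw [ht, add_mul, mul_assoc, h.bc' s n]
  simp only [mul_add, mul_neg, ← mul_assoc, h.cc r n, mul_smul_comm, smul_mul_assoc, mul_one,
    one_mul, neg_mul]
  module

theorem modeCB_comm_b (r s n : ℤ) : modeCB c b r s * b n - b n * modeCB c b r s
    = -((if n + r = 0 then 1 else 0 : ℂ) • b s) := by
  obtain ⟨t, ht⟩ := h.modeCB_eq r s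
  rw [ht, mul_add, ← mul_assoc, h.bc' n r]
  simp only [add_mul, mul_assoc, h.bb s n, mul_smul_comm, smul_mul_assoc, mul_one,
    one_mul, neg_mul, mul_neg]
  module

theorem virasoro_comm_c (m n : ℤ) :
    ℓ m * c n - c n * ℓ m = (-(2 * m + n : ℤ) : ℂ) • c (m + n) := by
  refine ((h.virasoro m).comm (c n)).unique ((hasPf_single (-m - n) _).congr fun k => ?_)
  rw [smul_mul_assoc, mul_smul_comm, ← smul_sub, h.modeCB_comm_c]
  by_cases hk : k = -m - n
  · subst hk
    rw [if_pos (by ring), if_pos rfl, one_smul, show -(-m - n) = m + n by ring]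
    congr 1
    push_cast
    ring
  · rw [if_neg (by omega), if_neg hk, zero_smul, smul_zero]

theorem virasoro_comm_b (m n : ℤ) :
    ℓ m * b n - b n * ℓ m = ((m - n : ℤ) : ℂ) • b (m + n) := by
  refine ((h.virasoro m).comm (b n)).unique ((hasPf_single n _).congr fun k => ?_)
  rw [smul_mul_assoc, mul_smul_comm, ← smul_sub, h.modeCB_comm_b]
  by_cases hk : k = n
  · subst hk
    rw [if_pos (by ring), if_pos rfl, one_smul]
    push_cast
    module
  · rw [if_neg (by omega), if_neg hk, zero_smul, neg_zero, smul_zero]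

theorem virasoroTerm_vac (m k : ℤ) (hk : m + k ≥ 0 ∨ k < 0) :
    (((k - m : ℤ) : ℂ) • modeCB c b (-k) (m + k)) vac = 0 := by
  unfold modeCB
  split_ifs with h1 h2
  · rw [show k - m = 0 by omega]
    simp
  · simp [h.b_vac _ h2]
  · simp [h.c_vac (-k) (by omega)]

theorem virasoro_vac_nonneg {m : ℤ} (hm : 0 ≤ m) : ℓ m vac = 0 :=
  (h.virasoro m).apply_eq_zero fun k => h.virasoroTerm_vac m k (by omega)

theorem virasoro_vac_neg {N : ℤ} (hN : 0 < N) : ℓ (-N) vac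
    = (∑ k ∈ Finset.Ico 0 N, ((k + N : ℤ) : ℂ) • (c (-k) * b (k - N))) vac := by
  rw [(h.virasoro (-N)).apply_eq_sum (v := vac) (Finset.Ico 0 N) fun k hk =>
    h.virasoroTerm_vac (-N) k (by simp at hk; omega), LinearMap.sum_apply]
  refine Finset.sum_congr rfl fun k hk => ?_
  simp only [Finset.mem_Ico] at hk
  have : modeCB c b (-k) (-N + k) = c (-k) * b (k - N) := by
    rw [modeCB, if_neg (by omega), if_neg (by omega), neg_add_eq_sub, h.bc', if_neg (by omega)]
    module
  rw [this, sub_neg_eq_add]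

/-- The method is that of the matter sector. For `m = N` the contractions leave `-∑ (k + m) (2 m -
k)` over `0 ≤ k < m`, which is `-(13 m^3 - m) / 6`, corresponding to central charge `-26`. -/
theorem virasoro_comm_vac_neg {m N : ℤ} (hm : 0 ≤ m) (hN : 0 < N) :
    (ℓ m * ℓ (-N) - ℓ (-N) * ℓ m) vac = ((m + N : ℤ) : ℂ) • ℓ (m - N) vac
      + (if m = N then (-(13 * (m : ℂ) ^ 3 - m) / 6) • vac else 0) := by
  set f : ℤ → V := fun j => c (-j) (b (j - (N - m)) vac) with hf
  have hf1 : ∀ j, N - m ≤ j → f j = 0 := fun j hj => by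
    simp only [hf]
    rw [h.b_vac _ (by omega), map_zero]
  have hf2 : ∀ j < 0, f j = if m = N then vac else 0 := fun j hj => by
    have := LinearMap.congr_fun (h.bc' (j - (N - m)) (-j)) vac
    simp only [LinearMap.add_apply, LinearMap.neg_apply, LinearMap.smul_apply,
      Module.End.mul_apply, h.c_vac (-j) (by omega), map_zero, Module.End.one_apply] at this
    have e : (j - (N - m) + -j = 0) ↔ m = N := by omega
    simp only [e] at this
    simp only [hf]
    split_ifs at this ⊢ <;> linear_combination (norm := module) this
  set O : Module.End ℂ V := ∑ k ∈ Finset.Ico 0 N, ((k + N : ℤ) : ℂ) • (c (-k) * b (k - N)) with hO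
  have h1 : (ℓ m * ℓ (-N) - ℓ (-N) * ℓ m) vac = (ℓ m * O - O * ℓ m) vac := by
    simp only [LinearMap.sub_apply, Module.End.mul_apply, h.virasoro_vac_nonneg hm, map_zero]
    rw [h.virasoro_vac_neg hN]
  have hpair : ∀ k, ℓ m * (c (-k) * b (k - N)) - (c (-k) * b (k - N)) * ℓ m
      = (-((2 * m - k : ℤ) : ℂ)) • (c (m - k) * b (k - N))
        + ((m + N - k : ℤ) : ℂ) • (c (-k) * b (m + k - N)) := by
    intro k
    have e : ℓ m * (c (-k) * b (k - N)) - (c (-k) * b (k - N)) * ℓ m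
        = (ℓ m * c (-k) - c (-k) * ℓ m) * b (k - N)
          + c (-k) * (ℓ m * b (k - N) - b (k - N) * ℓ m) := by
      simp only [mul_sub, sub_mul, mul_assoc]
      abel
    rw [e, h.virasoro_comm_c, h.virasoro_comm_b]
    simp only [smul_mul_assoc, mul_smul_comm, ← sub_eq_add_neg, ← add_sub_assoc]
    push_cast
    module
  have hsum : (ℓ m * O - O * ℓ m) vac
      = ∑ j ∈ Finset.Ico (-m) (N - m), (-((j + m + N : ℤ) : ℂ) * ((m - j : ℤ) : ℂ)) • f j
        + ∑ j ∈ Finset.Ico 0 N, (((j + N : ℤ) : ℂ) * ((m + N - j : ℤ) : ℂ)) • f j := by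
    have e : ℓ m * O - O * ℓ m = ∑ k ∈ Finset.Ico 0 N, ((k + N : ℤ) : ℂ) •
        (ℓ m * (c (-k) * b (k - N)) - (c (-k) * b (k - N)) * ℓ m) := by
      rw [hO]
      simp only [mul_smul_comm, smul_mul_assoc, Finset.mul_sum, Finset.sum_mul, smul_sub,
        Finset.sum_sub_distrib]
    rw [e, LinearMap.sum_apply]
    simp only [hpair, smul_add, LinearMap.add_apply, Finset.sum_add_distrib]
    congr 1
    · refine Finset.sum_bij' (fun k _ => k - m) (fun j _ => j + m) ?_ ?_ ?_ ?_ ?_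
      · intro k hk
        simp only [Finset.mem_Ico] at hk ⊢
        omega
      · intro k hk
        simp only [Finset.mem_Ico] at hk ⊢
        omega
      · intro k _; ring
      · intro k _; ring
      · intro k _
        simp only [hf, LinearMap.smul_apply, Module.End.mul_apply]
        rw [show -(k - m) = m - k by ring, show k - m - (N - m) = k - N by ring, smul_smul]
        congr 1
        push_cast
        ring
    · refine Finset.sum_congr rfl fun j _ => ?_
      simp only [hf, LinearMap.smul_apply, Module.End.mul_apply]
      rw [show j - (N - m) = m + j - N by ring, smul_smul]
  rw [h1, hsum]
  rcases lt_trichotomy m N with hlt | rfl | hgt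
  · rw [if_neg hlt.ne, add_zero]
    have e1 : ∑ j ∈ Finset.Ico (-m) (N - m), (-((j + m + N : ℤ) : ℂ) * ((m - j : ℤ) : ℂ)) • f j
        = ∑ j ∈ Finset.Ico 0 (N - m), (-((j + m + N : ℤ) : ℂ) * ((m - j : ℤ) : ℂ)) • f j := by
      refine (Finset.sum_subset (Finset.Ico_subset_Ico (by omega) le_rfl) fun j hj hj' => ?_).symm
      simp only [Finset.mem_Ico] at hj hj'
      rw [hf2 j (by omega), if_neg hlt.ne, smul_zero]
    have e2 : ∑ j ∈ Finset.Ico 0 N, (((j + N : ℤ) : ℂ) * ((m + N - j : ℤ) : ℂ)) • f j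
        = ∑ j ∈ Finset.Ico 0 (N - m), (((j + N : ℤ) : ℂ) * ((m + N - j : ℤ) : ℂ)) • f j := by
      refine (Finset.sum_subset (Finset.Ico_subset_Ico le_rfl (by omega)) fun j hj hj' => ?_).symm
      simp only [Finset.mem_Ico] at hj hj'
      rw [hf1 j (by omega), smul_zero]
    have e3 := h.virasoro_vac_neg (N := N - m) (by omega)
    rw [neg_sub] at e3
    rw [e1, e2, e3, ← Finset.sum_add_distrib, LinearMap.sum_apply, Finset.smul_sum]
    refine Finset.sum_congr rfl fun j _ => ?_
    rw [← add_smul, LinearMap.smul_apply, Module.End.mul_apply, smul_smul]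
    congr 1
    push_cast
    ring
  · rw [if_pos rfl, sub_self, h.virasoro_vac_nonneg le_rfl, smul_zero, zero_add]
    rw [Finset.sum_eq_zero (s := Finset.Ico 0 m), add_zero]
    · have e1 : ∀ j ∈ Finset.Ico (-m) 0, (-((j + m + m : ℤ) : ℂ) * ((m - j : ℤ) : ℂ)) • f j
          = (-((j + m + m : ℤ) : ℂ) * ((m - j : ℤ) : ℂ)) • vac := fun j hj => by
        simp only [Finset.mem_Ico] at hj
        rw [hf2 j (by omega), if_pos rfl]
      rw [Finset.sum_congr rfl e1, ← Finset.sum_smul]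
      congr 1
      obtain ⟨n, rfl⟩ := Int.eq_ofNat_of_zero_le hm
      have e2 : ∑ j ∈ Finset.Ico (-(n : ℤ)) 0,
            (-((j + n + n : ℤ) : ℂ) * (((n : ℤ) - j : ℤ) : ℂ))
          = ∑ k ∈ Finset.range n, (-((k : ℂ) + n) * (2 * n - k)) := by
        refine Finset.sum_bij' (fun j _ => (j + n).toNat) (fun k _ => (k : ℤ) - n) ?_ ?_ ?_ ?_ ?_
        · intro k hk
          simp only [Finset.mem_Ico, Finset.mem_range] at hk ⊢
          omega
        · intro k hk
          simp only [Finset.mem_Ico, Finset.mem_range] at hk ⊢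
          omega
        · intro k hk
          simp only [Finset.mem_Ico] at hk
          omega
        · intro k _
          simp
        · intro k hk
          simp only [Finset.mem_Ico] at hk
          have : (((k + n).toNat : ℕ) : ℂ) = ((k + n : ℤ) : ℂ) := by
            have := congrArg (Int.cast : ℤ → ℂ) (Int.toNat_of_nonneg (show 0 ≤ k + n by omega))
            rwa [Int.cast_natCast] at this
          rw [this]
          push_cast
          ring
      -- The parameter `M` is separated from the number of summands `n` so that induction on `n`
      -- applies.
      have e3 : ∀ M : ℂ, ∀ n : ℕ, ∑ k ∈ Finset.range n, (-((k : ℂ) + M) * (2 * M - k))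
          = -(2 * M ^ 2 * n + M * (n * (n - 1)) / 2 - (n - 1) * n * (2 * n - 1) / 6) := by
        intro M n
        induction n with
        | zero => simp
        | succ n ih =>
          rw [Finset.sum_range_succ, ih]
          push_cast
          ring
      rw [e2, e3]
      push_cast
      ring
    · intro j hj
      simp only [Finset.mem_Ico] at hj
      rw [hf1 j (by omega), smul_zero]
  · rw [if_neg hgt.ne', add_zero, h.virasoro_vac_nonneg (by omega), smul_zero]
    rw [Finset.sum_eq_zero, Finset.sum_eq_zero, add_zero]
    · intro j hj
      simp only [Finset.mem_Ico] at hj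
      rw [hf1 j (by omega), smul_zero]
    · intro j hj
      simp only [Finset.mem_Ico] at hj
      rw [hf2 j (by omega), if_neg hgt.ne', smul_zero]

/-- Opposite signs suffice: the relation is applied to the creation modes `b_n` when the ghost
anomaly is computed. -/
theorem virasoro_comm {m n : ℤ} (hm : 0 ≤ m) (hn : n < 0) :
    ℓ m * ℓ n - ℓ n * ℓ m = ((m - n : ℤ) : ℂ) • ℓ (m + n)
      + (if m + n = 0 then -(13 * (m : ℂ) ^ 3 - m) / 6 else 0) • 1 := by
  have jac : ∀ x : Module.End ℂ V, (ℓ m * ℓ n - ℓ n * ℓ m) * x - x * (ℓ m * ℓ n - ℓ n * ℓ m)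
      = (ℓ m * (ℓ n * x - x * ℓ n) - (ℓ n * x - x * ℓ n) * ℓ m)
        - (ℓ n * (ℓ m * x - x * ℓ m) - (ℓ m * x - x * ℓ m) * ℓ n) := fun x => by
    simp only [mul_sub, sub_mul, mul_assoc]
    abel
  have e' : ∀ (s : ℂ) (x y : Module.End ℂ V), x * (s • y) - (s • y) * x
      = s • (x * y - y * x) := fun s x y => by
    simp only [mul_smul_comm, smul_mul_assoc]
    module
  rw [← sub_eq_zero]
  refine h.ext _ ?_ 1 (fun k _ => ?_) (fun k _ => ?_)
  · obtain ⟨N, rfl⟩ : ∃ N, n = -N := ⟨-n, by ring⟩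
    rw [LinearMap.sub_apply, h.virasoro_comm_vac_neg hm (by omega)]
    simp only [LinearMap.add_apply, LinearMap.smul_apply, Module.End.one_apply, sub_neg_eq_add,
      ← sub_eq_add_neg, sub_eq_zero (a := m)]
    split_ifs <;> simp
  · have := jac (c k)
    rw [h.virasoro_comm_c, h.virasoro_comm_c, e', e', h.virasoro_comm_c, h.virasoro_comm_c,
      show n + (m + k) = m + n + k by ring, show m + (n + k) = m + n + k by ring] at this
    have h2 := congrArg (((m - n : ℤ) : ℂ) • ·) (h.virasoro_comm_c (m + n) k)
    simp only [sub_mul, mul_sub, add_mul, mul_add, smul_mul_assoc, mul_smul_comm, one_mul, mul_one,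
      smul_sub] at this h2 ⊢
    push_cast at this h2 ⊢
    linear_combination (norm := module) this - h2
  · have := jac (b k)
    rw [h.virasoro_comm_b, h.virasoro_comm_b, e', e', h.virasoro_comm_b, h.virasoro_comm_b,
      show n + (m + k) = m + n + k by ring, show m + (n + k) = m + n + k by ring] at this
    have h2 := congrArg (((m - n : ℤ) : ℂ) • ·) (h.virasoro_comm_b (m + n) k)
    simp only [sub_mul, mul_sub, add_mul, mul_add, smul_mul_assoc, mul_smul_comm, one_mul, mul_one,
      smul_sub] at this h2 ⊢
    push_cast at this h2 ⊢
    linear_combination (norm := module) this - h2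

/-- The three pieces of `2 d` form one sum over the integers. In each summand the right-hand factor
kills the vacuum, so `d` does too. -/
theorem hasPf_differential : HasPf (fun k : ℤ => if 0 ≤ k then c (-k) * ℓ k else ℓ k * c (-k))
    ((2 : ℂ) • d) := by
  obtain ⟨A, B, hA, hB, hd⟩ := h.differential
  have := HasPf.of_int (T := fun k : ℤ => if 0 ≤ k then c (-k) * ℓ k else ℓ k * c (-k))
    (hA.congr fun m => if_pos (by positivity))
    (hB.congr fun m => by rw [if_neg (by have := m.pos; omega), neg_neg])
  rw [hd]
  convert this using 1
  simp only [le_refl, if_true, neg_zero]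
  module

theorem differential_vac : d vac = 0 := by
  have := h.hasPf_differential.apply_eq_zero (v := vac) fun k => by
    split_ifs with hk
    · rw [Module.End.mul_apply, h.virasoro_vac_nonneg hk, map_zero]
    · rw [Module.End.mul_apply, h.c_vac _ (by omega), map_zero]
  simpa using this

/-- The anticommutator of the ghost differential with `b_n` is the ghost Virasoro operator. -/
theorem differential_anticomm_b (n : ℤ) : b n * d + d * b n = ℓ n := by
  -- In the anticommutator with `2 d`, contracting `b_n` with `c_{-k}` gives the single term `ℓ_n`.
  -- The commutators of `ℓ_k` with `b_n` give the family `(k - n) c_{-k} b_{n+k}`, which sums to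
  -- `ℓ_n` once more.
  have key : HasPf (fun k : ℤ => (if k = n then ℓ n else 0)
      + ((k - n : ℤ) : ℂ) • modeCB c b (-k) (n + k)) (ℓ n + ℓ n) :=
    (hasPf_single n _).add (h.virasoro n)
  have := (h.hasPf_differential.anticomm (b n)).unique (key.congr fun k => ?_)
  · have e : b n * ((2 : ℂ) • d) + ((2 : ℂ) • d) * b n = (2 : ℂ) • (b n * d + d * b n) := by
      simp only [mul_smul_comm, smul_mul_assoc]
      module
    rw [e, ← two_smul ℂ] at this
    exact smul_right_injective _ (two_ne_zero) this
  · have hbc := h.bc' n (-k)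
    have hbc' := h.bc' (n + k) (-k)
    have hl := h.virasoro_comm_b k n
    have hdel : (if k = n then ℓ n else 0) = (if n + -k = 0 then 1 else 0 : ℂ) • ℓ k := by
      by_cases hk : k = n
      · subst hk; simp
      · rw [if_neg hk, if_neg (by omega), zero_smul]
    -- The orderings prescribed by `0 ≤ k` and by `0 ≤ n + k` differ only for `n ≠ 0`, where the two
    -- modes anticommute. For `n = 0` the symmetrized zero-mode term has coefficient zero.
    have hmode : ((k - n : ℤ) : ℂ) • modeCB c b (-k) (n + k)
        = ((k - n : ℤ) : ℂ) • (if 0 ≤ k then c (-k) * b (n + k) else -(b (n + k) * c (-k))) := by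
      unfold modeCB
      by_cases hn : n = 0
      · subst hn
        by_cases hk0 : k = 0
        · simp [hk0]
        · rw [if_neg (by omega), zero_add]
      · rw [if_neg (by omega)]
        rw [if_neg (by omega)] at hbc'
        rw [hbc', zero_smul, add_zero, neg_neg, ite_self, ite_self]
    rw [hdel, hmode]
    clear hdel hmode
    generalize (if n + -k = 0 then 1 else 0 : ℂ) = δ at hbc ⊢
    split_ifs with hk
    · have e : b n * (c (-k) * ℓ k) + c (-k) * ℓ k * b n
          = (b n * c (-k)) * ℓ k + c (-k) * (ℓ k * b n - b n * ℓ k) + c (-k) * b n * ℓ k := by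
        simp only [mul_sub, mul_assoc]; abel
      rw [e, hbc, hl, add_comm k n]
      simp only [add_mul, neg_mul, smul_mul_assoc, one_mul, mul_smul_comm]
      module
    · have e : b n * (ℓ k * c (-k)) + ℓ k * c (-k) * b n
          = ℓ k * (b n * c (-k)) - (ℓ k * b n - b n * ℓ k) * c (-k) + ℓ k * c (-k) * b n := by
        simp only [sub_mul, mul_assoc]; abel
      rw [e, hbc, hl, add_comm k n]
      simp only [mul_add, mul_neg, smul_mul_assoc, mul_one, mul_smul_comm, mul_assoc]
      module

theorem hasPf_differential_anticomm_c (n : ℤ) :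
    HasPf (fun k : ℤ => (-((2 * k + n : ℤ) : ℂ) / 2) • (c (-k) * c (k + n)))
      (c n * d + d * c n) := by
  have := (h.hasPf_differential.anticomm (c n)).smul (1 / 2)
  have e : (1 / 2 : ℂ) • (c n * ((2 : ℂ) • d) + ((2 : ℂ) • d) * c n) = c n * d + d * c n := by
    simp only [mul_smul_comm, smul_mul_assoc]
    module
  rw [e] at this
  refine this.congr fun k => ?_
  have hl := h.virasoro_comm_c k n
  have hcc := h.cc n (-k)
  have hcc' := h.cc (k + n) (-k)
  split_ifs with hk
  · have e : c n * (c (-k) * ℓ k) + c (-k) * ℓ k * c n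
        = (c n * c (-k)) * ℓ k + c (-k) * (ℓ k * c n - c n * ℓ k) + c (-k) * c n * ℓ k := by
      simp only [mul_sub, mul_assoc]; abel
    rw [e, hcc, hl]
    simp only [neg_mul, mul_smul_comm]
    push_cast
    module
  · have e : c n * (ℓ k * c (-k)) + ℓ k * c (-k) * c n
        = ℓ k * (c n * c (-k)) - (ℓ k * c n - c n * ℓ k) * c (-k) + ℓ k * c (-k) * c n := by
      simp only [sub_mul, mul_assoc]; abel
    rw [e, hcc, hl]
    simp only [mul_neg, smul_mul_assoc, mul_assoc, hcc']
    push_cast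
    module

theorem pointwiseFinite_cc (n : ℤ) (w : ℤ → ℂ) :
    PointwiseFinite fun k : ℤ => w k • (c (-k) * c (k + n)) := by
  intro v
  obtain ⟨N, hN⟩ := h.finite v
  refine (Set.finite_Ioo (-(N : ℤ)) (N - n)).subset fun k hk => ?_
  by_contra hc
  apply hk
  simp only [Set.mem_Ioo, not_and_or, not_lt] at hc
  change (w k • (c (-k) * c (k + n))) v = 0
  rcases hc with hc | hc
  · rw [h.cc]
    simp [(hN (-k) (by omega)).1]
  · simp [(hN (k + n) (by omega)).1]

/-- The quadratic expression `{c_n, d}` transforms under `ℓ_m` as `c_n` does. The commutator acts on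
either factor; shifting the summation index by `m` in the first contribution makes the coefficients
match summand by summand. -/
theorem virasoro_comm_differential_anticomm_c (m n : ℤ) :
    ℓ m * (c n * d + d * c n) - (c n * d + d * c n) * ℓ m
      = (-(2 * m + n : ℤ) : ℂ) • (c (m + n) * d + d * c (m + n)) := by
  have h1 := (h.hasPf_differential_anticomm_c n).comm' (ℓ m)
  have h2 := hasPf_pfSum (h.pointwiseFinite_cc (m + n)
    fun k => ((2 * k + 2 * m + n : ℤ) * (m - k : ℤ)) / 2)
  have h3 := hasPf_pfSum (h.pointwiseFinite_cc (m + n)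
    fun k => ((2 * k + n : ℤ) * (2 * m + k + n : ℤ)) / 2)
  have h4 := (h.hasPf_differential_anticomm_c (m + n)).smul (-(2 * m + n : ℤ) : ℂ)
  have h5 := h4.unique ((h2.add h3).congr fun k => by
    rw [smul_smul, ← add_smul]
    congr 1
    push_cast
    ring)
  rw [h5]
  refine h1.unique (((h2.reindex (Equiv.subRight m)).add h3).congr fun k => ?_)
  have e : ℓ m * (c (-k) * c (k + n)) - (c (-k) * c (k + n)) * ℓ m
      = (ℓ m * c (-k) - c (-k) * ℓ m) * c (k + n)
        + c (-k) * (ℓ m * c (k + n) - c (k + n) * ℓ m) := by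
    simp only [mul_sub, sub_mul, mul_assoc]; abel
  rw [mul_smul_comm, smul_mul_assoc, ← smul_sub, e, h.virasoro_comm_c, h.virasoro_comm_c]
  simp only [Equiv.subRight_apply, smul_mul_assoc, mul_smul_comm]
  rw [show -(k - m) = m + -k by ring, show k - m + (m + n) = k + n by ring,
    show m + (k + n) = k + (m + n) by ring]
  push_cast
  module

/-- The ghost anomaly. -/
theorem virasoro_comm_differential {m : ℤ} (hm : 0 ≤ m) :
    ℓ m * d - d * ℓ m = (-(13 * (m : ℂ) ^ 3 - m) / 6) • c m := by
  rw [← sub_eq_zero]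
  -- The difference is odd in the ghosts, hence the sign `-1`. Against `c_n` it vanishes by the
  -- previous lemma. Against `b_n`, the relation `{b_n, d} = ℓ_n` reduces the claim to `[ℓ_m, ℓ_n]`,
  -- whose central term is the anomaly.
  refine h.ext _ ?_ (-1) (fun n _ => ?_) (fun n hn => ?_)
  · simp only [LinearMap.sub_apply, Module.End.mul_apply, LinearMap.smul_apply,
      h.differential_vac, h.virasoro_vac_nonneg hm, map_zero]
    rcases hm.eq_or_lt with rfl | hm
    · simp
    · simp [h.c_vac m hm]
  · have h1 := h.virasoro_comm_differential_anticomm_c m n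
    have h2 := h.virasoro_comm_c m n
    have e : (ℓ m * d - d * ℓ m) * c n + c n * (ℓ m * d - d * ℓ m)
        = (ℓ m * (c n * d + d * c n) - (c n * d + d * c n) * ℓ m)
          - ((ℓ m * c n - c n * ℓ m) * d + d * (ℓ m * c n - c n * ℓ m)) := by
      simp only [mul_sub, sub_mul, mul_add, add_mul, mul_assoc]; abel
    rw [h1, h2] at e
    simp only [sub_mul (_ - _), mul_sub (c n), smul_mul_assoc, mul_smul_comm, h.cc m n] at e ⊢
    linear_combination (norm := module) e
  · have h2 := h.virasoro_comm_b m n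
    have h3 := h.virasoro_comm hm hn
    have h4 := h.differential_anticomm_b (m + n)
    have e : (ℓ m * d - d * ℓ m) * b n + b n * (ℓ m * d - d * ℓ m)
        = (ℓ m * (b n * d + d * b n) - (b n * d + d * b n) * ℓ m)
          - ((ℓ m * b n - b n * ℓ m) * d + d * (ℓ m * b n - b n * ℓ m)) := by
      simp only [mul_sub, sub_mul, mul_add, add_mul, mul_assoc]; abel
    rw [h.differential_anticomm_b, h3, h2, smul_mul_assoc, mul_smul_comm, ← smul_add, h4] at e
    have hbc := h.bc' n m
    simp only [add_comm n m] at hbc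
    simp only [sub_mul (_ - _), mul_sub (b n), smul_mul_assoc, mul_smul_comm, hbc] at e ⊢
    have : (if m + n = 0 then -(13 * (m : ℂ) ^ 3 - m) / 6 else 0)
        = (-(13 * (m : ℂ) ^ 3 - m) / 6) * (if m + n = 0 then 1 else 0) := by
      split_ifs <;> simp
    rw [this] at e
    linear_combination (norm := module) e

end IsGhost

end GhostAlgebra

/-! ### The anomaly of the string differential -/

section Total

variable {M G V : Type*} [AddCommGroup M] [Module ℂ M] [AddCommGroup G] [Module ℂ G]
  [AddCommGroup V] [Module ℂ V]

/-- The endomorphism `T` is diagonalizable with eigenvalues in `ℕ`. -/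
def NatDiag (T : Module.End ℂ V) : Prop := ⨆ n : ℕ, Module.End.eigenspace T (n : ℂ) = ⊤

/-- The actions of the operators on the factors of a tensor product. -/
structure IsTensor (α : Module.End ℂ M →ₐ[ℂ] Module.End ℂ V)
    (γ : Module.End ℂ G →ₐ[ℂ] Module.End ℂ V) : Prop where
  comm : ∀ A B, γ B * α A = α A * γ B
  left {ι : Type} {T : ι → Module.End ℂ M} {A : Module.End ℂ M} :
    HasPf T A → HasPf (fun i => α (T i)) (α A)
  right {ι : Type} {T : ι → Module.End ℂ G} {A : Module.End ℂ G} :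
    HasPf T A → HasPf (fun i => γ (T i)) (γ A)
  finite_left {T : ℕ+ → Module.End ℂ M} (h : ∀ v, ∃ N : ℕ, ∀ m : ℕ+, N ≤ (m : ℕ) → T m v = 0) :
    ∀ v, ∃ N : ℕ, ∀ m : ℕ+, N ≤ (m : ℕ) → α (T m) v = 0
  finite_right {T : ℕ+ → Module.End ℂ G} (h : ∀ v, ∃ N : ℕ, ∀ m : ℕ+, N ≤ (m : ℕ) → T m v = 0) :
    ∀ v, ∃ N : ℕ, ∀ m : ℕ+, N ≤ (m : ℕ) → γ (T m) v = 0
  natDiag {A B} : NatDiag A → NatDiag B → NatDiag (α A + γ B)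

theorem pointwiseFinite_of_eventually {T : ℕ+ → Module.End ℂ V}
    (h : ∀ v, ∃ N : ℕ, ∀ m : ℕ+, N ≤ (m : ℕ) → T m v = 0) : PointwiseFinite T := by
  intro v
  obtain ⟨N, hN⟩ := h v
  exact pnat_finite_of_eventually N fun m hm h0 => h0 (hN m hm)

variable {α : Module.End ℂ M →ₐ[ℂ] Module.End ℂ V} {γ : Module.End ℂ G →ₐ[ℂ] Module.End ℂ V}

namespace IsTensor

variable (hT : IsTensor α γ)

include hT

theorem mul_mul (A A' : Module.End ℂ M) (B B' : Module.End ℂ G) :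
    α A * γ B * (α A' * γ B') = α (A * A') * γ (B * B') := by
  rw [mul_assoc, ← mul_assoc (γ B), hT.comm, map_mul, map_mul]
  simp only [mul_assoc]

omit hT in
theorem mul_left (A A' : Module.End ℂ M) (B' : Module.End ℂ G) :
    α A * (α A' * γ B') = α (A * A') * γ B' := by
  rw [map_mul, mul_assoc]

theorem left_mul (A A' : Module.End ℂ M) (B' : Module.End ℂ G) :
    α A' * γ B' * α A = α (A' * A) * γ B' := by
  rw [mul_assoc, hT.comm, ← mul_assoc, map_mul]

theorem mul_right (A' : Module.End ℂ M) (B B' : Module.End ℂ G) :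
    γ B * (α A' * γ B') = α A' * γ (B * B') := by
  rw [← mul_assoc, hT.comm, map_mul, mul_assoc]

omit hT in
theorem right_mul (A' : Module.End ℂ M) (B B' : Module.End ℂ G) :
    α A' * γ B' * γ B = α A' * γ (B' * B) := by
  rw [mul_assoc, map_mul]

end IsTensor

variable {ι : Type*} [Fintype ι] [DecidableEq ι] {η : ι → ℂ} {a : ι → ℤ → Module.End ℂ M}
  {vac : M} {z : ι → ℂ} {u : ι} {q w : ℂ} {L : ℤ → Module.End ℂ M}
  {c b : ℤ → Module.End ℂ G} {vac' : G} {ℓ : ℤ → Module.End ℂ G} {d : Module.End ℂ G}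

theorem total_virasoro_eq (hT : IsTensor α γ) (hG : IsGhost c b vac' ℓ d) {t : ℂ}
    {B : Module.End ℂ V}
    (hB : HasPf (fun m : ℤ => α (L m - (if m = 0 then t else 0) • 1) * γ (c (-m))) B) (m : ℤ) :
    γ (b m) * (B + γ d) + (B + γ d) * γ (b m)
      = α (L m - (if m = 0 then t else 0) • 1) + γ (ℓ m) := by
  have h1 : γ (b m) * B + B * γ (b m) = α (L m - (if m = 0 then t else 0) • 1) := by
    refine (hB.anticomm _).unique ((hasPf_single m _).congr fun k => ?_)
    rw [hT.mul_right, IsTensor.right_mul, ← mul_add, ← map_add, hG.bc]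
    by_cases hk : k = m
    · subst hk; simp
    · rw [if_neg (show m + -k ≠ 0 by omega), if_neg hk, map_zero, mul_zero]
  have h2 : γ (b m) * γ d + γ d * γ (b m) = γ (ℓ m) := by
    rw [← map_mul, ← map_mul, ← map_add, hG.differential_anticomm_b]
  rw [← h1, ← h2]
  simp only [mul_add, add_mul]
  abel

/-- The terms `(m - k) L_{m+k} c_{-k}` from `[L_m, L_k]` cancel, after a shift of index, against
those from `[ℓ_m, c_{-k}]`. What remains is the matter central term, the ghost anomaly, and `2 m t`
from subtracting the intercept `t` in `L_0`. -/
theorem total_virasoro_comm (hT : IsTensor α γ) (hM : IsMatter η a vac z u q w L)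
    (hG : IsGhost c b vac' ℓ d) {t : ℂ} {B : Module.End ℂ V}
    (hB : HasPf (fun m : ℤ => α (L m - (if m = 0 then t else 0) • 1) * γ (c (-m))) B)
    {m : ℤ} (hm : 0 ≤ m) :
    (α (L m - (if m = 0 then t else 0) • 1) + γ (ℓ m)) * (B + γ d)
      - (B + γ d) * (α (L m - (if m = 0 then t else 0) • 1) + γ (ℓ m))
      = (((Fintype.card ι : ℂ) / 12 + 2 * w) * ((m : ℂ) ^ 3 - m) - (13 * (m : ℂ) ^ 3 - m) / 6
        + 2 * m * t) • γ (c m) := by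
  have h1 : α (L m) * B - B * α (L m) + (γ (ℓ m) * B - B * γ (ℓ m))
      = (((Fintype.card ι : ℂ) / 12 + 2 * w) * ((m : ℂ) ^ 3 - m) + 2 * m * t) • γ (c m) := by
    have hB' : HasPf (fun k : ℤ => γ (ℓ m) * (α (L (m + k) - (if m + k = 0 then t else 0) • 1)
          * γ (c (-(m + k)))) - α (L (m + k) - (if m + k = 0 then t else 0) • 1)
          * γ (c (-(m + k))) * γ (ℓ m)) (γ (ℓ m) * B - B * γ (ℓ m)) :=
      (hB.comm' _).reindex (Equiv.addLeft m)
    refine ((hB.comm' _).add hB').unique ((hasPf_single (-m) _).congr fun k => ?_)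
    rw [IsTensor.mul_left, hT.left_mul, hT.mul_right, IsTensor.right_mul, ← sub_mul,
      ← mul_sub, ← map_sub, ← map_sub, hG.virasoro_comm_c]
    have e : L m * (L k - (if k = 0 then t else 0) • 1) - (L k - (if k = 0 then t else 0) • 1) * L m
        = L m * L k - L k * L m := by
      simp only [mul_sub, sub_mul, mul_smul_comm, smul_mul_assoc, mul_one, one_mul]
      abel
    rw [e, hM.virasoro_comm hm, neg_add, add_neg_cancel_left, map_smul, map_sub,
      map_add, map_smul, map_smul, map_smul, map_one]
    by_cases hk : k = -m
    · subst hk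
      simp only [add_neg_cancel, if_true, neg_neg, sub_mul, add_mul, smul_mul_assoc, one_mul,
        mul_smul_comm]
      push_cast
      module
    · rw [if_neg (by omega), if_neg (by omega), if_neg hk]
      simp only [sub_mul, add_mul, smul_mul_assoc, one_mul, mul_smul_comm]
      push_cast
      module
  have h2 : γ (ℓ m) * γ d - γ d * γ (ℓ m) = (-(13 * (m : ℂ) ^ 3 - m) / 6) • γ (c m) := by
    rw [← map_mul, ← map_mul, ← map_sub, hG.virasoro_comm_differential hm, map_smul]
  have h3 := hT.comm (L m) d
  simp only [map_sub, map_smul, map_one, mul_sub, sub_mul, mul_add, add_mul, mul_smul_comm,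
    smul_mul_assoc, mul_one, one_mul] at h1 h2 ⊢
  linear_combination (norm := module) h1 + h2 - h3

end Total

/-! ### Diagonalizable operators with natural eigenvalues -/

section NatDiag

variable {V : Type*} [AddCommGroup V] [Module ℂ V] {T x : Module.End ℂ V}

theorem mem_eigenspace_of_comm {s t : ℂ} (hx : T * x - x * T = s • x) {v : V}
    (hv : v ∈ Module.End.eigenspace T t) : x v ∈ Module.End.eigenspace T (t + s) := by
  rw [Module.End.mem_eigenspace_iff] at hv ⊢
  have := LinearMap.congr_fun hx v
  simp only [LinearMap.sub_apply, Module.End.mul_apply, hv, map_smul, LinearMap.smul_apply] at this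
  linear_combination (norm := module) this

/-- Ladder operators of weight in `ℕ` preserve the span of the eigenspaces. On a Fock space
generated from the vacuum, diagonalizability thus follows from the weights of the creation
operators. -/
theorem mem_iSup_eigenspace_of_comm (k : ℕ) (hx : T * x - x * T = (k : ℂ) • x) {v : V}
    (hv : v ∈ ⨆ n : ℕ, Module.End.eigenspace T (n : ℂ)) :
    x v ∈ ⨆ n : ℕ, Module.End.eigenspace T (n : ℂ) := by
  refine Submodule.iSup_induction _ (motive := fun v => x v ∈ ⨆ n : ℕ,
    Module.End.eigenspace T (n : ℂ)) hv (fun n v hv => ?_) (by simp) fun v w hv hw => ?_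
  · refine Submodule.mem_iSup_of_mem (n + k) ?_
    push_cast
    exact mem_eigenspace_of_comm hx hv
  · rw [map_add]
    exact Submodule.add_mem _ hv hw

theorem mem_iSup_eigenspace_of_map_eq_zero {v : V} (hv : T v = 0) :
    v ∈ ⨆ n : ℕ, Module.End.eigenspace T (n : ℂ) := by
  refine Submodule.mem_iSup_of_mem 0 ?_
  rw [Module.End.mem_eigenspace_iff, hv]
  simp

end NatDiag

/-! ### Light-cone modes -/

section LightCone

variable {ι M : Type*} [Fintype ι] [DecidableEq ι] [AddCommGroup M] [Module ℂ M]

/-- The modes in a direction `i + ε j`. -/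
def lightMode (a : ι → ℤ → Module.End ℂ M) (i j : ι) (ε : ℂ) (n : ℤ) : Module.End ℂ M :=
  a i n + ε • a j n

/-- The operator `R` rotates the nonzero modes of the null directions `i ± ε j`. -/
structure IsRotation (η : ι → ℂ) (a : ι → ℤ → Module.End ℂ M) (vac : M) (u i j : ι) (ε : ℂ)
    (R : Module.End ℂ M) : Prop where
  ne : i ≠ j
  ne_left : i ≠ u
  ne_right : j ≠ u
  null : ε * ε = -(η i * η j)
  vac : R vac = 0
  comm_left : ∀ n : ℤ, n ≠ 0 → R * a i n - a i n * R = ε • a j n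
  comm_right : ∀ n : ℤ, n ≠ 0 → R * a j n - a j n * R = ε⁻¹ • a i n
  comm_of_ne : ∀ l, ∀ n : ℤ, l ≠ i → l ≠ j → R * a l n - a l n * R = 0

variable {η : ι → ℂ} {a : ι → ℤ → Module.End ℂ M} {vac : M} {z : ι → ℂ} {u : ι} {q w : ℂ}
  {L : ℤ → Module.End ℂ M} {i j : ι} {ε : ℂ} {R : Module.End ℂ M}

namespace IsRotation

variable (hR : IsRotation η a vac u i j ε R) (hM : IsMatter η a vac z u q w L)

include hR hM

theorem eps_ne_zero : ε ≠ 0 := by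
  intro h0
  have h1 := hR.null
  have h2 := hM.metric i
  have h3 := hM.metric j
  rw [h0] at h1
  have : (η i * η i) * (η j * η j) = 0 := by
    linear_combination (η i * η j) * h1
  rw [h2, h3] at this
  norm_num at this

theorem metric_mul_inv : η j * ε⁻¹ = -(η i * ε) := by
  have h0 := hR.eps_ne_zero hM
  field_simp
  linear_combination (η i) * hR.null - η j * hM.metric i

/-- The condition `ε² = -η_i η_j` makes the direction `i + ε j` null, so its modes have no
contractions among themselves. They pair only with the modes of `i - ε j`. -/
theorem plus_comm_plus (m n : ℤ) : lightMode a i j ε m * lightMode a i j ε n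
    = lightMode a i j ε n * lightMode a i j ε m := by
  have h1 := hM.comm i i m n
  have h2 := hM.comm i j m n
  have h3 := hM.comm j i m n
  have h4 := hM.comm j j m n
  have hj : η j = -(ε * ε) * η i := by
    rw [hR.null]; linear_combination (-η j) * hM.metric i
  simp only [hR.ne, hR.ne.symm, false_and, true_and, if_false] at h1 h2 h3 h4
  have h5 : (if m + n = 0 then ((m : ℂ) * η i) • (1 : Module.End ℂ M) else 0)
      + (ε * ε) • (if m + n = 0 then ((m : ℂ) * η j) • (1 : Module.End ℂ M) else 0) = 0 := by
    split_ifs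
    · rw [smul_smul, ← add_smul]
      have : (m : ℂ) * η i + ε * ε * (m * η j) = 0 := by
        rw [hR.null]; linear_combination (-(m : ℂ) * η i) * hM.metric j
      rw [this, zero_smul]
    · simp
  simp only [lightMode, add_mul, mul_add, smul_mul_assoc, mul_smul_comm, smul_add]
  linear_combination (norm := module) h1 + ε • h2 + ε • h3 + (ε * ε) • h4 + h5

theorem plus_comm_minus (m n : ℤ) :
    lightMode a i j ε m * lightMode a i j (-ε) n - lightMode a i j (-ε) n * lightMode a i j ε m
      = (if m + n = 0 then 2 * (m * η i) else 0) • 1 := by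
  have h1 := hM.comm i i m n
  have h2 := hM.comm i j m n
  have h3 := hM.comm j i m n
  have h4 := hM.comm j j m n
  simp only [hR.ne, hR.ne.symm, false_and, true_and, if_false] at h1 h2 h3 h4
  have h5 : (if m + n = 0 then ((m : ℂ) * η i) • (1 : Module.End ℂ M) else 0)
      + (ε * ε) • (if m + n = 0 then ((m : ℂ) * η j) • (1 : Module.End ℂ M) else 0) = 0 := by
    split_ifs
    · rw [smul_smul, ← add_smul]
      have : (m : ℂ) * η i + ε * ε * (m * η j) = 0 := by
        rw [hR.null]; linear_combination (-(m : ℂ) * η i) * hM.metric j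
      rw [this, zero_smul]
    · simp
  have h6 : (if m + n = 0 then 2 * (m * η i) else 0) • (1 : Module.End ℂ M)
      = (2 : ℂ) • (if m + n = 0 then ((m : ℂ) * η i) • (1 : Module.End ℂ M) else 0) := by
    split_ifs
    · rw [smul_smul]
    · simp
  rw [h6]
  simp only [lightMode, add_mul, mul_add, smul_mul_assoc, mul_smul_comm, smul_add]
  linear_combination (norm := module) h1 - ε • h2 + ε • h3 - (ε * ε) • h4 - h5

theorem virasoro_comm_light (e : ℂ) (m n : ℤ) :
    L m * lightMode a i j e n - lightMode a i j e n * L m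
      = (-(n : ℂ)) • lightMode a i j e (m + n) := by
  have h1 := hM.virasoro_comm_mode m i n
  have h2 := hM.virasoro_comm_mode m j n
  simp only [hR.ne_left, hR.ne_right, false_and, if_false, zero_smul, add_zero] at h1 h2
  simp only [lightMode, add_mul, mul_add, smul_mul_assoc, mul_smul_comm, smul_add]
  linear_combination (norm := module) h1 + e • h2

omit [Fintype ι] [DecidableEq ι] hM in
theorem neg : IsRotation η a vac u i j (-ε) (-R) where
  ne := hR.ne
  ne_left := hR.ne_left
  ne_right := hR.ne_right
  null := by rw [neg_mul_neg, hR.null]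
  vac := by simp [hR.vac]
  comm_left n hn := by
    have := hR.comm_left n hn
    simp only [neg_mul, mul_neg]
    linear_combination (norm := module) -this
  comm_right n hn := by
    have := hR.comm_right n hn
    simp only [neg_mul, mul_neg, inv_neg]
    linear_combination (norm := module) -this
  comm_of_ne l n hi hj := by
    have := hR.comm_of_ne l n hi hj
    simp only [neg_mul, mul_neg]
    linear_combination (norm := module) -this

theorem comm_plus {n : ℤ} (hn : n ≠ 0) :
    R * lightMode a i j ε n - lightMode a i j ε n * R = lightMode a i j ε n := by
  have h1 := hR.comm_left n hn
  have h2 := congrArg (ε • ·) (hR.comm_right n hn)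
  simp only [smul_smul, mul_inv_cancel₀ (hR.eps_ne_zero hM), one_smul, smul_sub] at h2
  simp only [lightMode, add_mul, mul_add, smul_mul_assoc, mul_smul_comm]
  linear_combination (norm := module) h1 + h2

theorem comm_minus {n : ℤ} (hn : n ≠ 0) :
    R * lightMode a i j (-ε) n - lightMode a i j (-ε) n * R = -lightMode a i j (-ε) n := by
  have h1 := hR.comm_left n hn
  have h2 := congrArg (ε • ·) (hR.comm_right n hn)
  simp only [smul_smul, mul_inv_cancel₀ (hR.eps_ne_zero hM), one_smul, smul_sub] at h2
  simp only [lightMode, add_mul, mul_add, smul_mul_assoc, mul_smul_comm]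
  linear_combination (norm := module) h1 - h2

omit hR in
theorem comm_zero (l : ι) : R * a l 0 - a l 0 * R = 0 := by
  rw [hM.zero]
  simp

/-- The metric contraction is invariant under rotations, so contributions of nonzero modes cancel.
The zero modes are scalars and are not rotated; they alone spoil invariance. -/
theorem comm_modeProd_sum (r s : ℤ) (hrs : r ≠ 0 ∨ s ≠ 0) :
    R * (∑ l, η l • modeProd a l r s) - (∑ l, η l • modeProd a l r s) * R
      = (η i * ε) • ((if s = 0 then z i • a j r - z j • a i r else 0)
        + (if r = 0 then z i • a j s - z j • a i s else 0)) := by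
  have key : ∀ l, R * (η l • modeProd a l r s) - (η l • modeProd a l r s) * R
      = η l • (a l r * (R * a l s - a l s * R) + (R * a l r - a l r * R) * a l s) := fun l => by
    have := hM.modeProd_comm l r s R
    simp only [mul_smul_comm, smul_mul_assoc, mul_sub, sub_mul] at this ⊢
    linear_combination (norm := module) (-η l) • this
  have hinv := hR.metric_mul_inv hM
  rw [Finset.mul_sum, Finset.sum_mul, ← Finset.sum_sub_distrib, Fintype.sum_eq_add i j hR.ne
    fun l hl => by rw [key, hR.comm_of_ne l _ hl.1 hl.2, hR.comm_of_ne l _ hl.1 hl.2]; simp]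
  rw [key, key]
  by_cases hs : s = 0
  · subst hs
    have hr : r ≠ 0 := by omega
    rw [comm_zero hM, comm_zero hM, hR.comm_left r hr, hR.comm_right r hr, if_pos rfl,
      if_neg hr, hM.zero, hM.zero]
    have e : η j • z j • ε⁻¹ • a i r = (-(η i * ε) * z j) • a i r := by
      rw [smul_smul, smul_smul, ← hinv]
      congr 1
      ring
    simp only [mul_zero, zero_add, add_zero, mul_smul_comm, mul_one] at e ⊢
    linear_combination (norm := module) e
  · rw [if_neg hs, hR.comm_left s hs, hR.comm_right s hs]
    by_cases hr : r = 0
    · subst hr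
      rw [comm_zero hM, comm_zero hM, if_pos rfl, hM.zero, hM.zero]
      simp only [zero_mul, zero_add, add_zero, smul_mul_assoc, mul_smul_comm, one_mul,
        smul_smul, smul_sub, ← mul_assoc, hinv]
      module
    · rw [if_neg hr, hR.comm_left r hr, hR.comm_right r hr]
      simp only [smul_mul_assoc, mul_smul_comm, smul_add, smul_smul, hinv, add_zero, smul_zero]
      module

/-- Only the summands `k = 0` and `k = -m` contain a zero mode. Thus `L_m` splits into parts of
`R`-weight `0`, `1` and `-1`, the last two being light-cone modes with coefficients linear in the
zero modes. -/
theorem comm_virasoro {m : ℤ} (hm : m ≠ 0) :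
    R * L m - L m * R = (η i / 2) • ((z i + -ε * z j) • lightMode a i j ε m
      - (z i + ε * z j) • lightMode a i j (-ε) m) := by
  obtain ⟨Q, hQ, hL⟩ := hM.virasoro m
  have h1 : R * Q - Q * R = (η i * ε) • (z i • a j m - z j • a i m)
      + (η i * ε) • (z i • a j m - z j • a i m) := by
    refine (hQ.comm' R).unique (((hasPf_single 0 _).add (hasPf_single (-m) _)).congr fun k => ?_)
    rw [hR.comm_modeProd_sum hM _ _ (by omega)]
    by_cases hk : k = 0
    · subst hk
      rw [if_pos (by simp), if_neg (by omega), if_pos rfl, if_neg (by omega)]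
      simp
    · rw [if_neg (by omega), if_neg hk]
      by_cases hk' : k = -m
      · subst hk'
        simp
      · rw [if_neg (by omega), if_neg hk']
        simp
  have h2 := hR.comm_of_ne u m hR.ne_left.symm hR.ne_right.symm
  have h3 : R * L m - L m * R = (1 / 2 : ℂ) • (R * Q - Q * R)
      + (q * m) • (R * a u m - a u m * R) := by
    rw [hL]
    simp only [mul_add, add_mul, mul_smul_comm, smul_mul_assoc, mul_one, one_mul]
    module
  rw [h3, h1, h2]
  simp only [lightMode]
  module

/-- The light-cone weight operator on the matter Fock space. -/
theorem natDiag_weight :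
    NatDiag (L 0 - ((1 / 2) * ∑ i, η i * z i ^ 2 + w) • 1 - R) := by
  set h0 := (1 / 2) * ∑ i, η i * z i ^ 2 + w with hh0
  have hcomm : ∀ (x : Module.End ℂ M) (s t : ℂ), L 0 * x - x * L 0 = s • x →
      R * x - x * R = t • x → (L 0 - h0 • 1 - R) * x - x * (L 0 - h0 • 1 - R) = (s - t) • x := by
    intro x s t hs ht
    simp only [sub_mul, mul_sub, smul_mul_assoc, mul_smul_comm, one_mul, mul_one]
    linear_combination (norm := module) hs - ht
  refine hM.gen _ (mem_iSup_eigenspace_of_map_eq_zero ?_) fun l n hn v hv => ?_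
  · rw [LinearMap.sub_apply, LinearMap.sub_apply, hM.virasoro_vac_zero, hR.vac]
    simp [hh0]
  · obtain ⟨k, rfl⟩ : ∃ k : ℕ, n = -((k : ℤ) + 1) := ⟨(-n - 1).toNat, by omega⟩
    -- A creator of level `k + 1` has weight `k` in the direction `i + ε j`, `k + 2` in the opposite
    -- null direction and `k + 1` in the others. Levels start at `1`, so no weight is negative.
    have hp : lightMode a i j ε (-((k : ℤ) + 1)) v
        ∈ ⨆ n : ℕ, Module.End.eigenspace (L 0 - h0 • 1 - R) (n : ℂ) := by
      refine mem_iSup_eigenspace_of_comm k ?_ hv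
      rw [hcomm _ ((k : ℂ) + 1) 1 (by
        rw [hR.virasoro_comm_light hM, zero_add]; push_cast; module)
        (by rw [hR.comm_plus hM (by omega), one_smul])]
      module
    have hm : lightMode a i j (-ε) (-((k : ℤ) + 1)) v
        ∈ ⨆ n : ℕ, Module.End.eigenspace (L 0 - h0 • 1 - R) (n : ℂ) := by
      refine mem_iSup_eigenspace_of_comm (k + 2) ?_ hv
      rw [hcomm _ ((k : ℂ) + 1) (-1) (by
        rw [hR.virasoro_comm_light hM, zero_add]; push_cast; module)
        (by rw [hR.comm_minus hM (by omega), neg_one_smul])]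
      push_cast
      module
    by_cases hi : l = i
    · subst hi
      have : a l (-((k : ℤ) + 1)) v = (1 / 2 : ℂ) • (lightMode a l j ε (-((k : ℤ) + 1)) v
          + lightMode a l j (-ε) (-((k : ℤ) + 1)) v) := by
        simp only [lightMode, LinearMap.add_apply, LinearMap.smul_apply]
        module
      rw [this]
      exact Submodule.smul_mem _ _ (Submodule.add_mem _ hp hm)
    by_cases hj : l = j
    · subst hj
      have hε := hR.eps_ne_zero hM
      have : a l (-((k : ℤ) + 1)) v = (1 / (2 * ε) : ℂ) • (lightMode a i l ε (-((k : ℤ) + 1)) v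
          - lightMode a i l (-ε) (-((k : ℤ) + 1)) v) := by
        simp only [lightMode, LinearMap.add_apply, LinearMap.smul_apply]
        match_scalars <;> field_simp <;> ring
      rw [this]
      exact Submodule.smul_mem _ _ (Submodule.sub_mem _ hp hm)
    · refine mem_iSup_eigenspace_of_comm (k + 1) ?_ hv
      rw [hcomm _ ((k : ℂ) + 1) 0 (by
        rw [hM.virasoro_comm_mode, zero_add]; simp)
        (by rw [hR.comm_of_ne l _ hi hj, zero_smul])]
      push_cast
      module

/-- The operator weighting the excitations in the direction `i + ε j` by their level. -/
theorem natDiag_count {W : Module.End ℂ M}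
    (hW : HasPf (fun m : ℕ+ => (η i / 2) • (lightMode a i j ε (-m) * lightMode a i j (-ε) m)) W) :
    NatDiag W := by
  have hcomm : ∀ x : Module.End ℂ M, HasPf (fun m : ℕ+ => (η i / 2) •
      (lightMode a i j ε (-m) * (lightMode a i j (-ε) m * x - x * lightMode a i j (-ε) m)
      + (lightMode a i j ε (-m) * x - x * lightMode a i j ε (-m)) * lightMode a i j (-ε) m))
      (W * x - x * W) := fun x => (hW.comm x).congr fun m => by
    simp only [mul_sub, sub_mul, mul_smul_comm, smul_mul_assoc, mul_assoc]
    module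
  have hmm : ∀ m n : ℤ, 0 < m → n < 0 →
      lightMode a i j (-ε) m * lightMode a i j ε n - lightMode a i j ε n * lightMode a i j (-ε) m
      = (if m = -n then 2 * (m * η i) else 0) • 1 := fun m n hm hn => by
    have := hR.plus_comm_minus hM n m
    by_cases h0 : m = -n
    · subst h0
      rw [if_pos (by omega)] at this
      rw [if_pos rfl]
      push_cast
      linear_combination (norm := module) -this
    · rw [if_neg (by omega)] at this
      rw [if_neg h0]
      linear_combination (norm := module) -this
  refine hM.gen _ (mem_iSup_eigenspace_of_map_eq_zero ?_) fun l n hn v hv => ?_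
  · refine hW.apply_eq_zero fun m => ?_
    have hm : (0 : ℤ) < m := by exact_mod_cast m.pos
    simp [lightMode, hM.pos_vac _ _ hm]
  · obtain ⟨k, rfl⟩ : ∃ k : ℕ, n = -((k : ℤ) + 1) := ⟨(-n - 1).toNat, by omega⟩
    have hp : lightMode a i j ε (-((k : ℤ) + 1)) v
        ∈ ⨆ n : ℕ, Module.End.eigenspace W (n : ℂ) := by
      -- The creator contracts only with the annihilator of equal level in the opposite null
      -- direction, with total factor `(η_i / 2) * 2 (k + 1) η_i = k + 1`.
      refine mem_iSup_eigenspace_of_comm (k + 1) ?_ hv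
      refine (hcomm _).unique ((hasPf_single k.succPNat _).congr fun m => ?_)
      rw [hmm m _ (by exact_mod_cast m.pos) (by omega), hR.plus_comm_plus hM (-m), sub_self,
        zero_mul, add_zero, mul_smul_comm, mul_one, smul_smul]
      by_cases hm : m = k.succPNat
      · subst hm
        rw [if_pos (by simp), if_pos rfl]
        simp only [Nat.succPNat_coe, Nat.succ_eq_add_one]
        push_cast
        congr 1
        linear_combination ((k : ℂ) + 1) * hM.metric i
      · rw [if_neg, if_neg hm]
        · simp
        · intro h0
          apply hm
          rw [← PNat.coe_inj, Nat.succPNat_coe]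
          omega
    have hm : lightMode a i j (-ε) (-((k : ℤ) + 1)) v
        ∈ ⨆ n : ℕ, Module.End.eigenspace W (n : ℂ) := by
      refine mem_iSup_eigenspace_of_comm 0 ?_ hv
      rw [Nat.cast_zero, zero_smul]
      refine (hcomm _).eq_zero fun m => ?_
      have hm : (0 : ℤ) < m := by exact_mod_cast m.pos
      have h1 := hR.plus_comm_minus hM (-m) (-((k : ℤ) + 1))
      rw [if_neg (by omega), zero_smul] at h1
      rw [hR.neg.plus_comm_plus hM m, h1]
      simp
    by_cases hi : l = i
    · subst hi
      have : a l (-((k : ℤ) + 1)) v = (1 / 2 : ℂ) • (lightMode a l j ε (-((k : ℤ) + 1)) v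
          + lightMode a l j (-ε) (-((k : ℤ) + 1)) v) := by
        simp only [lightMode, LinearMap.add_apply, LinearMap.smul_apply]
        module
      rw [this]
      exact Submodule.smul_mem _ _ (Submodule.add_mem _ hp hm)
    by_cases hj : l = j
    · subst hj
      have hε := hR.eps_ne_zero hM
      have : a l (-((k : ℤ) + 1)) v = (1 / (2 * ε) : ℂ) • (lightMode a i l ε (-((k : ℤ) + 1)) v
          - lightMode a i l (-ε) (-((k : ℤ) + 1)) v) := by
        simp only [lightMode, LinearMap.add_apply, LinearMap.smul_apply]
        match_scalars <;> field_simp <;> ring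
      rw [this]
      exact Submodule.smul_mem _ _ (Submodule.sub_mem _ hp hm)
    · refine mem_iSup_eigenspace_of_comm 0 ?_ hv
      rw [Nat.cast_zero, zero_smul]
      refine (hcomm _).eq_zero fun m => ?_
      have h1 : ∀ e : ℂ, ∀ r s : ℤ,
          lightMode a i j e r * a l s - a l s * lightMode a i j e r = 0 := fun e r s => by
        have h2 := hM.comm i l r s
        have h3 := hM.comm j l r s
        rw [if_neg (by tauto)] at h2 h3
        simp only [lightMode, add_mul, mul_add, smul_mul_assoc, mul_smul_comm]
        linear_combination (norm := module) h2 + e • h3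
      rw [h1, h1]
      simp

end IsRotation

end LightCone

/-! ### Counting operators and the holomorphic ghost differential -/

section GhostComplex

variable {G : Type*} [AddCommGroup G] [Module ℂ G] {c b : ℤ → Module.End ℂ G} {vac : G}
  {ℓ : ℤ → Module.End ℂ G} {d : Module.End ℂ G}

theorem pnat_pos (m : ℕ+) : (0 : ℤ) < m := by exact_mod_cast m.pos

theorem pnat_eq_iff (m n : ℕ+) : (m : ℤ) = n ↔ m = n := by simp

namespace IsGhost

variable (h : IsGhost c b vac ℓ d)

include h

theorem pair_comm_c (r s n : ℤ) : c r * b s * c n - c n * (c r * b s)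
    = (if s + n = 0 then 1 else 0 : ℂ) • c r := by
  rw [mul_assoc, h.bc' s n, ← mul_assoc, h.cc n r]
  simp only [mul_add, mul_neg, neg_mul, mul_smul_comm, mul_one, mul_assoc]
  module

theorem pair_comm_b (r s n : ℤ) : c r * b s * b n - b n * (c r * b s)
    = -((if n + r = 0 then 1 else 0 : ℂ) • b s) := by
  rw [← mul_assoc, h.bc' n r, mul_assoc, h.bb s n]
  simp only [add_mul, mul_neg, neg_mul, smul_mul_assoc, one_mul, mul_assoc]
  module

theorem pair_comm_c' (r s n : ℤ) : b r * c s * c n - c n * (b r * c s)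
    = -((if r + n = 0 then 1 else 0 : ℂ) • c s) := by
  have h1 := h.bc' r n
  have h2 : c n * (b r * c s) = (c n * b r) * c s := (mul_assoc _ _ _).symm
  rw [mul_assoc, h.cc s n, h2,
    show c n * b r = (if r + n = 0 then 1 else 0 : ℂ) • 1 - b r * c n by rw [h1]; module]
  simp only [sub_mul, mul_neg, smul_mul_assoc, one_mul, mul_assoc]
  module

theorem pair_comm_b' (r s n : ℤ) : b r * c s * b n - b n * (b r * c s)
    = (if n + s = 0 then 1 else 0 : ℂ) • b r := by
  have h1 := h.bc' n s
  rw [mul_assoc, show c s * b n = (if n + s = 0 then 1 else 0 : ℂ) • 1 - b n * c s by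
    rw [h1]; module, ← mul_assoc (b n), h.bb n r]
  simp only [mul_sub, neg_mul, mul_smul_comm, mul_one, mul_assoc]
  module

theorem finite_b : ∀ v, ∃ N : ℕ, ∀ m : ℕ+, N ≤ (m : ℕ) → b m v = 0 := fun v => by
  obtain ⟨N, hN⟩ := h.finite v
  exact ⟨N, fun m hm => (hN m (by exact_mod_cast hm)).2⟩

theorem pointwiseFinite_count (w : ℤ → ℂ) :
    PointwiseFinite fun m : ℕ+ => w m • (c (-(m : ℤ)) * b m) := by
  refine pointwiseFinite_of_eventually fun v => ?_
  obtain ⟨N, hN⟩ := h.finite_b v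
  exact ⟨N, fun m hm => by simp [hN m hm]⟩

/-! ### Weighted counting of the excitations `c_{-m}` -/

section Count

variable {w : ℤ → ℂ} {N : Module.End ℂ G}
  (hN : HasPf (fun m : ℕ+ => w m • (c (-(m : ℤ)) * b m)) N)

include hN

theorem count_comm_c (n : ℤ) : N * c n - c n * N = (if n < 0 then w (-n) else 0) • c n := by
  have h1 := hN.comm (c n)
  have h2 : ∀ m : ℕ+, w m • (c (-(m : ℤ)) * b m) * c n - c n * (w m • (c (-(m : ℤ)) * b m))
      = (w m * (if (m : ℤ) + n = 0 then 1 else 0)) • c (-(m : ℤ)) := fun m => by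
    rw [smul_mul_assoc, mul_smul_comm, ← smul_sub, h.pair_comm_c, smul_smul]
  by_cases hn : n < 0
  · rw [if_pos hn]
    have hk : (((-n).toNat.toPNat (by omega) : ℕ+) : ℤ) = -n := by
      simp [Nat.toPNat]; omega
    refine h1.unique ((hasPf_single ((-n).toNat.toPNat (by omega)) _).congr fun m => ?_)
    rw [h2]
    by_cases hm : (m : ℤ) = -n
    · rw [if_pos ((pnat_eq_iff _ _).mp (hm.trans hk.symm)), if_pos (by omega), hm]
      simp
    · rw [if_neg (show ¬ (m : ℤ) + n = 0 by omega), if_neg fun h0 => hm (by rw [h0, hk])]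
      simp
  · rw [if_neg hn, zero_smul]
    refine h1.eq_zero fun m => ?_
    have := pnat_pos m
    rw [h2, if_neg (by omega)]
    simp

theorem count_comm_b (n : ℤ) : N * b n - b n * N = (if 0 < n then -w n else 0) • b n := by
  have h1 := hN.comm (b n)
  have h2 : ∀ m : ℕ+, w m • (c (-(m : ℤ)) * b m) * b n - b n * (w m • (c (-(m : ℤ)) * b m))
      = (-w m * (if n + -(m : ℤ) = 0 then 1 else 0)) • b m := fun m => by
    rw [smul_mul_assoc, mul_smul_comm, ← smul_sub, h.pair_comm_b]
    module
  by_cases hn : 0 < n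
  · rw [if_pos hn]
    have hk : ((n.toNat.toPNat (by omega) : ℕ+) : ℤ) = n := by
      simp [Nat.toPNat]; omega
    refine h1.unique ((hasPf_single (n.toNat.toPNat (by omega)) _).congr fun m => ?_)
    rw [h2]
    by_cases hm : (m : ℤ) = n
    · rw [if_pos ((pnat_eq_iff _ _).mp (hm.trans hk.symm)), if_pos (by omega), hm]
      simp
    · rw [if_neg (show ¬ n + -(m : ℤ) = 0 by omega), if_neg fun h0 => hm (by rw [h0, hk])]
      simp
  · rw [if_neg hn, zero_smul]
    refine h1.eq_zero fun m => ?_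
    have := pnat_pos m
    rw [h2, if_neg (by omega)]
    simp

theorem natDiag_count (hw : ∀ m : ℕ+, ∃ k : ℕ, w m = k) : NatDiag N := by
  refine h.gen _ (mem_iSup_eigenspace_of_map_eq_zero ?_) (fun n hn v hv => ?_) fun n hn v hv => ?_
  · refine hN.apply_eq_zero fun m => ?_
    simp [h.b_vac m (pnat_pos m).le]
  · have h1 := h.count_comm_c hN n
    rcases hn.lt_or_eq with hn | rfl
    · obtain ⟨k, hk⟩ := hw ((-n).toNat.toPNat (by omega))
      have hm : (((-n).toNat.toPNat (by omega) : ℕ+) : ℤ) = -n := by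
        simp [Nat.toPNat]; omega
      rw [hm] at hk
      rw [if_pos hn, hk] at h1
      exact mem_iSup_eigenspace_of_comm k h1 hv
    · exact mem_iSup_eigenspace_of_comm 0 (by simpa using h1) hv
  · have h1 := h.count_comm_b hN n
    rw [if_neg (by omega)] at h1
    exact mem_iSup_eigenspace_of_comm 0 (by simpa using h1) hv

end Count

section AntiCount

variable {N : Module.End ℂ G} (hN : HasPf (fun m : ℕ+ => b (-(m : ℤ)) * c m) N)

include hN

theorem antiCount_comm_c {n : ℤ} (hn : n < 0) : N * c n - c n * N = 0 :=
  (hN.comm (c n)).eq_zero fun m => by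
    have := pnat_pos m
    rw [h.pair_comm_c', if_neg (by omega), zero_smul, neg_zero]

theorem antiCount_comm_b {n : ℤ} (hn : 0 < n) : N * b n - b n * N = 0 :=
  (hN.comm (b n)).eq_zero fun m => by
    have := pnat_pos m
    rw [h.pair_comm_b', if_neg (by omega), zero_smul]

end AntiCount

/-! ### The operator ∂̄ and its nilpotency -/

section DelBar

variable {E : Module.End ℂ G}
  (hE : HasPf (fun q : ℕ+ × ℕ+ => (-(((q.1 : ℤ) - (q.2 : ℤ) : ℤ) : ℂ) / 2) •
      (c (-(q.1 : ℤ)) * c (-(q.2 : ℤ)) * b ((q.2 : ℤ) + (q.1 : ℤ)))) E)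

include hE

theorem delBar_anticomm_c {n : ℤ} (hn : 0 ≤ n) : c n * E + E * c n = 0 := by
  refine (hE.anticomm (c n)).eq_zero fun q => ?_
  have h1 := pnat_pos q.1
  have h2 := pnat_pos q.2
  have h3 := h.bc' ((q.2 : ℤ) + (q.1 : ℤ)) n
  rw [if_neg (by omega), zero_smul, add_zero] at h3
  rw [mul_smul_comm, smul_mul_assoc, ← smul_add, mul_assoc _ _ (c n), h3]
  rw [← mul_assoc (c n), ← mul_assoc (c n), h.cc n, neg_mul, mul_assoc _ (c n), h.cc n (-(q.2 : ℤ))]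
  simp only [mul_neg, neg_neg, mul_assoc]
  rw [add_neg_cancel, smul_zero]

theorem delBar_anticomm_b {n : ℤ} (hn : n ≤ 0) : b n * E + E * b n = 0 := by
  refine (hE.anticomm (b n)).eq_zero fun q => ?_
  have h1 := pnat_pos q.1
  have h2 := pnat_pos q.2
  have h3 := h.bc' n (-(q.1 : ℤ))
  have h4 := h.bc' n (-(q.2 : ℤ))
  rw [if_neg (by omega), zero_smul, add_zero] at h3 h4
  rw [mul_smul_comm, smul_mul_assoc, ← smul_add, ← mul_assoc, ← mul_assoc, h3, neg_mul,
    mul_assoc _ (b n), h4]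
  simp only [mul_neg, neg_neg, mul_assoc, h.bb _ n]
  rw [add_neg_cancel, smul_zero]

theorem hasPf_delBar_anticomm_c (j : ℕ+) :
    HasPf (fun q : ℕ+ × ℕ+ => (if q.1 + q.2 = j then -(((q.1 : ℤ) - (q.2 : ℤ) : ℤ) : ℂ) / 2
      else 0) • (c (-(q.1 : ℤ)) * c (-(q.2 : ℤ)))) (c (-(j : ℤ)) * E + E * c (-(j : ℤ))) := by
  refine (hE.anticomm (c (-(j : ℤ)))).congr fun q => ?_
  have h3 := h.bc' ((q.2 : ℤ) + (q.1 : ℤ)) (-(j : ℤ))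
  have hq : (q.2 : ℤ) + (q.1 : ℤ) + -(j : ℤ) = 0 ↔ q.1 + q.2 = j := by
    rw [← pnat_eq_iff]; push_cast; omega
  simp only [hq] at h3
  rw [mul_smul_comm, smul_mul_assoc, ← smul_add, mul_assoc _ _ (c _), h3]
  rw [← mul_assoc (c _), ← mul_assoc (c _), h.cc (-(j : ℤ)), neg_mul, mul_assoc _ (c (-(j : ℤ))),
    h.cc (-(j : ℤ)) (-(q.2 : ℤ))]
  simp only [mul_neg, neg_neg, mul_assoc, mul_add, mul_smul_comm, mul_one]
  split_ifs <;> module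

theorem delBar_vac : E vac = 0 := hE.apply_eq_zero fun q => by
  have h1 := pnat_pos q.1
  have h2 := pnat_pos q.2
  simp [h.b_vac ((q.2 : ℤ) + (q.1 : ℤ)) (by omega)]

omit h in
/-- The differential scales under a derivation which is diagonal on the modes. -/
theorem comm_delBar {X : Module.End ℂ G} {s t : ℤ → ℂ} {r : ℂ}
    (hc : ∀ m : ℕ+, X * c (-(m : ℤ)) - c (-(m : ℤ)) * X = s m • c (-(m : ℤ)))
    (hb : ∀ m : ℕ+, X * b m - b m * X = t m • b m)
    (hst : ∀ m n : ℕ+, s m + s n + t (n + m) = r) : X * E - E * X = r • E := by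
  refine (hE.comm' X).unique ((hE.smul r).congr fun q => ?_)
  have h1 := hc q.1
  have h2 := hc q.2
  have h3 := hb (q.2 + q.1)
  push_cast at h3
  have e : X * (c (-(q.1 : ℤ)) * c (-(q.2 : ℤ)) * b ((q.2 : ℤ) + (q.1 : ℤ)))
      - (c (-(q.1 : ℤ)) * c (-(q.2 : ℤ)) * b ((q.2 : ℤ) + (q.1 : ℤ))) * X
      = (X * c (-(q.1 : ℤ)) - c (-(q.1 : ℤ)) * X) * c (-(q.2 : ℤ)) * b ((q.2 : ℤ) + (q.1 : ℤ))
        + c (-(q.1 : ℤ)) * (X * c (-(q.2 : ℤ)) - c (-(q.2 : ℤ)) * X) * b ((q.2 : ℤ) + (q.1 : ℤ))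
        + c (-(q.1 : ℤ)) * c (-(q.2 : ℤ)) *
          (X * b ((q.2 : ℤ) + (q.1 : ℤ)) - b ((q.2 : ℤ) + (q.1 : ℤ)) * X) := by
    simp only [mul_sub, sub_mul, mul_assoc]; abel
  rw [mul_smul_comm, smul_mul_assoc, ← smul_sub, e, h1, h2, h3, ← hst q.1 q.2]
  simp only [smul_mul_assoc, mul_smul_comm]
  module

/-- The Jacobi identity for the holomorphic half of the Virasoro algebra. -/
theorem delBar_comm_anticomm_c (j : ℕ+) :
    E * (c (-(j : ℤ)) * E + E * c (-(j : ℤ))) = (c (-(j : ℤ)) * E + E * c (-(j : ℤ))) * E := by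
  set Q : ℕ+ → Module.End ℂ G := fun j => c (-(j : ℤ)) * E + E * c (-(j : ℤ)) with hQdef
  have hQ : ∀ j, HasPf (fun q : ℕ+ × ℕ+ => (if q.1 + q.2 = j then
      -(((q.1 : ℤ) - (q.2 : ℤ) : ℤ) : ℂ) / 2 else 0) • (c (-(q.1 : ℤ)) * c (-(q.2 : ℤ)))) (Q j) :=
    h.hasPf_delBar_anticomm_c hE
  set k : ℕ+ → ℕ+ → ℂ := fun m n => -(((m : ℤ) - (n : ℤ) : ℤ) : ℂ) / 2 with hk
  set f : ℕ+ × ℕ+ × ℕ+ → Module.End ℂ G := fun t =>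
    c (-(t.1 : ℤ)) * c (-(t.2.1 : ℤ)) * c (-(t.2.2 : ℤ)) with hf
  have hfin : ∀ g : ℕ+ × ℕ+ × ℕ+ → ℂ,
      PointwiseFinite fun t => (if t.1 + t.2.1 + t.2.2 = j then g t else 0) • f t := by
    intro g v
    refine ((Set.finite_Iic j).prod ((Set.finite_Iic j).prod (Set.finite_Iic j))).subset ?_
    rintro ⟨x, y, z⟩ ht
    have : x + y + z = j := by
      by_contra hc
      simp [hc] at ht
    subst this
    simp only [Set.mem_prod, Set.mem_Iic, ← PNat.coe_le_coe, PNat.add_coe]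
    omega
  have h1 := hasPf_pfSum (hfin fun t => k (t.1 + t.2.1) t.2.2 * k t.1 t.2.1)
  have h2 := hasPf_pfSum (hfin fun t => k t.1 (t.2.1 + t.2.2) * k t.2.1 t.2.2)
  set Y1 := pfSum _ (hfin fun t => k (t.1 + t.2.1) t.2.2 * k t.1 t.2.1)
  set Y2 := pfSum _ (hfin fun t => k t.1 (t.2.1 + t.2.2) * k t.2.1 t.2.2)
  -- Inserting the quadratic expansion of `Q` turns this family into a cubic sum over triples with
  -- total `j`. The constraint on the intermediate index leaves one term for each triple.
  have e1 : HasPf (fun q : ℕ+ × ℕ+ => (if q.1 + q.2 = j then k q.1 q.2 else 0) •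
      (Q q.1 * c (-(q.2 : ℤ)))) Y1 := by
    refine HasPf.sum_fst (T := fun r : (ℕ+ × ℕ+) × (ℕ+ × ℕ+) =>
      (if r.2.1 + r.2.2 = j then k r.2.1 r.2.2 else 0) •
      (((if r.1.1 + r.1.2 = r.2.1 then k r.1.1 r.1.2 else 0) •
        (c (-(r.1.1 : ℤ)) * c (-(r.1.2 : ℤ)))) * c (-(r.2.2 : ℤ)))) ?_ fun q =>
      (((hQ q.1).mul_right (c (-(q.2 : ℤ)))).smul (if q.1 + q.2 = j then k q.1 q.2 else 0))
    refine h1.extend (f := fun t => ((t.1, t.2.1), (t.1 + t.2.1, t.2.2))) ?_ ?_ ?_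
    · rintro ⟨x, y, z⟩ ⟨x', y', z'⟩ hxyz
      simp only [Prod.mk.injEq] at hxyz ⊢
      tauto
    · rintro ⟨x, y, z⟩
      simp only [hf, if_true, smul_mul_assoc, smul_smul]
      split_ifs <;> simp
    · rintro ⟨⟨x, y⟩, ⟨p, z⟩⟩ hr
      rw [if_neg (c := x + y = p)]
      · simp
      · rintro rfl
        exact hr ⟨(x, y, z), rfl⟩
  have e2 : HasPf (fun q : ℕ+ × ℕ+ => (if q.1 + q.2 = j then k q.1 q.2 else 0) •
      (c (-(q.1 : ℤ)) * Q q.2)) Y2 := by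
    refine HasPf.sum_fst (T := fun r : (ℕ+ × ℕ+) × (ℕ+ × ℕ+) =>
      (if r.2.1 + r.2.2 = j then k r.2.1 r.2.2 else 0) •
      (c (-(r.2.1 : ℤ)) * ((if r.1.1 + r.1.2 = r.2.2 then k r.1.1 r.1.2 else 0) •
        (c (-(r.1.1 : ℤ)) * c (-(r.1.2 : ℤ)))))) ?_ fun q =>
      (((hQ q.2).mul_left (c (-(q.1 : ℤ)))).smul (if q.1 + q.2 = j then k q.1 q.2 else 0))
    refine h2.extend (f := fun t => ((t.2.1, t.2.2), (t.1, t.2.1 + t.2.2))) ?_ ?_ ?_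
    · rintro ⟨x, y, z⟩ ⟨x', y', z'⟩ hxyz
      simp only [Prod.mk.injEq] at hxyz ⊢
      tauto
    · rintro ⟨x, y, z⟩
      simp only [hf, if_true, mul_smul_comm, smul_smul, mul_assoc, add_assoc]
      split_ifs <;> simp
    · rintro ⟨⟨x, y⟩, ⟨p, z⟩⟩ hr
      rw [if_neg (c := x + y = z)]
      · simp
      · rintro rfl
        exact hr ⟨(p, x, y), rfl⟩
  have e3 : E * Q j - Q j * E = Y1 - Y2 := by
    refine ((hQ j).comm' E).unique ((e1.sub e2).congr fun q => ?_)
    simp only [hQdef, mul_smul_comm, smul_mul_assoc, mul_add, add_mul, mul_assoc, hk]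
    split_ifs
    · push_cast
      module
    · module
  have h3 := h1.sub h2
  have rot : ∀ t, f (t.2.1, t.2.2, t.1) = f t := fun t => by
    simp only [hf]
    rw [mul_assoc, h.cc (-(t.2.2 : ℤ)), mul_neg, ← mul_assoc, h.cc (-(t.2.1 : ℤ)), neg_mul, neg_neg]
  let σ : ℕ+ × ℕ+ × ℕ+ ≃ ℕ+ × ℕ+ × ℕ+ :=
    { toFun := fun t => (t.2.1, t.2.2, t.1)
      invFun := fun t => (t.2.2, t.1, t.2.1)
      left_inv := fun _ => rfl
      right_inv := fun _ => rfl }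
  have h4 := h3.reindex σ
  have h5 := h4.reindex σ
  -- Cubic ghost monomials are invariant under cyclic rotation, and the three rotated coefficients
  -- add up to zero. This is the Jacobi identity for `[L_m, L_n] = (m - n) L_{m+n}`.
  have h6 : (Y1 - Y2) + (Y1 - Y2) + (Y1 - Y2) = 0 := ((h3.add h4).add h5).eq_zero fun t => by
    have r1 : f (σ t) = f t := rot t
    have r2 : f (σ (σ t)) = f t := (rot (σ t)).trans r1
    rw [r1, r2]
    simp only [← sub_smul, ← add_smul]
    have s1 : t.2.1 + t.2.2 + t.1 = t.1 + t.2.1 + t.2.2 := by rw [add_comm, ← add_assoc]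
    have s2 : t.2.2 + t.1 + t.2.1 = t.1 + t.2.1 + t.2.2 := by rw [add_assoc, add_comm]
    simp only [σ, Equiv.coe_fn_mk, s1, s2]
    split_ifs
    · rw [show ∀ z : ℂ, z = 0 → z • f t = 0 from fun z hz => by rw [hz, zero_smul]]
      simp only [hk]
      push_cast
      ring
    · simp
  have h7 : Y1 - Y2 = 0 := by
    have : (3 : ℂ) • (Y1 - Y2) = 0 := by linear_combination (norm := module) h6
    simpa using this
  rw [h7] at e3
  exact sub_eq_zero.mp e3

/-- The square commutes with a mode `x` as soon as `E` commutes with `{x, E}`. This anticommutator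
is zero for `c_0` and for `b_n` with `n < 0`; for `c_{-j}` the Jacobi identity applies. As `E` kills
the vacuum, so does its square, and `IsGhost.ext` concludes. -/
theorem delBar_mul_self : E * E = 0 := by
  have key : ∀ x : Module.End ℂ G, E * (x * E + E * x) = (x * E + E * x) * E →
      E * E * x = (1 : ℂ) • (x * (E * E)) := fun x hx => by
    rw [one_smul]
    simp only [mul_add, add_mul, mul_assoc] at hx ⊢
    linear_combination (norm := module) hx
  refine h.ext _ ?_ 1 (fun n hn => key _ ?_) (fun n hn => key _ ?_)
  · rw [Module.End.mul_apply, h.delBar_vac hE, map_zero]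
  · rcases hn.lt_or_eq with hn | rfl
    · have := h.delBar_comm_anticomm_c hE ((-n).toNat.toPNat (by omega))
      rwa [show (((-n).toNat.toPNat (by omega) : ℕ+) : ℤ) = -n by simp [Nat.toPNat]; omega,
        neg_neg] at this
    · rw [h.delBar_anticomm_c hE le_rfl]
      simp
  · rw [h.delBar_anticomm_b hE hn.le]
    simp

end DelBar

end IsGhost

end GhostComplex

/-! ### Homogeneous operators -/

section Homogeneous

variable {V : Type*} [AddCommGroup V] [Module ℂ V]

/-- The operator `O` commutes with the `c n`, `n ≥ 0`, and with `b₀` up to the sign `σ`, it has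
degree `t` with respect to `C` and degree `0` with respect to `B`. -/
structure Homogeneous (c : ℤ → Module.End ℂ V) (b₀ C B : Module.End ℂ V) (σ t : ℂ)
    (O : Module.End ℂ V) : Prop where
  c : ∀ n : ℤ, 0 ≤ n → c n * O = σ • (O * c n)
  b : b₀ * O = σ • (O * b₀)
  countC : C * O - O * C = t • O
  countB : B * O = O * B

/-- The vectors with `A n • c n v = 0` for `n ≥ 0` and `b₀ v = 0`, of degree `x` with respect to
`C` and degree `y` with respect to `B`. -/
def cochainSpace (A : ℕ → ℂ) (c : ℤ → Module.End ℂ V) (b₀ C B : Module.End ℂ V) (x y : ℂ) :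
    Submodule ℂ V :=
  (⨅ n : ℕ, LinearMap.ker (A n • c n)) ⊓ LinearMap.ker b₀ ⊓ LinearMap.ker (C - x • 1)
    ⊓ LinearMap.ker (B - y • 1)

variable {A : ℕ → ℂ} {c : ℤ → Module.End ℂ V} {b₀ C B : Module.End ℂ V} {σ t σ' t' x y : ℂ}
  {O O' : Module.End ℂ V} {v : V}

theorem mem_cochainSpace : v ∈ cochainSpace A c b₀ C B x y ↔
    (∀ n : ℕ, A n • c n v = 0) ∧ b₀ v = 0 ∧ C v = x • v ∧ B v = y • v := by
  simp [cochainSpace, sub_eq_zero, and_assoc]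

namespace Homogeneous

theorem map_mem (h : Homogeneous c b₀ C B σ t O) (hv : v ∈ cochainSpace A c b₀ C B x y) :
    O v ∈ cochainSpace A c b₀ C B (x + t) y := by
  rw [mem_cochainSpace] at hv ⊢
  obtain ⟨h1, h2, h3, h4⟩ := hv
  refine ⟨fun n => ?_, ?_, ?_, ?_⟩
  · have e := LinearMap.congr_fun (h.c n (by positivity)) v
    simp only [Module.End.mul_apply, LinearMap.smul_apply] at e
    rw [e, smul_comm, ← map_smul, h1, map_zero, smul_zero]
  · have e := LinearMap.congr_fun h.b v
    simp only [Module.End.mul_apply, LinearMap.smul_apply] at e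
    rw [e, h2, map_zero, smul_zero]
  · have e := LinearMap.congr_fun h.countC v
    simp only [Module.End.mul_apply, LinearMap.smul_apply, LinearMap.sub_apply, h3, map_smul] at e
    linear_combination (norm := module) e
  · have e := LinearMap.congr_fun h.countB v
    simp only [Module.End.mul_apply, h4, map_smul] at e
    exact e

theorem mul (h : Homogeneous c b₀ C B σ t O) (h' : Homogeneous c b₀ C B σ' t' O') :
    Homogeneous c b₀ C B (σ * σ') (t + t') (O * O') where
  c n hn := by
    rw [← mul_assoc, h.c n hn, smul_mul_assoc, mul_assoc, h'.c n hn, mul_smul_comm, smul_smul,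
      mul_assoc]
  b := by
    rw [← mul_assoc, h.b, smul_mul_assoc, mul_assoc, h'.b, mul_smul_comm, smul_smul, mul_assoc]
  countC := by
    have e1 := congrArg (· * O') h.countC
    have e2 := congrArg (O * ·) h'.countC
    simp only [sub_mul, mul_sub, smul_mul_assoc, mul_smul_comm, mul_assoc] at e1 e2 ⊢
    linear_combination (norm := module) e1 + e2
  countB := by rw [← mul_assoc, h.countB, mul_assoc, h'.countB, mul_assoc]

theorem add (h : Homogeneous c b₀ C B σ t O) (h' : Homogeneous c b₀ C B σ t O') :
    Homogeneous c b₀ C B σ t (O + O') where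
  c n hn := by rw [mul_add, add_mul, h.c n hn, h'.c n hn, smul_add]
  b := by rw [mul_add, add_mul, h.b, h'.b, smul_add]
  countC := by rw [mul_add, add_mul, smul_add, ← h.countC, ← h'.countC]; abel
  countB := by rw [mul_add, add_mul, h.countB, h'.countB]

theorem smul (h : Homogeneous c b₀ C B σ t O) (r : ℂ) : Homogeneous c b₀ C B σ t (r • O) where
  c n hn := by rw [mul_smul_comm, smul_mul_assoc, h.c n hn, smul_comm]
  b := by rw [mul_smul_comm, smul_mul_assoc, h.b, smul_comm]
  countC := by rw [mul_smul_comm, smul_mul_assoc, ← smul_sub, h.countC, smul_comm]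
  countB := by rw [mul_smul_comm, smul_mul_assoc, h.countB]

theorem sub (h : Homogeneous c b₀ C B σ t O) (h' : Homogeneous c b₀ C B σ t O') :
    Homogeneous c b₀ C B σ t (O - O') := by
  simpa [sub_eq_add_neg] using h.add (h'.smul (-1))

theorem hasPf {ι : Type*} {T : ι → Module.End ℂ V} (hT : HasPf T O)
    (h : ∀ i, Homogeneous c b₀ C B σ t (T i)) : Homogeneous c b₀ C B σ t O where
  c n hn := (hT.mul_left _).unique (((hT.mul_right _).smul σ).congr fun i => (h i).c n hn)
  b := (hT.mul_left _).unique (((hT.mul_right _).smul σ).congr fun i => (h i).b)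
  countC := (hT.comm' _).unique ((hT.smul t).congr fun i => (h i).countC)
  countB := (hT.mul_left _).unique ((hT.mul_right _).congr fun i => (h i).countB)

theorem map {G : Type*} [AddCommGroup G] [Module ℂ G] {c : ℤ → Module.End ℂ G}
    {b₀ C B O : Module.End ℂ G} (γ : Module.End ℂ G →ₐ[ℂ] Module.End ℂ V)
    (h : Homogeneous c b₀ C B σ t O) :
    Homogeneous (fun n => γ (c n)) (γ b₀) (γ C) (γ B) σ t (γ O) where
  c n hn := by rw [← map_mul, h.c n hn, map_smul, map_mul]
  b := by rw [← map_mul, h.b, map_smul, map_mul]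
  countC := by rw [← map_mul, ← map_mul, ← map_sub, h.countC, map_smul]
  countB := by rw [← map_mul, h.countB, map_mul]

end Homogeneous

end Homogeneous

/-! ### Bidegrees of the ghost operators -/

namespace IsGhost

variable {G : Type*} [AddCommGroup G] [Module ℂ G] {c b : ℤ → Module.End ℂ G} {vac : G}
  {ℓ : ℤ → Module.End ℂ G} {d : Module.End ℂ G} (h : IsGhost c b vac ℓ d) {C B : Module.End ℂ G}
  (hC : HasPf (fun m : ℕ+ => c (-(m : ℤ)) * b m) C)
  (hB : HasPf (fun m : ℕ+ => b (-(m : ℤ)) * c m) B)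

include h hC hB

theorem homogeneous_c (m : ℕ+) : Homogeneous c (b 0) C B (-1) 1 (c (-(m : ℤ))) where
  c n _ := by rw [h.cc, neg_one_smul]
  b := by
    have := pnat_pos m
    rw [h.bc', if_neg (by omega)]
    module
  countC := by
    have := pnat_pos m
    rw [h.count_comm_c (w := fun _ => 1) (hC.congr fun m => one_smul _ _), if_pos (by omega)]
  countB := by
    have := pnat_pos m
    exact sub_eq_zero.mp (h.antiCount_comm_c hB (by omega))

theorem homogeneous_b (m : ℕ+) : Homogeneous c (b 0) C B (-1) (-1) (b m) where
  c n hn := by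
    have := pnat_pos m
    rw [h.bc' m n, if_neg (by omega)]
    module
  b := by rw [h.bb, neg_one_smul]
  countC := by
    have := pnat_pos m
    rw [h.count_comm_b (w := fun _ => 1) (hC.congr fun m => one_smul _ _), if_pos (by omega)]
  countB := by
    have := pnat_pos m
    exact sub_eq_zero.mp (h.antiCount_comm_b hB (by omega))

theorem homogeneous_count {w : ℤ → ℂ} {N : Module.End ℂ G}
    (hN : HasPf (fun m : ℕ+ => w m • (c (-(m : ℤ)) * b m)) N) :
    Homogeneous c (b 0) C B 1 0 N :=
  .hasPf hN fun m => by
    simpa using ((h.homogeneous_c hC hB m).mul (h.homogeneous_b hC hB m)).smul (w m)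

theorem homogeneous_delBar {E : Module.End ℂ G}
    (hE : HasPf (fun q : ℕ+ × ℕ+ => (-(((q.1 : ℤ) - (q.2 : ℤ) : ℤ) : ℂ) / 2) •
      (c (-(q.1 : ℤ)) * c (-(q.2 : ℤ)) * b ((q.2 : ℤ) + (q.1 : ℤ)))) E) :
    Homogeneous c (b 0) C B (-1) 1 E :=
  .hasPf hE fun q => by
    have h1 := h.homogeneous_b hC hB (q.2 + q.1)
    rw [PNat.add_coe, Nat.cast_add] at h1
    simpa using (((h.homogeneous_c hC hB q.1).mul (h.homogeneous_c hC hB q.2)).mul h1).smul _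

omit hB in
theorem virasoro_zero_comm_countC : ℓ 0 * C = C * ℓ 0 :=
  (hC.mul_left _).unique ((hC.mul_right _).congr fun m => by
    have h1 := congrArg (· * b m) (h.virasoro_comm_c 0 (-m))
    have h2 := congrArg (c (-m) * ·) (h.virasoro_comm_b 0 m)
    simp only [zero_add, mul_zero, sub_mul, mul_sub, smul_mul_assoc, mul_smul_comm, mul_assoc,
      zero_sub] at h1 h2 ⊢
    push_cast at h1 h2
    linear_combination (norm := module) h1 + h2)

omit hC in
theorem virasoro_zero_comm_countB : ℓ 0 * B = B * ℓ 0 :=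
  (hB.mul_left _).unique ((hB.mul_right _).congr fun m => by
    have h1 := congrArg (· * c m) (h.virasoro_comm_b 0 (-m))
    have h2 := congrArg (b (-m) * ·) (h.virasoro_comm_c 0 m)
    simp only [zero_add, mul_zero, sub_mul, mul_sub, smul_mul_assoc, mul_smul_comm, mul_assoc,
      zero_sub, neg_neg] at h1 h2 ⊢
    push_cast at h1 h2
    linear_combination (norm := module) h1 + h2)

end IsGhost

/-! ### The square of the polarized differential -/

section Square

variable {M G V : Type*} [AddCommGroup M] [Module ℂ M] [AddCommGroup G] [Module ℂ G]
  [AddCommGroup V] [Module ℂ V] {α : Module.End ℂ M →ₐ[ℂ] Module.End ℂ V}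
  {γ : Module.End ℂ G →ₐ[ℂ] Module.End ℂ V}
  {ι : Type*} [Fintype ι] [DecidableEq ι] {η : ι → ℂ} {a : ι → ℤ → Module.End ℂ M}
  {vac : M} {z : ι → ℂ} {u : ι} {q w : ℂ} {L : ℤ → Module.End ℂ M}
  {c b : ℤ → Module.End ℂ G} {vac' : G} {ℓ : ℤ → Module.End ℂ G} {d : Module.End ℂ G}

/-- Anticommuting ghosts turn `Λ²` into one half of the sum of `[L_m, L_n] c_{-m} c_{-n}`. Since `m
+ n > 0` no central term occurs, and the result cancels `{γ E, Λ}`. The last term vanishes with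
`E²`. -/
theorem polarizedDifferential_sq (hT : IsTensor α γ) (hM : IsMatter η a vac z u q w L)
    (hG : IsGhost c b vac' ℓ d) {Λ : Module.End ℂ V} {E : Module.End ℂ G}
    (hΛ : HasPf (fun m : ℕ+ => α (L m) * γ (c (-(m : ℤ)))) Λ)
    (hE : HasPf (fun q : ℕ+ × ℕ+ => (-(((q.1 : ℤ) - (q.2 : ℤ) : ℤ) : ℂ) / 2) •
      (c (-(q.1 : ℤ)) * c (-(q.2 : ℤ)) * b ((q.2 : ℤ) + (q.1 : ℤ)))) E) :
    (Λ + γ E) * (Λ + γ E) = 0 := by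
  have h1 : HasPf (fun q : ℕ+ × ℕ+ => (-(((q.1 : ℤ) - (q.2 : ℤ) : ℤ) : ℂ) / 2) •
      (α (L ((q.1 : ℤ) + (q.2 : ℤ))) * γ (c (-(q.1 : ℤ)) * c (-(q.2 : ℤ))))) (-(Λ * Λ)) := by
    have e : -(Λ * Λ) = (-(1 / 2) : ℂ) • (Λ * Λ + Λ * Λ) := by module
    rw [e]
    refine (((hΛ.mul hΛ).add ((hΛ.mul hΛ).reindex (Equiv.prodComm _ _))).smul _).congr fun q => ?_
    have := pnat_pos q.1
    have := pnat_pos q.2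
    have h2 := hM.virasoro_comm (show (0 : ℤ) ≤ q.1 by omega) q.2
    rw [if_neg (by omega), zero_smul, add_zero] at h2
    simp only [Equiv.prodComm_apply, Prod.fst_swap, Prod.snd_swap]
    rw [hT.mul_mul, hT.mul_mul, hG.cc (-(q.2 : ℤ)), map_neg, mul_neg, ← sub_eq_add_neg, ← sub_mul,
      ← map_sub, h2, map_smul, smul_mul_assoc, smul_smul]
    congr 1
    ring
  have h3 : γ E * Λ + Λ * γ E = -(Λ * Λ) := by
    have hS : HasPf (fun r : (ℕ+ × ℕ+) × ℕ+ => (if r.1.1 + r.1.2 = r.2 then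
        -(((r.1.1 : ℤ) - (r.1.2 : ℤ) : ℤ) : ℂ) / 2 else 0) •
        (α (L r.2) * γ (c (-(r.1.1 : ℤ)) * c (-(r.1.2 : ℤ))))) (-(Λ * Λ)) := by
      refine h1.extend (f := fun q => (q, q.1 + q.2)) (fun q q' hq => (Prod.ext_iff.mp hq).1)
        (fun q => ?_) fun r hr => ?_
      · rw [if_pos rfl, PNat.add_coe, Nat.cast_add]
      · rw [if_neg fun h0 => hr ⟨r.1, Prod.ext rfl h0⟩, zero_smul]
    refine (hΛ.anticomm (γ E)).unique ((hS.sum_fst (S := fun j : ℕ+ => α (L j) *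
      γ (c (-(j : ℤ)) * E + E * c (-(j : ℤ)))) fun j => ?_).congr fun j => ?_)
    · refine ((hT.right (hG.hasPf_delBar_anticomm_c hE j)).mul_left (α (L j))).congr fun q => ?_
      rw [map_smul, mul_smul_comm]
    · rw [hT.mul_right, IsTensor.right_mul, ← mul_add, ← map_add, add_comm]
  have h4 : γ E * γ E = 0 := by rw [← map_mul, hG.delBar_mul_self hE, map_zero]
  simp only [mul_add, add_mul]
  linear_combination (norm := module) h3 + h4

end Square

/-! ### Perturbations of diagonalizable operators -/

section Perturbation

variable {V : Type*} [AddCommGroup V] [Module ℂ V]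

namespace NatDiag

variable {S : Module.End ℂ V} (hS : NatDiag S)

include hS

theorem eigenspace_eq_bot {s : ℂ} (hs : ∀ n : ℕ, s ≠ n) : Module.End.eigenspace S s = ⊥ := by
  have h1 := (Module.End.eigenspaces_iSupIndep S) s
  refine disjoint_self.mp (h1.mono_right ?_)
  refine le_trans (le_top.trans_eq hS.symm) (iSup_le fun n => ?_)
  exact le_iSup₂_of_le (n : ℂ) (hs n).symm le_rfl

theorem eq_zero_of_map_eq {s : ℂ} (hs : ∀ n : ℕ, s ≠ n) {v : V} (hv : S v = s • v) : v = 0 := by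
  have := Module.End.mem_eigenspace_iff.mpr hv
  rwa [hS.eigenspace_eq_bot hs, Submodule.mem_bot] at this

/-- Diagonalizability provides, for each vector, a polynomial `p` with `p(0) ≠ 0` such that `S p(S)`
kills it. Injectivity on `P` removes the factor `S`, and `p(S) v = 0` expresses `v` as `S` of a
polynomial in `S` applied to `v`. Only stability of `P` enters, no finiteness of dimension. -/
theorem exists_map_eq {P : Submodule ℂ V} (hP : ∀ v ∈ P, S v ∈ P)
    (hinj : ∀ v ∈ P, S v = 0 → v = 0) {v : V} (hv : v ∈ P) : ∃ u ∈ P, S u = v := by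
  have hpol : ∀ v, ∃ p : Polynomial ℂ, p.coeff 0 ≠ 0 ∧ S (Polynomial.aeval S p v) = 0 := fun v => by
    have h1 : v ∈ ⨆ n : ℕ, Module.End.eigenspace S (n : ℂ) := by
      rw [show (⨆ n : ℕ, Module.End.eigenspace S (n : ℂ)) = ⊤ from hS]; trivial
    refine Submodule.iSup_induction _ (motive := fun v => ∃ p : Polynomial ℂ, p.coeff 0 ≠ 0 ∧
      S (Polynomial.aeval S p v) = 0) h1 (fun n v hv => ?_) ⟨1, by simp, by simp⟩ fun v w => ?_
    · have h2 := Module.End.mem_eigenspace_iff.mp hv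
      by_cases hn : (n : ℂ) = 0
      · exact ⟨1, by simp, by simp [h2, hn]⟩
      · exact ⟨Polynomial.X - Polynomial.C (n : ℂ), by simpa using hn, by
          rw [map_sub, Polynomial.aeval_X, Polynomial.aeval_C, LinearMap.sub_apply,
            Module.algebraMap_end_apply, h2, sub_self, map_zero]⟩
    · rintro ⟨p, hp, hv⟩ ⟨p', hp', hw⟩
      have hcomm : ∀ (r : Polynomial ℂ) x, S (Polynomial.aeval S r x)
          = Polynomial.aeval S r (S x) := fun r x => by
        have := congrArg (Polynomial.aeval S) (Polynomial.X_mul (p := r))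
        rw [map_mul, map_mul, Polynomial.aeval_X] at this
        exact LinearMap.congr_fun this x
      refine ⟨p * p', by simpa [Polynomial.mul_coeff_zero] using ⟨hp, hp'⟩, ?_⟩
      have h1 : S (Polynomial.aeval S (p * p') v) = 0 := by
        rw [mul_comm, map_mul, Module.End.mul_apply, hcomm, hv, map_zero]
      have h2 : S (Polynomial.aeval S (p * p') w) = 0 := by
        rw [map_mul, Module.End.mul_apply, hcomm, hw, map_zero]
      rw [map_add, map_add, h1, h2, add_zero]
  have hPp : ∀ (r : Polynomial ℂ), ∀ v ∈ P, Polynomial.aeval S r v ∈ P := fun r => by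
    induction r using Polynomial.induction_on' with
    | add p q hp hq =>
      intro v hv
      rw [map_add]
      exact P.add_mem (hp v hv) (hq v hv)
    | monomial n s =>
      intro v hv
      rw [Polynomial.aeval_monomial, Module.End.mul_apply, Module.algebraMap_end_apply]
      refine P.smul_mem _ ?_
      induction n with
      | zero => exact hv
      | succ n ih => rw [pow_succ', Module.End.mul_apply]; exact hP _ ih
  obtain ⟨p, hp, h0⟩ := hpol v
  have h1 := hinj _ (hPp p v hv) h0
  rw [← Polynomial.divX_mul_X_add p, mul_comm, map_add, map_mul, Polynomial.aeval_X,
    Polynomial.aeval_C, LinearMap.add_apply, Module.End.mul_apply,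
    Module.algebraMap_end_apply] at h1
  refine ⟨-((p.coeff 0)⁻¹ • Polynomial.aeval S p.divX v), P.neg_mem (P.smul_mem _ (hPp _ v hv)), ?_⟩
  rw [map_neg, map_smul, eq_neg_of_add_eq_zero_left h1, smul_neg, neg_neg, smul_smul,
    inv_mul_cancel₀ hp, one_smul]

/-- An operator lowering the eigenvalues of `S` lowers the filtration by the eigenvalues. -/
theorem map_mem_iSup_eigenspace {R : Module.End ℂ V} {r : ℕ} (hr : 1 ≤ r)
    (hR : S * R - R * S = (-(r : ℂ)) • R) {j : ℕ} {v : V}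
    (hv : v ∈ ⨆ g ∈ Set.Iio (j + 1), Module.End.eigenspace S ((g : ℕ) : ℂ)) :
    R v ∈ ⨆ g ∈ Set.Iio j, Module.End.eigenspace S ((g : ℕ) : ℂ) := by
  refine (iSup₂_le (a := Submodule.comap R (⨆ g ∈ Set.Iio j, Module.End.eigenspace S ((g : ℕ) : ℂ)))
    fun g hg v hv => ?_ :) hv
  rw [Submodule.mem_comap]
  have h1 := mem_eigenspace_of_comm hR hv
  by_cases hgr : r ≤ g
  · refine Submodule.mem_iSup_of_mem (g - r) (Submodule.mem_iSup_of_mem ?_ ?_)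
    · simp at hg ⊢; omega
    · push_cast [hgr]
      rwa [← sub_eq_add_neg] at h1
  -- For `r > g` the new eigenvalue `g - r` is negative, so its eigenspace is zero.
  · rw [hS.eigenspace_eq_bot fun n hn => hgr ?_, Submodule.mem_bot] at h1
    · rw [h1]
      exact zero_mem _
    · have : (g : ℂ) = ((n + r : ℕ) : ℂ) := by push_cast; linear_combination hn
      have := Nat.cast_injective this
      omega

end NatDiag

variable {G W T R R' : Module.End ℂ V} {κ : ℂ} (hG : NatDiag G) (hW : NatDiag W)
  (hGW : G * W = W * G) (hκ : κ ≠ 0) (hT : T = κ • W + R + R') (hR : G * R - R * G = -R)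
  (hR' : G * R' - R' * G = (-2 : ℂ) • R') {Y : Submodule ℂ V}
  (hYW : ∀ v ∈ Y, W v ∈ Y) (hYR : ∀ v ∈ Y, R v ∈ Y) (hYR' : ∀ v ∈ Y, R' v ∈ Y)
  (hinj : ∀ v ∈ Y, W v = 0 → v = 0)

include hG hW hGW hκ hT hR hR' hYW hYR hYR' hinj

/-- A perturbation of `κ W` by operators lowering the eigenvalues of `G` is bijective on a stable
subspace on which `W` is injective. -/
theorem bijective_of_perturbation :
    (∀ v ∈ Y, T v = 0 → v = 0) ∧ ∀ v ∈ Y, ∃ u ∈ Y, T u = v := by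
  -- The filtration is by `G`-eigenvalues less than `j`, so `F 0 = 0`. The leading term is bijective
  -- on each `Y ⊓ F j`, while `R + R'` maps `Y ⊓ F (j + 1)` into `Y ⊓ F j`. The subspace `Y` itself
  -- need not be stable under `G`.
  set F : ℕ → Submodule ℂ V := fun j => ⨆ g ∈ Set.Iio j, Module.End.eigenspace G ((g : ℕ) : ℂ)
    with hF
  have hF0 : F 0 = ⊥ := by simp [hF]
  have hFW : ∀ j, ∀ v ∈ F j, W v ∈ F j := fun j v hv => by
    refine (iSup₂_le (a := Submodule.comap W (F j)) fun g hg v hv => ?_ :) hv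
    have h1 := mem_eigenspace_of_comm (s := 0) (x := W) (by rw [hGW, sub_self, zero_smul]) hv
    rw [add_zero] at h1
    exact Submodule.mem_iSup_of_mem g (Submodule.mem_iSup_of_mem hg h1)
  have hFR : ∀ j, ∀ v ∈ Y ⊓ F (j + 1), R v + R' v ∈ Y ⊓ F j := fun j v hv =>
    ⟨Y.add_mem (hYR v hv.1) (hYR' v hv.1), (F j).add_mem
      (hG.map_mem_iSup_eigenspace (r := 1) le_rfl (by rw [hR]; simp) hv.2)
      (hG.map_mem_iSup_eigenspace (r := 2) one_le_two (by rw [hR']; simp) hv.2)⟩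
  have hFsurj : ∀ j, ∀ v ∈ Y ⊓ F j, ∃ u ∈ Y ⊓ F j, κ • W u = v := fun j v hv => by
    obtain ⟨u, hu, rfl⟩ := hW.exists_map_eq (P := Y ⊓ F j) (fun v hv => ⟨hYW v hv.1, hFW j v hv.2⟩)
      (fun v hv => hinj v hv.1) hv
    exact ⟨κ⁻¹ • u, (Y ⊓ F j).smul_mem _ hu, by
      rw [map_smul, smul_smul, mul_inv_cancel₀ hκ, one_smul]⟩
  have hTv : ∀ v, T v = κ • W v + (R v + R' v) := fun v => by
    rw [hT]; simp [add_assoc]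
  have hmem : ∀ v ∈ Y, ∃ j, v ∈ Y ⊓ F j := fun v hv => by
    suffices h : ∃ j, v ∈ F j from h.imp fun j hj => ⟨hv, hj⟩
    have h1 : v ∈ ⨆ n : ℕ, Module.End.eigenspace G (n : ℂ) := by
      rw [show (⨆ n : ℕ, Module.End.eigenspace G (n : ℂ)) = ⊤ from hG]; trivial
    have hmono : Monotone F := fun i j hij =>
      biSup_mono fun g hg => lt_of_lt_of_le hg hij
    have h2 : v ∈ ⨆ j, F j := (iSup_le fun n => le_trans
      (le_iSup₂_of_le (f := fun g (_ : g ∈ Set.Iio (n + 1)) =>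
        Module.End.eigenspace G ((g : ℕ) : ℂ)) n (Set.mem_Iio.mpr n.lt_succ_self) le_rfl)
      (le_iSup F (n + 1)) : _ ≤ ⨆ j, F j) h1
    exact (Submodule.mem_iSup_of_directed _ hmono.directed_le).mp h2
  constructor
  · intro v hv h0
    obtain ⟨j, hj⟩ := hmem v hv
    induction j with
    | zero => simpa [hF0] using hj.2
    | succ j ih =>
      refine ih ?_
      -- A kernel vector satisfies `κ W v = -(R + R') v`. The right side lies one step lower and
      -- equals `κ W u` with `u` there as well; injectivity of `W` gives `v = u`.
      obtain ⟨u, hu, hu'⟩ := hFsurj j _ (neg_mem (hFR j v hj))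
      have h1 : W (v - u) = 0 := by
        have h2 : κ • W (v - u) = 0 := by
          rw [map_sub, smul_sub, hu', sub_neg_eq_add, ← hTv, h0]
        exact (smul_eq_zero.mp h2).resolve_left hκ
      rwa [sub_eq_zero.mp (hinj _ (Y.sub_mem hv hu.1) h1)]
  · intro v hv
    obtain ⟨j, hj⟩ := hmem v hv
    induction j generalizing v with
    | zero => exact ⟨0, Y.zero_mem, by rw [map_zero]; simpa [hF0, eq_comm] using hj.2⟩
    | succ j ih =>
      -- The vector `u` solves the leading equation. Its error `(R + R') u` lies one step lower and
      -- is removed by induction.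
      obtain ⟨u, hu, rfl⟩ := hFsurj _ _ hj
      have h1 := hFR j u hu
      obtain ⟨u', hu', he⟩ := ih _ h1.1 h1
      exact ⟨u - u', Y.sub_mem hu.1 hu', by rw [map_sub, he, hTv]; abel⟩

end Perturbation

/-! ### The light-cone homotopy -/

section Homotopy

variable {M G V : Type*} [AddCommGroup M] [Module ℂ M] [AddCommGroup G] [Module ℂ G]
  [AddCommGroup V] [Module ℂ V] {α : Module.End ℂ M →ₐ[ℂ] Module.End ℂ V}
  {γ : Module.End ℂ G →ₐ[ℂ] Module.End ℂ V}
  {ι : Type*} [Fintype ι] [DecidableEq ι] {η : ι → ℂ} {a : ι → ℤ → Module.End ℂ M}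
  {vac : M} {z : ι → ℂ} {u : ι} {q w : ℂ} {L : ℤ → Module.End ℂ M}
  {c b : ℤ → Module.End ℂ G} {vac' : G} {ℓ : ℤ → Module.End ℂ G} {d : Module.End ℂ G}
  {i j : ι} {ε : ℂ} {R : Module.End ℂ M}

theorem IsTensor.comm_mul (hT : IsTensor α γ) {X x x' : Module.End ℂ M} {Y y : Module.End ℂ G}
    {t : ℂ} (hx : X * x - x * X = x') (hy : Y * y - y * Y = t • y) :
    (α X + γ Y) * (α x * γ y) - (α x * γ y) * (α X + γ Y) = α (x' + t • x) * γ y := by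
  rw [add_mul, mul_add, IsTensor.mul_left, hT.left_mul, hT.mul_right, IsTensor.right_mul,
    add_sub_add_comm, ← sub_mul, ← mul_sub, ← map_sub, ← map_sub, hx, hy, map_smul, map_add,
    map_smul, add_mul, smul_mul_assoc, mul_smul_comm]

theorem comm_comm_add_comm {X x y : Module.End ℂ V} {s t : ℂ} (hx : X * x - x * X = s • x)
    (hy : X * y - y * X = t • y) :
    X * (x * y + y * x) - (x * y + y * x) * X = (s + t) • (x * y + y * x) := by
  have h1 := congrArg (· * y) hx
  have h2 := congrArg (y * ·) hx
  have h3 := congrArg (x * ·) hy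
  have h4 := congrArg (· * x) hy
  simp only [sub_mul, mul_sub, smul_mul_assoc, mul_smul_comm, mul_assoc, mul_add, add_mul]
    at h1 h2 h3 h4 ⊢
  linear_combination (norm := module) h1 + h2 + h3 + h4

/-- The anticommutator of the leading part of the differential with the homotopy. -/
theorem lightMode_anticomm (hT : IsTensor α γ) (hM : IsMatter η a vac z u q w L)
    (hG : IsGhost c b vac' ℓ d) (hR : IsRotation η a vac u i j ε R) {Δ K : Module.End ℂ V}
    (hΔ : HasPf (fun m : ℕ+ => α (lightMode a i j (-ε) m) * γ (c (-(m : ℤ)))) Δ)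
    (hK : HasPf (fun n : ℕ+ => α (lightMode a i j ε (-n)) * γ (b n)) K)
    {W : Module.End ℂ M} {N : Module.End ℂ G}
    (hW : HasPf (fun m : ℕ+ => (η i / 2) • (lightMode a i j ε (-m) * lightMode a i j (-ε) m)) W)
    (hN : HasPf (fun m : ℕ+ => (m : ℂ) • (c (-(m : ℤ)) * b m)) N) :
    (η i / 2) • (Δ * K + K * Δ) = α W + γ N := by
  -- Off-diagonal pairs cancel, as the matter modes commute and the ghost modes anticommute. On the
  -- diagonal the ghost contraction yields the matter count, and the matter contraction yields the
  -- ghost count weighted by `m`.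
  refine ((((hΔ.mul hK).add ((hK.mul hΔ).reindex (Equiv.prodComm _ _))).smul (η i / 2)).unique
    (((hT.left hW).add (hT.right hN)).extend (f := fun m : ℕ+ => (m, m))
      (fun m n hmn => (Prod.ext_iff.mp hmn).1) (fun m => ?_) fun k hk => ?_))
  all_goals simp only [Equiv.prodComm_apply, Prod.fst_swap, Prod.snd_swap]
  · have h1 := hR.plus_comm_minus hM (-m) m
    have h2 := hG.bc' m (-m)
    rw [if_pos (by omega)] at h1 h2
    have h3 := congrArg (fun x => α x * γ (c (-m) * b m)) h1
    have h4 := congrArg (fun t => ((m : ℂ) * t) • γ (c (-m) * b m)) (hM.metric i)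
    rw [hT.mul_mul, hT.mul_mul, h2]
    push_cast at h3
    simp only [map_sub, map_smul, map_add, map_neg, map_one, sub_mul, mul_add, mul_neg,
      smul_mul_assoc, mul_smul_comm, mul_one, one_mul] at h3 h4 ⊢
    linear_combination (norm := module) (-(η i / 2)) • h3 + h4
  · have hne : k.1 ≠ k.2 := fun h0 => hk ⟨k.1, Prod.ext rfl h0⟩
    have hne' : (k.1 : ℤ) ≠ k.2 := fun h0 => hne ((pnat_eq_iff _ _).mp h0)
    have h1 := hR.plus_comm_minus hM (-k.2) k.1
    have h2 := hG.bc' k.2 (-k.1)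
    rw [if_neg (by omega), zero_smul] at h1 h2
    rw [hT.mul_mul, hT.mul_mul, h2, sub_eq_zero.mp h1, add_zero, map_neg, mul_neg, add_neg_cancel,
      smul_zero]

/-! ### Degrees with respect to the light-cone grading -/

section

variable (hT : IsTensor α γ) (hM : IsMatter η a vac z u q w L)
  (hG : IsGhost c b vac' ℓ d) (hR : IsRotation η a vac u i j ε R) {N : Module.End ℂ G}
  (hN : HasPf (fun m : ℕ+ => (((m : ℤ) : ℂ) - 1) • (c (-(m : ℤ)) * b m)) N) (h : ℂ)

include hT hM hG hR hN

/-- The matter mode lowers `L_0` by `m` and `c_{-m}` raises `N` by `m - 1`. The weight `m - 1` is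
chosen so that the total degree `-1 - r` does not depend on `m`. -/
theorem grading_comm_lightMode (e r : ℂ)
    (hr : ∀ n : ℤ, n ≠ 0 → R * lightMode a i j e n - lightMode a i j e n * R
      = r • lightMode a i j e n) {Δ : Module.End ℂ V}
    (hΔ : HasPf (fun m : ℕ+ => α (lightMode a i j e m) * γ (c (-(m : ℤ)))) Δ) :
    (α (L 0 - h • 1 - R) + γ N) * Δ - Δ * (α (L 0 - h • 1 - R) + γ N) = (-1 - r) • Δ := by
  refine (hΔ.comm' _).unique ((hΔ.smul (-1 - r)).congr fun m => ?_)
  have hm := pnat_pos m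
  have h1 := hG.count_comm_c (w := fun m => (m : ℂ) - 1) hN (-m)
  rw [if_pos (by omega), neg_neg] at h1
  have h2 := hR.virasoro_comm_light hM e 0 m
  have h3 := hr m hm.ne'
  rw [zero_add] at h2
  have h4 : (L 0 - h • 1 - R) * lightMode a i j e m - lightMode a i j e m * (L 0 - h • 1 - R)
      = (-(m : ℂ) - r) • lightMode a i j e m := by
    push_cast at h2
    simp only [sub_mul, mul_sub, smul_mul_assoc, mul_smul_comm, one_mul, mul_one]
    linear_combination (norm := module) h2 - h3
  rw [hT.comm_mul h4 h1, ← smul_mul_assoc, ← map_smul]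
  congr 2
  push_cast
  module

/-- The creator raises `L_0 - R` by `n - 1`, and `b_n` lowers `N` by the same amount. -/
theorem grading_comm_homotopy {K : Module.End ℂ V}
    (hK : HasPf (fun n : ℕ+ => α (lightMode a i j ε (-n)) * γ (b n)) K) :
    (α (L 0 - h • 1 - R) + γ N) * K - K * (α (L 0 - h • 1 - R) + γ N) = 0 := by
  refine (hK.comm' _).eq_zero fun n => ?_
  have hn := pnat_pos n
  have h1 := hG.count_comm_b (w := fun m => (m : ℂ) - 1) hN n
  rw [if_pos hn] at h1
  have h2 := hR.virasoro_comm_light hM ε 0 (-n)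
  have h3 := hR.comm_plus hM (n := -n) (by omega)
  rw [zero_add] at h2
  have h4 : (L 0 - h • 1 - R) * lightMode a i j ε (-n) - lightMode a i j ε (-n) * (L 0 - h • 1 - R)
      = ((n : ℂ) - 1) • lightMode a i j ε (-n) := by
    push_cast at h2
    simp only [sub_mul, mul_sub, smul_mul_assoc, mul_smul_comm, one_mul, mul_one]
    linear_combination (norm := module) h2 - h3
  rw [hT.comm_mul h4 h1]
  convert zero_mul _
  convert map_zero α
  push_cast
  module

/-- Combined with `comm_virasoro`, this says that `Λ` has a part of degree `-1` and, from the zero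
modes, multiples of `Δ` in degree `0` and of `Δ'` in degree `-2`. -/
theorem grading_comm_virasoro {Λ Δ Δ' : Module.End ℂ V}
    (hΛ : HasPf (fun m : ℕ+ => α (L m) * γ (c (-(m : ℤ)))) Λ)
    (hΔ : HasPf (fun m : ℕ+ => α (lightMode a i j (-ε) m) * γ (c (-(m : ℤ)))) Δ)
    (hΔ' : HasPf (fun m : ℕ+ => α (lightMode a i j ε m) * γ (c (-(m : ℤ)))) Δ') :
    (α (L 0 - h • 1 - R) + γ N) * Λ - Λ * (α (L 0 - h • 1 - R) + γ N)
      = -Λ - ((η i / 2 * (z i + -ε * z j)) • Δ' - (η i / 2 * (z i + ε * z j)) • Δ) := by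
  refine (hΛ.comm' _).unique ((hΛ.neg.sub ((hΔ'.smul _).sub (hΔ.smul _))).congr fun m => ?_)
  have hm := pnat_pos m
  have h1 := hG.count_comm_c (w := fun m => (m : ℂ) - 1) hN (-m)
  rw [if_pos (by omega), neg_neg] at h1
  have h2 := hM.virasoro_comm (le_refl 0) m
  have h3 := hR.comm_virasoro hM hm.ne'
  rw [zero_add, if_neg hm.ne'] at h2
  have h4 : (L 0 - h • 1 - R) * L m - L m * (L 0 - h • 1 - R) = (-(m : ℂ)) • L m
      - (η i / 2) • ((z i + -ε * z j) • lightMode a i j ε m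
        - (z i + ε * z j) • lightMode a i j (-ε) m) := by
    push_cast at h2
    simp only [sub_mul, mul_sub, smul_mul_assoc, mul_smul_comm, one_mul, mul_one]
    linear_combination (norm := module) h2 - h3
  rw [hT.comm_mul h4 h1]
  simp only [← smul_mul_assoc, ← sub_mul, ← neg_mul, ← map_smul, ← map_neg, ← map_sub]
  congr 2
  push_cast
  module

omit hM hR in
-- Each term of ∂̄ has degree `(m - 1) + (n - 1) - (m + n - 1) = -1`.
theorem grading_comm_delBar {E : Module.End ℂ G}
    (hE : HasPf (fun q : ℕ+ × ℕ+ => (-(((q.1 : ℤ) - (q.2 : ℤ) : ℤ) : ℂ) / 2) •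
      (c (-(q.1 : ℤ)) * c (-(q.2 : ℤ)) * b ((q.2 : ℤ) + (q.1 : ℤ)))) E) (X : Module.End ℂ M) :
    (α X + γ N) * γ E - γ E * (α X + γ N) = -γ E := by
  have h1 : N * E - E * N = (-1 : ℂ) • E := by
    refine IsGhost.comm_delBar hE (s := fun m => (m : ℂ) - 1) (t := fun m => -((m : ℂ) - 1))
      (fun m => ?_) (fun m => ?_) fun m n => ?_
    · have hm := pnat_pos m
      have h1 := hG.count_comm_c (w := fun m => (m : ℂ) - 1) hN (-m)
      rwa [if_pos (by omega), neg_neg] at h1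
    · have h1 := hG.count_comm_b (w := fun m => (m : ℂ) - 1) hN m
      rwa [if_pos (pnat_pos m)] at h1
    · push_cast
      ring
  have h2 := congrArg γ h1
  rw [map_sub, map_mul, map_mul, map_smul] at h2
  have h3 := hT.comm X E
  rw [add_mul, mul_add]
  linear_combination (norm := module) h2 - h3

end

/-! ### Compatibility with the level operator -/

section Level

variable (hT : IsTensor α γ) (hM : IsMatter η a vac z u q w L) (hG : IsGhost c b vac' ℓ d)

include hT hG

omit hG in
theorem level_comm_mode {X : Module.End ℂ M} {Y : Module.End ℂ G} {s t : ℂ}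
    (hX : L 0 * X - X * L 0 = s • X) (hY : ℓ 0 * Y - Y * ℓ 0 = t • Y) (hst : s + t = 0) :
    (α (L 0) + γ (ℓ 0)) * (α X * γ Y) = (α X * γ Y) * (α (L 0) + γ (ℓ 0)) := by
  rw [← sub_eq_zero, hT.comm_mul hX hY, ← add_smul, hst, zero_smul, map_zero, zero_mul]

include hM

theorem level_comm_differential {Λ : Module.End ℂ V} {E : Module.End ℂ G}
    (hΛ : HasPf (fun m : ℕ+ => α (L m) * γ (c (-(m : ℤ)))) Λ)
    (hE : HasPf (fun q : ℕ+ × ℕ+ => (-(((q.1 : ℤ) - (q.2 : ℤ) : ℤ) : ℂ) / 2) •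
      (c (-(q.1 : ℤ)) * c (-(q.2 : ℤ)) * b ((q.2 : ℤ) + (q.1 : ℤ)))) E) :
    (α (L 0) + γ (ℓ 0)) * (Λ + γ E) = (Λ + γ E) * (α (L 0) + γ (ℓ 0)) := by
  have hc : ∀ m : ℕ+, ℓ 0 * c (-m) - c (-m) * ℓ 0 = (m : ℂ) • c (-m) := fun m => by
    have := hG.virasoro_comm_c 0 (-m)
    rw [zero_add] at this
    rw [this]
    push_cast
    module
  have hb : ∀ m : ℕ+, ℓ 0 * b m - b m * ℓ 0 = (-(m : ℂ)) • b m := fun m => by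
    have := hG.virasoro_comm_b 0 m
    rw [zero_add] at this
    rw [this]
    push_cast
    module
  have h1 : (α (L 0) + γ (ℓ 0)) * Λ = Λ * (α (L 0) + γ (ℓ 0)) := by
    refine (hΛ.mul_left _).unique ((hΛ.mul_right _).congr fun m => ?_)
    have hm := pnat_pos m
    have h2 := hM.virasoro_comm (le_refl 0) m
    rw [zero_add, if_neg hm.ne', zero_smul, add_zero] at h2
    refine level_comm_mode hT h2 (hc m) ?_
    push_cast
    ring
  have h2 : ℓ 0 * E - E * ℓ 0 = (0 : ℂ) • E :=
    IsGhost.comm_delBar hE (s := fun m => (m : ℂ)) (t := fun m => -(m : ℂ)) hc hb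
      fun m n => by push_cast; ring
  have h3 := congrArg γ h2
  rw [map_sub, map_mul, map_mul, map_smul] at h3
  have h4 := hT.comm (L 0) E
  simp only [add_mul, mul_add] at h1 ⊢
  linear_combination (norm := module) h1 + h3 - h4

theorem level_comm_homotopy (hR : IsRotation η a vac u i j ε R) {K : Module.End ℂ V}
    (hK : HasPf (fun n : ℕ+ => α (lightMode a i j ε (-n)) * γ (b n)) K) :
    (α (L 0) + γ (ℓ 0)) * K = K * (α (L 0) + γ (ℓ 0)) := by
  refine (hK.mul_left _).unique ((hK.mul_right _).congr fun n => ?_)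
  have h2 := hR.virasoro_comm_light hM ε 0 (-n)
  have h3 := hG.virasoro_comm_b 0 n
  rw [zero_add] at h2 h3
  refine level_comm_mode hT h2 h3 ?_
  push_cast
  ring

omit hM in
theorem level_mem_cochainSpace {C B : Module.End ℂ G}
    (hC : HasPf (fun m : ℕ+ => c (-(m : ℤ)) * b m) C)
    (hB : HasPf (fun m : ℕ+ => b (-(m : ℤ)) * c m) B) {A : ℕ → ℂ} {x y : ℂ} {v : V}
    (hv : v ∈ cochainSpace A (fun n => γ (c n)) (γ (b 0)) (γ C) (γ B) x y) :
    (α (L 0) + γ (ℓ 0)) v ∈ cochainSpace A (fun n => γ (c n)) (γ (b 0)) (γ C) (γ B) x y := by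
  have key : ∀ (Y : Module.End ℂ G) (t : ℂ), ℓ 0 * Y - Y * ℓ 0 = t • Y →
      ∀ v, γ Y ((α (L 0) + γ (ℓ 0)) v) = (α (L 0) + γ (ℓ 0)) (γ Y v) - t • γ Y v := by
    intro Y t hY v
    have h1 := hT.comm_mul (show L 0 * 1 - 1 * L 0 = 0 by simp) hY
    rw [zero_add, map_smul, map_one, one_mul, smul_mul_assoc, one_mul] at h1
    have h2 := LinearMap.congr_fun h1 v
    simp only [LinearMap.sub_apply, Module.End.mul_apply, LinearMap.smul_apply] at h2
    rw [← h2, sub_sub_cancel]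
  rw [mem_cochainSpace] at hv ⊢
  obtain ⟨h1, h2, h3, h4⟩ := hv
  refine ⟨fun n => ?_, ?_, ?_, ?_⟩
  · have := hG.virasoro_comm_c 0 n
    rw [zero_add] at this
    rw [key _ _ this, smul_sub, ← map_smul, h1, map_zero, smul_comm, h1, smul_zero, sub_zero]
  · have := hG.virasoro_comm_b 0 0
    rw [zero_add] at this
    rw [key _ _ this, h2, map_zero, smul_zero, sub_zero]
  · rw [key C 0 (by rw [hG.virasoro_zero_comm_countC hC, sub_self, zero_smul]), h3, map_smul,
      zero_smul, sub_zero]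
  · rw [key B 0 (by rw [hG.virasoro_zero_comm_countB hB, sub_self, zero_smul]), h4, map_smul,
      zero_smul, sub_zero]

end Level

/-! ### Bidegrees on the tensor product -/

section Homogeneous

variable (hT : IsTensor α γ) (hG : IsGhost c b vac' ℓ d) {C B : Module.End ℂ G}
  (hC : HasPf (fun m : ℕ+ => c (-(m : ℤ)) * b m) C)
  (hB : HasPf (fun m : ℕ+ => b (-(m : ℤ)) * c m) B)

include hT

theorem homogeneous_matter (X : Module.End ℂ M) :
    Homogeneous (fun n => γ (c n)) (γ (b 0)) (γ C) (γ B) 1 0 (α X) where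
  c n _ := by rw [one_smul, hT.comm]
  b := by rw [one_smul, hT.comm]
  countC := by rw [zero_smul, hT.comm, sub_self]
  countB := hT.comm _ _

include hG hC hB

theorem homogeneous_hasPf_c {X : ℕ+ → Module.End ℂ M} {Λ : Module.End ℂ V}
    (hΛ : HasPf (fun m : ℕ+ => α (X m) * γ (c (-(m : ℤ)))) Λ) :
    Homogeneous (fun n => γ (c n)) (γ (b 0)) (γ C) (γ B) (-1) 1 Λ :=
  .hasPf hΛ fun m => by
    simpa using (homogeneous_matter hT (X m)).mul ((hG.homogeneous_c hC hB m).map γ)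

theorem homogeneous_hasPf_b {X : ℕ+ → Module.End ℂ M} {K : Module.End ℂ V}
    (hK : HasPf (fun n : ℕ+ => α (X n) * γ (b n)) K) :
    Homogeneous (fun n => γ (c n)) (γ (b 0)) (γ C) (γ B) (-1) (-1) K :=
  .hasPf hK fun m => by
    simpa using (homogeneous_matter hT (X m)).mul ((hG.homogeneous_b hC hB m).map γ)

end Homogeneous

section Existence

variable (hT : IsTensor α γ)

include hT

theorem pointwiseFinite_left {X : ℕ+ → Module.End ℂ M} (Y : ℕ+ → Module.End ℂ G)
    (h : ∀ v, ∃ N : ℕ, ∀ m : ℕ+, N ≤ (m : ℕ) → X m v = 0) :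
    PointwiseFinite fun m : ℕ+ => α (X m) * γ (Y m) :=
  pointwiseFinite_of_eventually fun v => by
    obtain ⟨N, hN⟩ := hT.finite_left h v
    exact ⟨N, fun m hm => by rw [← hT.comm, Module.End.mul_apply, hN m hm, map_zero]⟩

theorem pointwiseFinite_right (X : ℕ+ → Module.End ℂ M) {Y : ℕ+ → Module.End ℂ G}
    (h : ∀ v, ∃ N : ℕ, ∀ m : ℕ+, N ≤ (m : ℕ) → Y m v = 0) :
    PointwiseFinite fun m : ℕ+ => α (X m) * γ (Y m) :=
  pointwiseFinite_of_eventually fun v => by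
    obtain ⟨N, hN⟩ := hT.finite_right h v
    exact ⟨N, fun m hm => by rw [Module.End.mul_apply, hN m hm, map_zero]⟩

omit hT in
theorem IsMatter.finite_lightMode (hM : IsMatter η a vac z u q w L) (e : ℂ) (v : M) :
    ∃ N : ℕ, ∀ m : ℕ+, N ≤ (m : ℕ) → lightMode a i j e m v = 0 := by
  obtain ⟨N, hN⟩ := hM.finite v
  refine ⟨N, fun m hm => ?_⟩
  have := hN m (by exact_mod_cast hm)
  simp [lightMode, this]

end Existence

theorem homogeneous_differential (hT : IsTensor α γ) (hG : IsGhost c b vac' ℓ d)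
    {Λ : Module.End ℂ V} {E C B : Module.End ℂ G}
    (hΛ : HasPf (fun m : ℕ+ => α (L m) * γ (c (-(m : ℤ)))) Λ)
    (hE : HasPf (fun q : ℕ+ × ℕ+ => (-(((q.1 : ℤ) - (q.2 : ℤ) : ℤ) : ℂ) / 2) •
      (c (-(q.1 : ℤ)) * c (-(q.2 : ℤ)) * b ((q.2 : ℤ) + (q.1 : ℤ)))) E)
    (hC : HasPf (fun m : ℕ+ => c (-(m : ℤ)) * b m) C)
    (hB : HasPf (fun m : ℕ+ => b (-(m : ℤ)) * c m) B) :
    Homogeneous (fun n => γ (c n)) (γ (b 0)) (γ C) (γ B) (-1) 1 (Λ + γ E) :=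
  (homogeneous_hasPf_c hT hG hC hB hΛ).add ((hG.homogeneous_delBar hC hB hE).map γ)

/-- A homotopy whose anticommutator with the polarized differential is bijective in positive ghost
degree. -/
theorem exists_homotopy (hT : IsTensor α γ) (hM : IsMatter η a vac z u q w L)
    (hG : IsGhost c b vac' ℓ d) (hR : IsRotation η a vac u i j ε R) (hκ : z i + ε * z j ≠ 0)
    {Λ : Module.End ℂ V} {E C B : Module.End ℂ G}
    (hΛ : HasPf (fun m : ℕ+ => α (L m) * γ (c (-(m : ℤ)))) Λ)
    (hE : HasPf (fun q : ℕ+ × ℕ+ => (-(((q.1 : ℤ) - (q.2 : ℤ) : ℤ) : ℂ) / 2) •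
      (c (-(q.1 : ℤ)) * c (-(q.2 : ℤ)) * b ((q.2 : ℤ) + (q.1 : ℤ)))) E)
    (hC : HasPf (fun m : ℕ+ => c (-(m : ℤ)) * b m) C)
    (hB : HasPf (fun m : ℕ+ => b (-(m : ℤ)) * c m) B) (A : ℕ → ℂ) :
    ∃ K : Module.End ℂ V, Homogeneous (fun n => γ (c n)) (γ (b 0)) (γ C) (γ B) (-1) (-1) K ∧
      (α (L 0) + γ (ℓ 0)) * K = K * (α (L 0) + γ (ℓ 0)) ∧ ∀ x y : ℂ, (∀ n : ℕ, -x ≠ n) →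
        (∀ v ∈ cochainSpace A (fun n => γ (c n)) (γ (b 0)) (γ C) (γ B) x y,
          ((Λ + γ E) * K + K * (Λ + γ E)) v = 0 → v = 0) ∧
        ∀ v ∈ cochainSpace A (fun n => γ (c n)) (γ (b 0)) (γ C) (γ B) x y,
          ∃ u ∈ cochainSpace A (fun n => γ (c n)) (γ (b 0)) (γ C) (γ B) x y,
            ((Λ + γ E) * K + K * (Λ + γ E)) u = v := by
  obtain ⟨K, hK⟩ : ∃ K, HasPf (fun n : ℕ+ => α (lightMode a i j ε (-n)) * γ (b n)) K :=
    ⟨_, hasPf_pfSum (pointwiseFinite_right hT _ hG.finite_b)⟩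
  obtain ⟨Δ, hΔ⟩ : ∃ Δ, HasPf (fun m : ℕ+ => α (lightMode a i j (-ε) m) * γ (c (-(m : ℤ)))) Δ :=
    ⟨_, hasPf_pfSum (pointwiseFinite_left hT _ (hM.finite_lightMode _))⟩
  obtain ⟨Δ', hΔ'⟩ : ∃ Δ, HasPf (fun m : ℕ+ => α (lightMode a i j ε m) * γ (c (-(m : ℤ)))) Δ :=
    ⟨_, hasPf_pfSum (pointwiseFinite_left hT _ (hM.finite_lightMode _))⟩
  obtain ⟨N, hN⟩ : ∃ N, HasPf (fun m : ℕ+ => (((m : ℤ) : ℂ) - 1) • (c (-(m : ℤ)) * b m)) N :=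
    ⟨_, hasPf_pfSum (hG.pointwiseFinite_count fun m => (m : ℂ) - 1)⟩
  obtain ⟨W, hW⟩ : ∃ W, HasPf (fun m : ℕ+ => (η i / 2) •
      (lightMode a i j ε (-m) * lightMode a i j (-ε) m)) W := by
    refine ⟨_, hasPf_pfSum (pointwiseFinite_of_eventually fun v => ?_)⟩
    obtain ⟨n, hn⟩ := hM.finite_lightMode (i := i) (j := j) (-ε) v
    exact ⟨n, fun m hm => by simp [hn m hm]⟩
  -- Two ghost weights are in play: `N` gives `c_{-m}` weight `m - 1` and enters the grading, while
  -- `N + C` gives it weight `m` and enters the leading term.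
  have hN' : HasPf (fun m : ℕ+ => (m : ℂ) • (c (-(m : ℤ)) * b m)) (N + C) :=
    (hN.add hC).congr fun m => by push_cast; module
  have hNat : NatDiag N := hG.natDiag_count (w := fun m => (m : ℂ) - 1) hN fun m =>
    ⟨(m : ℕ) - 1, by rw [Nat.cast_sub m.pos]; simp⟩
  have hNat' : NatDiag (N + C) := hG.natDiag_count (w := fun m => (m : ℂ)) hN' fun m =>
    ⟨m, by simp⟩
  set δ := Λ + γ E with hδdef
  set X := α (L 0 - ((1 / 2) * ∑ i, η i * z i ^ 2 + w) • 1 - R) + γ N with hX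
  have hXdiag : NatDiag X := hT.natDiag (hR.natDiag_weight hM) hNat
  have hWdiag : NatDiag (α W + γ (N + C)) := hT.natDiag (hR.natDiag_count hM hW) hNat'
  have hWdiag' : NatDiag (α W + γ N) := hT.natDiag (hR.natDiag_count hM hW) hNat
  have hWeq := lightMode_anticomm hT hM hG hR hΔ hK hW hN'
  have hXK : X * K - K * X = (0 : ℂ) • K := by
    rw [grading_comm_homotopy hT hM hG hR hN _ hK, zero_smul]
  have hXΔ : X * Δ - Δ * X = (0 : ℂ) • Δ := by
    rw [grading_comm_lightMode hT hM hG hR hN _ _ (-1) (fun n hn => by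
      rw [hR.comm_minus hM hn, neg_one_smul]) hΔ]
    module
  have hXΔ' : X * Δ' - Δ' * X = (-2 : ℂ) • Δ' := by
    rw [grading_comm_lightMode hT hM hG hR hN _ _ 1 (fun n hn => by
      rw [hR.comm_plus hM hn, one_smul]) hΔ']
    module
  have hXΛ := grading_comm_virasoro hT hM hG hR hN
    ((1 / 2) * ∑ i, η i * z i ^ 2 + w) hΛ hΔ hΔ'
  have hXE := grading_comm_delBar hT hG hN hE
    (L 0 - ((1 / 2) * ∑ i, η i * z i ^ 2 + w) • 1 - R)
  rw [← hX] at hXΛ hXE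
  set k := η i / 2 * (z i + ε * z j) with hk
  set k' := η i / 2 * (z i + -ε * z j) with hk'
  have hXδ : X * (δ - k • Δ - k' • Δ') - (δ - k • Δ - k' • Δ') * X
      = (-1 : ℂ) • (δ - k • Δ - k' • Δ') := by
    rw [hδdef]
    simp only [mul_sub, sub_mul, mul_add, add_mul, smul_mul_assoc, mul_smul_comm]
    linear_combination (norm := module) hXΛ + hXE - k • hXΔ - k' • hXΔ'
  have gδ : Homogeneous (fun n => γ (c n)) (γ (b 0)) (γ C) (γ B) (-1) 1 δ :=
    homogeneous_differential hT hG hΛ hE hC hB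
  have gΔ := homogeneous_hasPf_c hT hG hC hB hΔ
  have gΔ' := homogeneous_hasPf_c hT hG hC hB hΔ'
  have gK := homogeneous_hasPf_b hT hG hC hB hK
  have gW : Homogeneous (fun n => γ (c n)) (γ (b 0)) (γ C) (γ B) 1 0 (α W + γ (N + C)) :=
    (homogeneous_matter hT W).add
      ((hG.homogeneous_count hC hB (w := fun m => (m : ℂ)) hN').map γ)
  have anti : ∀ {O}, Homogeneous (fun n => γ (c n)) (γ (b 0)) (γ C) (γ B) (-1) 1 O →
      Homogeneous (fun n => γ (c n)) (γ (b 0)) (γ C) (γ B) 1 0 (O * K + K * O) := fun {O} hO => by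
    have h1 := hO.mul gK
    have h2 := gK.mul hO
    norm_num at h1 h2
    exact h1.add h2
  refine ⟨K, gK, level_comm_homotopy hT hM hG hR hK, fun x y hx => ?_⟩
  have hmap : ∀ {O}, Homogeneous (fun n => γ (c n)) (γ (b 0)) (γ C) (γ B) 1 0 O →
      ∀ v ∈ cochainSpace A (fun n => γ (c n)) (γ (b 0)) (γ C) (γ B) x y,
        O v ∈ cochainSpace A (fun n => γ (c n)) (γ (b 0)) (γ C) (γ B) x y := fun hO v hv => by
    simpa using hO.map_mem hv
  -- Decomposition by `X`-degrees `0`, `-1` and `-2`; `K` has degree `0`, so the degrees are those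
  -- of the three parts of `δ`.
  have hsplit : δ * K + K * δ = (z i + ε * z j) • (α W + γ (N + C))
      + ((δ - k • Δ - k' • Δ') * K + K * (δ - k • Δ - k' • Δ'))
      + (k' • Δ' * K + K * (k' • Δ')) := by
    rw [← hWeq, hk]
    simp only [mul_sub, sub_mul, smul_mul_assoc, mul_smul_comm]
    module
  have hXW : X * (α W + γ (N + C)) = (α W + γ (N + C)) * X := by
    have := comm_comm_add_comm hXΔ hXK
    rw [add_zero, zero_smul, sub_eq_zero] at this
    rw [← hWeq, mul_smul_comm, smul_mul_assoc, this]
  exact bijective_of_perturbation hXdiag hWdiag hXW hκ hsplit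
    (by rw [comm_comm_add_comm hXδ hXK, add_zero, neg_one_smul])
    (by
      rw [comm_comm_add_comm (s := -2) (t := 0) ?_ hXK, add_zero]
      rw [mul_smul_comm, smul_mul_assoc, ← smul_sub, hXΔ', smul_comm])
    (hmap gW) (hmap (anti ((gδ.sub (gΔ.smul k)).sub (gΔ'.smul k')))) (hmap (anti (gΔ'.smul k')))
    -- In ghost degree `x` the operator `C` acts by `x`. A kernel vector of the leading term would
    -- be an eigenvector of `α W + γ N` with eigenvalue `-x`, which is not natural.
    (fun v hv h0 => hWdiag'.eq_zero_of_map_eq (s := -x) hx (by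
      have := (mem_cochainSpace.mp hv).2.2.1
      rw [map_add, ← add_assoc, LinearMap.add_apply, this] at h0
      rw [neg_smul]
      exact eq_neg_of_add_eq_zero_left h0))

/-- **Vanishing of the cohomology** of the polarized differential `∑ L_m c_{-m} + ∂̄` in positive
ghost degree, over a momentum with a nonzero light-cone component. -/
theorem exists_primitive (hT : IsTensor α γ) (hM : IsMatter η a vac z u q w L)
    (hG : IsGhost c b vac' ℓ d) (hR : IsRotation η a vac u i j ε R) (hκ : z i + ε * z j ≠ 0)
    {Λ : Module.End ℂ V} {E C B : Module.End ℂ G}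
    (hΛ : HasPf (fun m : ℕ+ => α (L m) * γ (c (-(m : ℤ)))) Λ)
    (hE : HasPf (fun q : ℕ+ × ℕ+ => (-(((q.1 : ℤ) - (q.2 : ℤ) : ℤ) : ℂ) / 2) •
      (c (-(q.1 : ℤ)) * c (-(q.2 : ℤ)) * b ((q.2 : ℤ) + (q.1 : ℤ)))) E)
    (hC : HasPf (fun m : ℕ+ => c (-(m : ℤ)) * b m) C)
    (hB : HasPf (fun m : ℕ+ => b (-(m : ℤ)) * c m) B) (A : ℕ → ℂ) {x y : ℂ} (hx : ∀ n : ℕ, -x ≠ n) {Ψ : V}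
    (hΨ : Ψ ∈ cochainSpace A (fun n => γ (c n)) (γ (b 0)) (γ C) (γ B) x y)
    (hδ : (Λ + γ E) Ψ = 0) :
    ∃ Φ ∈ cochainSpace A (fun n => γ (c n)) (γ (b 0)) (γ C) (γ B) (x - 1) y,
      (Λ + γ E) Φ = Ψ ∧ ∀ ν : ℂ, (α (L 0) + γ (ℓ 0)) Ψ = ν • Ψ → (α (L 0) + γ (ℓ 0)) Φ = ν • Φ := by
  obtain ⟨K, gK, hHK, hbij⟩ := exists_homotopy hT hM hG hR hκ hΛ hE hC hB A
  have gδ := homogeneous_differential hT hG hΛ hE hC hB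
  have hHδ := level_comm_differential hT hM hG hΛ hE
  have hδδ := polarizedDifferential_sq hT hM hG hΛ hE
  generalize Λ + γ E = δ at *
  have hmem := fun {v} => level_mem_cochainSpace (L := L) (v := v) (A := A) (x := x) (y := y) hT hG hC hB
  generalize α (L 0) + γ (ℓ 0) = H at *
  have hT0 : δ * (δ * K + K * δ) = (δ * K + K * δ) * δ := by
    rw [mul_add, add_mul, ← mul_assoc, hδδ, zero_mul, zero_add, mul_assoc K, hδδ, mul_zero,
      add_zero, mul_assoc]
  have hHT : H * (δ * K + K * δ) = (δ * K + K * δ) * H := by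
    rw [mul_add, add_mul, ← mul_assoc, hHδ, mul_assoc, hHK, ← mul_assoc, ← mul_assoc, hHK,
      mul_assoc K, hHδ, mul_assoc, mul_assoc]
  -- Since `T = δ K + K δ` commutes with `δ`, the image `δ Φ` is in the kernel of `T` in degree `x +
  -- 1` and hence zero. Then `Ψ = T Φ = δ (K Φ)`.
  obtain ⟨Φ, hΦ, hΦΨ⟩ := (hbij x y hx).2 Ψ hΨ
  have h1 : δ Φ = 0 := by
    refine (hbij (x + 1) y fun n hn => hx (n + 1) ?_).1 _ (gδ.map_mem hΦ) ?_
    · push_cast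
      linear_combination hn
    · have := LinearMap.congr_fun hT0 Φ
      rw [Module.End.mul_apply, Module.End.mul_apply, hΦΨ, hδ] at this
      exact this.symm
  refine ⟨K Φ, by simpa [sub_eq_add_neg] using gK.map_mem hΦ, ?_, fun ν hν => ?_⟩
  · rw [← hΦΨ, LinearMap.add_apply, Module.End.mul_apply, Module.End.mul_apply, h1, map_zero,
      add_zero]
  · have h2 : H Φ - ν • Φ = 0 := by
      refine (hbij x y hx).1 _ (Submodule.sub_mem _ (hmem hΦ)
        (Submodule.smul_mem _ _ hΦ)) ?_
      have := LinearMap.congr_fun hHT Φ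
      rw [Module.End.mul_apply, Module.End.mul_apply, hΦΨ, hν] at this
      rw [map_sub, map_smul, ← this, hΦΨ, sub_self]
    have h3 := LinearMap.congr_fun hHK Φ
    rw [Module.End.mul_apply, Module.End.mul_apply, sub_eq_zero.mp h2, map_smul] at h3
    exact h3

end Homotopy

/-! ### The ghost sector of the string -/

theorem isGhost : IsGhost ghostC ghostB (1 : Ghost) ghostVirasoro ghostDifferential where
  cc := ghostC_ghostC
  bb := ghostB_ghostB
  bc := ghostB_ghostC
  finite := ghost_eventually_zero
  c_vac _ := ghostC_one
  b_vac _ := ghostB_one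
  gen P h1 hc hb := ghost_gen P h1 fun j v hv => by
    obtain ⟨n, hn, h⟩ | ⟨n, hn, h⟩ := ghostCreate_eq j
    · rw [h]; exact hc n hn v hv
    · rw [h]; exact hb n hn v hv
  virasoro m := hasPf_pfSum (ghostVirasoro_pointwiseFinite m)
  differential := ⟨_, _, hasPf_pfSum _, hasPf_pfSum _, rfl⟩

namespace MassiveString

variable (S : MassiveString)

/-! ### The matter sector of the string -/

theorem isMatter (p : S.Momentum) : IsMatter (fun i => (S.metric i : ℂ)) (S.osc p)
    (1 : S.Matter) (fun i => (S.zeroMode p i : ℂ)) none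
    (2 * Complex.I * (S.β : ℂ) ^ (1 / 2 : ℂ)) (2 * (S.β : ℂ)) (S.virasoro p) where
  metric i := by exact_mod_cast S.metric_mul_self i
  comm := S.osc_comm p
  zero := S.osc_zero p
  pos_vac i _ := S.osc_one p i
  finite := S.osc_eventually_zero p
  gen P h1 hP := matter_gen P h1 fun j v hv => by
    have := hP j.1 (Int.negSucc j.2) (Int.negSucc_lt_zero _) v hv
    exact this
  charge := by
    have h1 : ((S.β : ℂ) ^ (1 / 2 : ℂ)) ^ 2 = S.β := by
      rw [← Complex.cpow_nat_mul]
      norm_num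
    linear_combination (-4 : ℂ) * h1 + 4 * ((S.β : ℂ) ^ (1 / 2 : ℂ)) ^ 2 * Complex.I_sq
  metric_u := by simp [metric]
  zero_u := by simp [zeroMode]
  virasoro m := ⟨_, hasPf_pfSum (S.virasoro_pointwiseFinite p m), rfl⟩

end MassiveString

/-! ### Operators on a tensor product -/

section TensorProduct

variable {M G : Type*} [AddCommGroup M] [Module ℂ M] [AddCommGroup G] [Module ℂ G]

theorem rTensorAlgHom_tmul (A : Module.End ℂ M) (x : M) (y : G) :
    Module.End.rTensorAlgHom ℂ M G A (x ⊗ₜ y) = A x ⊗ₜ y := rfl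

theorem lTensorAlgHom_tmul (B : Module.End ℂ G) (x : M) (y : G) :
    Module.End.lTensorAlgHom ℂ G M B (x ⊗ₜ y) = x ⊗ₜ B y := rfl

theorem hasPf_tensor {ι : Type*} {T : ι → Module.End ℂ (M ⊗[ℂ] G)} {A : Module.End ℂ (M ⊗[ℂ] G)}
    (h : ∀ x y, {i | T i (x ⊗ₜ y) ≠ 0}.Finite ∧ A (x ⊗ₜ y) = ∑ᶠ i, T i (x ⊗ₜ y)) : HasPf T A := by
  have hT : PointwiseFinite T := fun v => by
    induction v using TensorProduct.induction_on with
    | zero => simp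
    | tmul x y => exact (h x y).1
    | add v w hv hw =>
      refine (hv.union hw).subset fun i hi => ?_
      simp only [Set.mem_ofPred_eq, Set.mem_union, map_add] at hi ⊢
      by_contra hc
      push Not at hc
      exact hi (by rw [hc.1, hc.2, add_zero])
  have : A = pfSum T hT := TensorProduct.ext' fun x y => (h x y).2
  rw [this]
  exact hasPf_pfSum hT

theorem tensor_eventually {T : ℕ+ → Module.End ℂ (M ⊗[ℂ] G)}
    (h : ∀ x y, ∃ N : ℕ, ∀ m : ℕ+, N ≤ (m : ℕ) → T m (x ⊗ₜ y) = 0) (v : M ⊗[ℂ] G) :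
    ∃ N : ℕ, ∀ m : ℕ+, N ≤ (m : ℕ) → T m v = 0 := by
  induction v using TensorProduct.induction_on with
  | zero => exact ⟨0, fun m _ => map_zero _⟩
  | tmul x y => exact h x y
  | add v w hv hw =>
    obtain ⟨N, hN⟩ := hv
    obtain ⟨N', hN'⟩ := hw
    exact ⟨max N N', fun m hm => by
      rw [map_add, hN m (le_trans (le_max_left _ _) hm), hN' m (le_trans (le_max_right _ _) hm),
        add_zero]⟩

theorem isTensor : IsTensor (Module.End.rTensorAlgHom ℂ M G) (Module.End.lTensorAlgHom ℂ G M) where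
  comm A B := TensorProduct.ext' fun _ _ => rfl
  left {ι T A} h := hasPf_tensor fun x y => by
    refine ⟨(h.1 x).subset fun i hi => ?_, ?_⟩
    · simp only [Set.mem_ofPred_eq, rTensorAlgHom_tmul] at hi ⊢
      exact fun h0 => hi (by rw [h0, TensorProduct.zero_tmul])
    · simp only [rTensorAlgHom_tmul, h.2]
      exact ((TensorProduct.mk ℂ M G).flip y).toAddMonoidHom.map_finsum (h.1 x)
  right {ι T A} h := hasPf_tensor fun x y => by
    refine ⟨(h.1 y).subset fun i hi => ?_, ?_⟩
    · simp only [Set.mem_ofPred_eq, lTensorAlgHom_tmul] at hi ⊢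
      exact fun h0 => hi (by rw [h0, TensorProduct.tmul_zero])
    · simp only [lTensorAlgHom_tmul, h.2]
      exact (TensorProduct.mk ℂ M G x).toAddMonoidHom.map_finsum (h.1 y)
  finite_left h := tensor_eventually fun x y => (h x).imp fun N hN m hm => by
    rw [rTensorAlgHom_tmul, hN m hm, TensorProduct.zero_tmul]
  finite_right h := tensor_eventually fun x y => (h y).imp fun N hN m hm => by
    rw [lTensorAlgHom_tmul, hN m hm, TensorProduct.tmul_zero]
  natDiag {A B} hA hB := by
    refine Submodule.eq_top_iff'.mpr fun v => ?_
    induction v using TensorProduct.induction_on with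
    | zero => exact zero_mem _
    | add v w hv hw => exact add_mem hv hw
    | tmul x y =>
      have hx : x ∈ ⨆ n : ℕ, Module.End.eigenspace A (n : ℂ) := by
        rw [show (⨆ n : ℕ, Module.End.eigenspace A (n : ℂ)) = ⊤ from hA]; trivial
      have hy : y ∈ ⨆ n : ℕ, Module.End.eigenspace B (n : ℂ) := by
        rw [show (⨆ n : ℕ, Module.End.eigenspace B (n : ℂ)) = ⊤ from hB]; trivial
      refine Submodule.iSup_induction _ (motive := fun x => x ⊗ₜ y ∈ _) hx (fun n x hx => ?_)
        (by rw [TensorProduct.zero_tmul]; exact zero_mem _)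
        fun x x' hx hx' => by rw [TensorProduct.add_tmul]; exact add_mem hx hx'
      refine Submodule.iSup_induction _ (motive := fun y => x ⊗ₜ y ∈ _) hy (fun k y hy => ?_)
        (by rw [TensorProduct.tmul_zero]; exact zero_mem _)
        fun y y' hy hy' => by rw [TensorProduct.tmul_add]; exact add_mem hy hy'
      refine Submodule.mem_iSup_of_mem (n + k) ?_
      rw [Module.End.mem_eigenspace_iff] at hx hy ⊢
      rw [LinearMap.add_apply, rTensorAlgHom_tmul, lTensorAlgHom_tmul, hx, hy, Nat.cast_add, add_smul,
        TensorProduct.smul_tmul', TensorProduct.tmul_smul]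

end TensorProduct

namespace MassiveString

variable (S : MassiveString)

theorem rTensor_eq_onMatter (A : Module.End ℂ S.Matter) :
    Module.End.rTensorAlgHom ℂ S.Matter Ghost A = S.onMatter A := rfl

theorem lTensor_eq_onGhost (B : Module.End ℂ Ghost) :
    Module.End.lTensorAlgHom ℂ Ghost S.Matter B = S.onGhost B := rfl

theorem mul_eq_map (A : Module.End ℂ S.Matter) (B : Module.End ℂ Ghost) :
    Module.End.rTensorAlgHom ℂ S.Matter Ghost A * Module.End.lTensorAlgHom ℂ Ghost S.Matter B
      = (TensorProduct.map A B : Module.End ℂ S.Space) := TensorProduct.ext' fun _ _ => rfl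

end MassiveString

theorem mul_smul_sub_smul_mul {V : Type*} [AddCommGroup V] [Module ℂ V]
    {X Y Z : Module.End ℂ V} {t : ℂ} (h : X * Y - Y * X = t • Z) (s : ℂ) :
    X * (s • Y) - s • Y * X = (s * t) • Z := by
  rw [mul_smul_comm, smul_mul_assoc, ← smul_sub, h, smul_smul]

namespace MassiveString

variable (S : MassiveString)

/-! ### Rotations in a light-cone plane -/

/-- The coefficients of the infinitesimal rotation in the plane of the labels `i`, `j`. -/
def rotationCoeff (i j : S.Label) (ε : ℂ) (l : S.Label) : ℂ :=
  if l = i then ε else if l = j then ε⁻¹ else 0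

/-- The infinitesimal rotation in the plane of the labels `i`, `j`. -/
def rotation (i j : S.Label) (ε : ℂ) : Derivation ℂ S.Matter S.Matter :=
  MvPolynomial.mkDerivation ℂ fun k =>
    S.rotationCoeff i j ε k.1 • MvPolynomial.X (Equiv.swap i j k.1, k.2)

variable {S}

theorem rotation_comm_create (i j : S.Label) (ε : ℂ) (l : S.Label) (k : ℕ) :
    ((S.rotation i j ε).toLinearMap * LinearMap.mulLeft ℂ (MvPolynomial.X (l, k))
      - LinearMap.mulLeft ℂ (MvPolynomial.X (l, k)) * (S.rotation i j ε).toLinearMap :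
        Module.End ℂ S.Matter)
      = S.rotationCoeff i j ε l • LinearMap.mulLeft ℂ (MvPolynomial.X (Equiv.swap i j l, k)) := by
  refine LinearMap.ext fun v => ?_
  simp only [LinearMap.sub_apply, Module.End.mul_apply, LinearMap.mulLeft_apply,
    Derivation.coeFn_coe, Derivation.leibniz, LinearMap.smul_apply,
    smul_eq_mul]
  rw [rotation, MvPolynomial.mkDerivation_X]
  rw [mul_comm v, smul_mul_assoc, add_sub_cancel_left]

theorem rotation_comm_annihilate (i j : S.Label) (ε : ℂ) (l : S.Label) (k : ℕ) :
    ((S.rotation i j ε).toLinearMap * (MvPolynomial.pderiv (l, k)).toLinearMap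
      - (MvPolynomial.pderiv (l, k)).toLinearMap * (S.rotation i j ε).toLinearMap :
        Module.End ℂ S.Matter)
      = (-S.rotationCoeff i j ε (Equiv.swap i j l)) •
        (MvPolynomial.pderiv (Equiv.swap i j l, k)).toLinearMap := by
  have h : ⁅S.rotation i j ε, MvPolynomial.pderiv (l, k)⁆
      = (-S.rotationCoeff i j ε (Equiv.swap i j l)) •
        (MvPolynomial.pderiv (Equiv.swap i j l, k) : Derivation ℂ S.Matter S.Matter) := by
    refine MvPolynomial.derivation_ext fun m => ?_
    have hX : S.rotation i j ε (MvPolynomial.X m)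
        = S.rotationCoeff i j ε m.1 • MvPolynomial.X (Equiv.swap i j m.1, m.2) :=
      MvPolynomial.mkDerivation_X _ _ _
    rw [Derivation.commutator_apply, hX, Derivation.map_smul, Derivation.smul_apply]
    by_cases hm : m = (Equiv.swap i j l, k)
    · subst hm
      rw [Equiv.swap_apply_self, MvPolynomial.pderiv_X_self, MvPolynomial.pderiv_X_self,
        MvPolynomial.pderiv_X, Pi.single_apply]
      split_ifs <;> simp
    · rw [MvPolynomial.pderiv_X_of_ne hm, smul_zero, MvPolynomial.pderiv_X_of_ne
        (i := (l, k)) (j := (Equiv.swap i j m.1, m.2)),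
        smul_zero, sub_zero, MvPolynomial.pderiv_X, Pi.single_apply]
      · split_ifs <;> simp
      · rintro h
        refine hm (Prod.ext ?_ (Prod.ext_iff.mp h).2)
        exact (Equiv.swap_apply_eq_iff.mp (Prod.ext_iff.mp h).1)
  refine LinearMap.ext fun v => ?_
  have := congrArg (fun D : Derivation ℂ S.Matter S.Matter => D v) h
  rw [Derivation.commutator_apply] at this
  exact this

theorem isRotation (p : S.Momentum) {i j : S.Label} (hij : i ≠ j) (hi : i ≠ none) (hj : j ≠ none)
    {ε : ℂ} (hε : ε * ε = -((S.metric i : ℂ) * (S.metric j : ℂ))) :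
    IsRotation (fun i => (S.metric i : ℂ)) (S.osc p) (1 : S.Matter) none i j ε
      (S.rotation i j ε).toLinearMap := by
  have hm : ∀ l, (S.metric l : ℂ) * S.metric l = 1 := fun l => by
    exact_mod_cast S.metric_mul_self l
  have h0 : ε ≠ 0 := by
    rintro rfl
    have h1 := hm i
    have h2 := hm j
    have : ((S.metric i : ℂ) * S.metric i) * ((S.metric j : ℂ) * S.metric j) = 0 := by
      linear_combination ((S.metric i : ℂ) * S.metric j) * hε
    rw [h1, h2] at this
    norm_num at this
  -- The generator is antisymmetric for the metric because `ε² = -η_i η_j`. Hence annihilators,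
  -- which carry a factor of the metric, rotate with the same coefficients as creators.
  have hcoeff : ∀ l, (S.metric l : ℂ) * S.rotationCoeff i j ε (Equiv.swap i j l)
      = -(S.rotationCoeff i j ε l * (S.metric (Equiv.swap i j l) : ℂ)) := fun l => by
    unfold rotationCoeff
    by_cases hli : l = i
    · subst hli
      rw [Equiv.swap_apply_left, if_neg hij.symm, if_pos rfl, if_pos rfl]
      field_simp
      linear_combination (S.metric j : ℂ) * hε - (S.metric l : ℂ) * hm j
    by_cases hlj : l = j
    · subst hlj
      rw [Equiv.swap_apply_right, if_pos rfl, if_neg hli, if_pos rfl]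
      field_simp
      linear_combination (S.metric l : ℂ) * hε - (S.metric i : ℂ) * hm l
    · rw [Equiv.swap_apply_of_ne_of_ne hli hlj, if_neg hli, if_neg hlj]
      ring
  have key : ∀ l, ∀ n : ℤ, n ≠ 0 → (S.rotation i j ε).toLinearMap * S.osc p l n
      - S.osc p l n * (S.rotation i j ε).toLinearMap
      = S.rotationCoeff i j ε l • S.osc p (Equiv.swap i j l) n := by
    rintro l ((_ | n) | n) hn
    · exact absurd rfl hn
    · have h1 := rotation_comm_annihilate i j ε l n
      simp only [osc]
      refine (mul_smul_sub_smul_mul h1 _).trans ?_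
      rw [smul_smul]
      congr 1
      linear_combination (-((n + 1 : ℕ) : ℂ)) * hcoeff l
    · exact rotation_comm_create i j ε l n
  exact
  { ne := hij
    ne_left := hi
    ne_right := hj
    null := hε
    vac := (S.rotation i j ε).map_one_eq_zero
    comm_left := fun n hn => by simpa [rotationCoeff] using key i n hn
    comm_right := fun n hn => by simpa [rotationCoeff, hij.symm] using key j n hn
    comm_of_ne := fun l n hli hlj => by
      by_cases hn : n = 0
      · subst hn
        rw [osc_zero, mul_smul_comm, smul_mul_assoc, mul_one, one_mul, sub_self]
      · rw [key l n hn, rotationCoeff, if_neg hli, if_neg hlj, zero_smul] }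

/-- Take `μ` with `p μ ≠ 0`, any second label, and a complex root `ε` of `-η_μ η_ν`, whatever the
signature of the plane. If both `z_μ + ε z_ν` and `z_μ - ε z_ν` vanished, so would `z_μ`; hence `ε`
or `-ε` works. -/
theorem exists_rotation (hd : 2 ≤ S.d) (hα : 0 < S.α) {p : S.Momentum} (hp : p ≠ 0) :
    ∃ (i j : S.Label) (ε : ℂ) (R : Module.End ℂ S.Matter),
      IsRotation (fun i => (S.metric i : ℂ)) (S.osc p) (1 : S.Matter) none i j ε R ∧
        (S.zeroMode p i : ℂ) + ε * S.zeroMode p j ≠ 0 := by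
  obtain ⟨μ, hμ⟩ := Function.ne_iff.mp hp
  have : Nontrivial (Fin S.d) := Fin.nontrivial_iff_two_le.mpr hd
  obtain ⟨ν, hν⟩ := exists_ne μ
  have hz : (S.zeroMode p (some μ) : ℂ) ≠ 0 := by
    rw [Complex.ofReal_ne_zero]
    exact div_ne_zero hμ (Real.sqrt_pos.mpr hα).ne'
  obtain ⟨ε, hε⟩ := IsAlgClosed.exists_pow_nat_eq
    (-((S.metric (some μ) : ℂ) * (S.metric (some ν) : ℂ))) two_pos
  rw [pow_two] at hε
  have hij : some μ ≠ some ν := fun h => hν (Option.some_injective _ h).symm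
  by_cases hκ : (S.zeroMode p (some μ) : ℂ) + ε * S.zeroMode p (some ν) = 0
  · refine ⟨some μ, some ν, -ε, _, isRotation p hij (by simp) (by simp) (by rw [neg_mul_neg, hε]),
      fun h => hz ?_⟩
    linear_combination (hκ + h) / 2
  · exact ⟨some μ, some ν, ε, _, isRotation p hij (by simp) (by simp) hε, hκ⟩

/-! ### The anomaly of the polarized complex -/

/-- The expression equals `(d + 48 β - 25)/12 * (m^3 - m) + 2 m (a - 1)`. Unitarity gives `a ≤ 1`,
and off the critical point `d + 48 β < 25`, so it is negative for `m ≥ 2`. -/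
theorem anomaly_ne_zero (hunitary : S.IsContinuousSeries ∨ S.IsDiscreteSeries)
    (hnoncritical : ¬ S.IsCritical) {m : ℕ} (hm : 2 ≤ m) :
    ((Fintype.card S.Label : ℂ) / 12 + 2 * (2 * (S.β : ℂ))) * (((m : ℤ) : ℂ) ^ 3 - (m : ℤ))
      - (13 * ((m : ℤ) : ℂ) ^ 3 - (m : ℤ)) / 6 + 2 * (m : ℤ) * (S.a : ℂ) ≠ 0 := by
  have key : S.a ≤ 1 ∧ S.d + 48 * S.β - 25 < 0 := by
    rcases hunitary with ⟨h1, -, h3⟩ | ⟨M, r, s, hM, hr, hrM, hs, hsr, hβ, ha⟩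
    · exact ⟨h1, by linarith⟩
    · have hM' : (2 : ℝ) ≤ M := by exact_mod_cast hM
      have hr' : (1 : ℝ) ≤ r := by exact_mod_cast hr
      have hsr' : (s : ℝ) ≤ r := by exact_mod_cast hsr
      -- The right side is `r + M (r - s)`, with `r ≥ 1` and `s ≤ r`.
      have hx : 1 ≤ ((M : ℝ) + 1) * r - M * s := by nlinarith
      constructor
      · rw [ha]
        have : 0 ≤ ((((M : ℝ) + 1) * r - M * s) ^ 2 - 1) / (4 * (M : ℝ) * ((M : ℝ) + 1)) :=
          div_nonneg (by nlinarith) (by positivity)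
        linarith
      -- For `M = 2` only `r = s = 1` is allowed, which is the excluded critical point. For `M ≥ 3`
      -- the extra term in `β` is less than `1 / 48`.
      · rcases hM.eq_or_lt with rfl | hM3
        · obtain rfl : r = 1 := by omega
          obtain rfl : s = 1 := by omega
          refine absurd ⟨?_, ?_⟩ hnoncritical
          · rw [hβ]; norm_num; ring
          · rw [ha]; norm_num
        · have hM3' : (3 : ℝ) ≤ M := by exact_mod_cast hM3
          have : 1 / (8 * (M : ℝ) * ((M : ℝ) + 1)) < 1 / 48 :=
            one_div_lt_one_div_of_lt (by norm_num) (by nlinarith)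
          rw [hβ]
          linarith
  have hm' : (2 : ℝ) ≤ m := by exact_mod_cast hm
  have h3 : 0 < (m : ℝ) ^ 3 - m := by nlinarith [mul_self_nonneg ((m : ℝ) - 1)]
  have hlt : (((S.d : ℝ) + 1) / 12 + 2 * (2 * S.β)) * ((m : ℝ) ^ 3 - m)
      - (13 * (m : ℝ) ^ 3 - m) / 6 + 2 * m * S.a < 0 := by
    have h4 := mul_neg_of_neg_of_pos key.2 h3
    have h5 : (m : ℝ) * (S.a - 1) ≤ 0 :=
      mul_nonpos_of_nonneg_of_nonpos (by linarith) (by linarith [key.1])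
    linarith
  have hcard : (Fintype.card S.Label : ℂ) = S.d + 1 := by simp
  rw [hcard]
  have := Complex.ofReal_ne_zero.mpr hlt.ne
  push_cast at this ⊢
  exact this

end MassiveString

namespace MassiveString

variable {S : MassiveString}

/-! ### The polarized complex -/

/-- The coefficient of `c_m` in the anomaly `[L_m^tot, D]`. -/
def anomaly (S : MassiveString) (m : ℕ) : ℂ :=
  ((Fintype.card S.Label : ℂ) / 12 + 2 * (2 * (S.β : ℂ))) * (((m : ℤ) : ℂ) ^ 3 - (m : ℤ))
    - (13 * ((m : ℤ) : ℂ) ^ 3 - (m : ℤ)) / 6 + 2 * (m : ℤ) * (S.a : ℂ)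

theorem hasPf_brst (p : S.Momentum) : HasPf (fun m : ℤ => Module.End.rTensorAlgHom ℂ S.Matter Ghost
      (S.virasoro p m - (if m = 0 then (S.a : ℂ) else 0) • 1)
      * Module.End.lTensorAlgHom ℂ Ghost S.Matter (ghostC (-m)))
    (pfSum _ (S.brst_pointwiseFinite p)) :=
  (hasPf_pfSum (S.brst_pointwiseFinite p)).congr fun _ => S.mul_eq_map _ _

theorem totalVirasoro_eq (p : S.Momentum) (m : ℤ) : S.totalVirasoro p m
    = Module.End.rTensorAlgHom ℂ S.Matter Ghost
        (S.virasoro p m - (if m = 0 then (S.a : ℂ) else 0) • 1)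
      + Module.End.lTensorAlgHom ℂ Ghost S.Matter (ghostVirasoro m) :=
  total_virasoro_eq isTensor isGhost (hasPf_brst p) m

/-- The condition is empty for `m = 0`, and for `m = 1` exactly when the intercept is `1`. Keeping
the scalar in front of `c_m` treats both cases at once. -/
theorem mem_polarized {p : S.Momentum} {v : S.Space} :
    v ∈ S.polarized p ↔ ∀ m : ℕ, S.anomaly m • S.onGhost (ghostC m) v = 0 := by
  have key : ∀ m : ℕ, S.totalVirasoro p m * S.brst p - S.brst p * S.totalVirasoro p m
      = S.anomaly m • S.onGhost (ghostC m) := fun m => by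
    rw [totalVirasoro_eq]
    exact total_virasoro_comm isTensor (S.isMatter p) isGhost (hasPf_brst p)
      (Int.natCast_nonneg m)
  simp only [polarized, Submodule.mem_iInf, key]
  rfl

/-- The modes `c_n` of the ghosts on the total space. -/
abbrev spaceC (S : MassiveString) (n : ℤ) : Module.End ℂ S.Space :=
  Module.End.lTensorAlgHom ℂ Ghost S.Matter (ghostC n)

/-- The polarized relative cochains of bidegree `(a, b)`. -/
abbrev bidegree (S : MassiveString) (a b : ℤ) : Submodule ℂ S.Space :=
  cochainSpace S.anomaly S.spaceC (Module.End.lTensorAlgHom ℂ Ghost S.Matter (ghostB 0))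
    (Module.End.lTensorAlgHom ℂ Ghost S.Matter countC)
    (Module.End.lTensorAlgHom ℂ Ghost S.Matter countB) a b

theorem mem_cochains {p : S.Momentum} {W : Submodule ℂ S.Space} {a b : ℤ} {v : S.Space} :
    v ∈ S.cochains p W a b ↔ v ∈ S.bidegree a b ∧ v ∈ W := by
  rw [mem_cochainSpace]
  simp only [cochains, Submodule.mem_inf, mem_polarized, LinearMap.mem_ker, LinearMap.sub_apply,
    LinearMap.smul_apply, Module.End.one_apply, sub_eq_zero]
  simp only [← lTensor_eq_onGhost]
  tauto

theorem hasPf_delBar : HasPf (fun q : ℕ+ × ℕ+ => (-(((q.1 : ℤ) - (q.2 : ℤ) : ℤ) : ℂ) / 2) •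
      (ghostC (-(q.1 : ℤ)) * ghostC (-(q.2 : ℤ)) * ghostB ((q.2 : ℤ) + (q.1 : ℤ)))) delBar :=
  ((hasPf_pfSum delBar_pointwiseFinite).smul (-(1 / 2))).congr fun q => by
    rw [smul_smul]
    congr 1
    ring

theorem hasPf_dBar (p : S.Momentum) : HasPf (fun m : ℕ+ =>
      Module.End.rTensorAlgHom ℂ S.Matter Ghost (S.virasoro p m)
      * Module.End.lTensorAlgHom ℂ Ghost S.Matter (ghostC (-(m : ℤ))))
    (pfSum _ (S.dBar_pointwiseFinite p)) :=
  (hasPf_pfSum (S.dBar_pointwiseFinite p)).congr fun _ => S.mul_eq_map _ _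

/-- On the polarized cochains the terms `c_{-m} τ_m` vanish. -/
theorem dBar_apply (hunitary : S.IsContinuousSeries ∨ S.IsDiscreteSeries)
    (hnoncritical : ¬ S.IsCritical) {p : S.Momentum} {a b : ℤ} {v : S.Space}
    (hv : v ∈ S.bidegree a b) :
    S.dBar p v = (pfSum _ (S.dBar_pointwiseFinite p)
      + Module.End.lTensorAlgHom ℂ Ghost S.Matter delBar) v := by
  have h1 : ∀ n : ℕ, 2 ≤ n → S.spaceC n v = 0 := fun n hn =>
    (smul_eq_zero.mp ((mem_cochainSpace.mp hv).1 n)).resolve_left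
      (anomaly_ne_zero hunitary hnoncritical hn)
  have h2 : ∀ m, Module.End.lTensorAlgHom ℂ Ghost S.Matter (tau m) v = 0 := fun m => by
    refine (isTensor.right (hasPf_pfSum (tau_pointwiseFinite m))).apply_eq_zero fun j => ?_
    -- The modes `c_{m+j}` in `τ_m` have index at least `2`, where the anomaly is nonzero.
    have := h1 ((m : ℕ) + j) (by have := m.pos; have := j.pos; omega)
    push_cast at this
    rw [map_smul, map_mul, LinearMap.smul_apply, Module.End.mul_apply, this, map_zero, smul_zero]
  have h3 : Module.End.lTensorAlgHom ℂ Ghost S.Matter (pfSum (fun m : ℕ+ =>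
      ghostC (-(m : ℤ)) * tau m) (pointwiseFinite_left_mul _ _ tau_pnat)) v = 0 := by
    refine (isTensor.right (hasPf_pfSum _)).apply_eq_zero fun m => ?_
    rw [map_mul, Module.End.mul_apply, h2, map_zero]
  rw [lTensor_eq_onGhost] at h3
  rw [dBar, LinearMap.add_apply, LinearMap.add_apply, h3, add_zero]
  rfl

/-- The cohomology vanishes on every subspace of fixed level. -/
theorem cohomologyVanishes_of_level (hd : 2 ≤ S.d) (hα : 0 < S.α)
    (hunitary : S.IsContinuousSeries ∨ S.IsDiscreteSeries) (hnoncritical : ¬ S.IsCritical)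
    {p : S.Momentum} (hp : p ≠ 0) {a b : ℤ} (ha : 0 < a) {W : Submodule ℂ S.Space}
    (hW : W = ⊤ ∨ ∃ ν : ℂ, ∀ v, v ∈ W ↔ (Module.End.rTensorAlgHom ℂ S.Matter Ghost (S.virasoro p 0)
      + Module.End.lTensorAlgHom ℂ Ghost S.Matter (ghostVirasoro 0)) v = ν • v) :
    S.CohomologyVanishes p W a b := by
  have hC : HasPf (fun m : ℕ+ => ghostC (-(m : ℤ)) * ghostB m) countC := hasPf_pfSum _
  have hB : HasPf (fun m : ℕ+ => ghostB (-(m : ℤ)) * ghostC m) countB := hasPf_pfSum _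
  have gδ := homogeneous_differential isTensor isGhost (hasPf_dBar p) hasPf_delBar hC hB
  have hHδ := level_comm_differential isTensor (S.isMatter p) isGhost (hasPf_dBar p) hasPf_delBar
  have hδδ := polarizedDifferential_sq isTensor (S.isMatter p) isGhost (hasPf_dBar p) hasPf_delBar
  obtain ⟨i, j, ε, R, hR, hκ⟩ := exists_rotation hd hα hp
  have hmem : ∀ v ∈ S.bidegree (a - 1) b, (pfSum _ (S.dBar_pointwiseFinite p)
      + Module.End.lTensorAlgHom ℂ Ghost S.Matter delBar) v ∈ S.bidegree a b := fun v hv => by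
    have := gδ.map_mem hv
    rwa [Int.cast_sub, Int.cast_one, sub_add_cancel] at this
  constructor
  · rintro _ ⟨v, hv, rfl⟩
    obtain ⟨hv, hvW⟩ := mem_cochains.mp hv
    have h1 := dBar_apply hunitary hnoncritical (p := p) hv
    refine ⟨mem_cochains.mpr ?_, ?_⟩
    · rw [h1]
      refine ⟨hmem v hv, ?_⟩
      rcases hW with rfl | ⟨ν, hν⟩
      · trivial
      · have h2 := LinearMap.congr_fun hHδ v
        rw [Module.End.mul_apply, Module.End.mul_apply, (hν v).mp hvW, map_smul] at h2
        exact (hν _).mpr h2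
    · change S.dBar p (S.dBar p v) = 0
      rw [h1, dBar_apply hunitary hnoncritical (hmem v hv)]
      exact LinearMap.congr_fun hδδ v
  · refine Submodule.Quotient.subsingleton_iff.mpr (Submodule.submoduleOf_eq_top.mpr ?_)
    rintro Ψ ⟨hΨ, hclosed⟩
    obtain ⟨hΨ, hΨW⟩ := mem_cochains.mp hΨ
    replace hclosed : S.dBar p Ψ = 0 := hclosed
    rw [dBar_apply hunitary hnoncritical hΨ] at hclosed
    obtain ⟨Φ, hΦ, hΦΨ, hlevel⟩ := exists_primitive isTensor (S.isMatter p) isGhost hR hκ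
      (hasPf_dBar p) hasPf_delBar hC hB S.anomaly (fun n hn => by
        have : (-a : ℤ) = n := by exact_mod_cast hn
        omega) hΨ hclosed
    have hΦ' : Φ ∈ S.bidegree (a - 1) b := by
      rw [bidegree, Int.cast_sub, Int.cast_one]
      exact hΦ
    refine ⟨Φ, mem_cochains.mpr ⟨hΦ', ?_⟩, ?_⟩
    · rcases hW with rfl | ⟨ν, hν⟩
      · trivial
      · exact (hν _).mpr (hlevel ν ((hν _).mp hΨW))
    · rw [dBar_apply hunitary hnoncritical hΦ', hΦΨ]

end MassiveString

end MassiveBRST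

end

open MassiveBRST in
theorem lemma3p2 (S : MassiveString) (hd : 2 ≤ S.d) (hα : 0 < S.α)
    (hunitary : S.IsContinuousSeries ∨ S.IsDiscreteSeries) (hnoncritical : ¬ S.IsCritical)
    (p : S.Momentum) (hp : p ≠ 0) (a b : ℤ) (ha : 0 < a) :
    S.CohomologyVanishes p (S.onShell p) a b ∧
      (∀ N : ℕ, S.CohomologyVanishes p (S.levelSpace p N) a b) ∧
      S.CohomologyVanishes p ⊤ a b := by
  -- The mass shell and the level-`N` space are the eigenspaces of `L_0 + 𝓛_0` with eigenvalues `a`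
  -- and `p²/(2α) + 2β + N`, where `a` is the intercept.
  refine ⟨?_, fun N => ?_, ?_⟩
  · refine MassiveString.cohomologyVanishes_of_level hd hα hunitary hnoncritical hp ha
      (Or.inr ⟨S.a, fun v => ?_⟩)
    rw [MassiveString.onShell, LinearMap.mem_ker, MassiveString.totalVirasoro_eq, if_pos rfl,
      map_sub, map_smul, map_one]
    simp only [LinearMap.add_apply, LinearMap.sub_apply, LinearMap.smul_apply, Module.End.one_apply]
    rw [← sub_eq_zero (b := (S.a : ℂ) • v)]
    rw [sub_add_eq_add_sub]
  · refine MassiveString.cohomologyVanishes_of_level hd hα hunitary hnoncritical hp ha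
      (Or.inr ⟨((S.momentumSq p / (2 * S.α) + 2 * S.β : ℝ) : ℂ) + N, fun v => ?_⟩)
    rw [MassiveString.levelSpace, LinearMap.mem_ker, MassiveString.levelOperator,
      ← MassiveString.rTensor_eq_onMatter, ← MassiveString.lTensor_eq_onGhost, map_sub, map_smul,
      map_one]
    simp only [LinearMap.add_apply, LinearMap.sub_apply, LinearMap.smul_apply, Module.End.one_apply]
    rw [← sub_eq_zero (b := (_ + (N : ℂ)) • v), add_smul, sub_add_eq_add_sub, sub_sub]
  · exact MassiveString.cohomologyVanishes_of_level hd hα hunitary hnoncritical hp ha (Or.inl rfl)
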